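/- Let $S(x,y)$ be a smooth real-valued function on a neighborhood of the origin in $\mathbb R^2$ with $S(0,0)=0$, $\nabla S(0,0)=0$, vanishing Hessian determinant at the origin, and nonvanishing Taylor expansion $\sum s_{ab}x^ay^b$ at the origin (a "degenerate phase"). The Newton polygon $N(S)$ is the convex hull of the union of the quadrants $\{t_1\ge a,\ t_2\ge b\}$ over all $(a,b)$ with $s_{ab}\neq 0$; the Newton distance is $d(S)=\inf\{t:(t,t)\in N(S)\}$; the bisectrix is the line $t_1=t_2$; for a compact edge $e$ of $N(S)$, $S_e(x,y)=\sum_{(a,b)\in e}s_{ab}x^ay^b$. We say that $S$ is in superadapted coordinates if for every compact edge $e$ of $N(S)$ meeting the bisectrix, neither $S_e(1,y)$ nor $S_e(-1,y)$ has a real zero $r\ne 0$ of order $d(S)$ or greater. Superadapted coordinates are in case 1, 2 or 3 if the bisectrix meets $N(S)$, respectively, in the interior of a compact edge, at a vertex $(d(S),d(S))$, or in the interior of an unbounded edge. Then: (i) There are smooth functions $a,f$ defined near $0\in\mathbb R$ with $a(0)=f(0)=0$ such that, if $\{\sigma,\tau\}$ are the two coordinate changes $(x,y)\mapsto(x,y+a(x))$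 and $(x,y)\mapsto(x-f(y),y)$, labelled in a suitable order, then one of the following holds: $S\circ\sigma$ is in case 1 of superadapted coordinates; $S\circ\sigma$ is in case 3 of superadapted coordinates; or the bisectrix meets $N(S\circ\sigma)$ at a vertex and $S\circ\sigma\circ\tau$ is in case 2 of superadapted coordinates. (ii) There is exactly one $i\in\{1,2,3\}$ for which some smooth local coordinate change $\Phi$ fixing the origin puts $S$ into case $i$ of superadapted coordinates, that is, for which $S\circ\Phi$ is in case $i$. -/

import Mathlib

open scoped ContDiff Manifold Polynomial

noncomputable section

namespace NewtonPhase

/-- `f` is smooth on some open neighbourhood of `p`. -/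
def SmoothNear {E F : Type*} [NormedAddCommGroup E] [NormedSpace ℝ E]
    [NormedAddCommGroup F] [NormedSpace ℝ F] (f : E → F) (p : E) : Prop :=
  ∃ U : Set E, IsOpen U ∧ p ∈ U ∧ ContDiffOn ℝ ∞ f U

/-- The partial derivative `∂ₓᵃ ∂ᵧᵇ S` at the origin. -/
def partialAtZero (S : ℝ × ℝ → ℝ) (a b : ℕ) : ℝ :=
  iteratedDeriv a (fun x : ℝ => iteratedDeriv b (fun y : ℝ => S (x, y)) 0) 0

/-- The coefficient of `xᵃ yᵇ` in the Taylor expansion of `S` at the origin. -/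
def taylorCoeff (S : ℝ × ℝ → ℝ) (a b : ℕ) : ℝ :=
  partialAtZero S a b / ((Nat.factorial a : ℝ) * (Nat.factorial b : ℝ))

/-- The Hessian determinant of `S` at the origin. -/
def hessianDet (S : ℝ × ℝ → ℝ) : ℝ :=
  partialAtZero S 2 0 * partialAtZero S 0 2 - partialAtZero S 1 1 ^ 2

/-- A smooth degenerate phase: smooth near the origin, with a degenerate critical point and
critical value `0` at the origin, and with a nonvanishing Taylor expansion there. -/
structure IsDegeneratePhase (S : ℝ × ℝ → ℝ) : Prop where
  smooth : SmoothNear S 0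
  value_zero : S 0 = 0
  grad_zero : fderiv ℝ S 0 = 0
  hessian_zero : hessianDet S = 0
  taylor_ne_zero : ∃ a b : ℕ, taylorCoeff S a b ≠ 0

/-- The Newton polygon: the convex hull of the union of the quadrants with corner `(a, b)` over
all `(a, b)` whose Taylor coefficient is nonzero. -/
def newtonPolygon (S : ℝ × ℝ → ℝ) : Set (ℝ × ℝ) :=
  convexHull ℝ {p | ∃ a b : ℕ, taylorCoeff S a b ≠ 0 ∧ (a : ℝ) ≤ p.1 ∧ (b : ℝ) ≤ p.2}

/-- The Newton distance. -/
def newtonDistance (S : ℝ × ℝ → ℝ) : ℝ :=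
  sInf {t : ℝ | (t, t) ∈ newtonPolygon S}

/-- The line `t₁ = t₂`. -/
def bisectrix : Set (ℝ × ℝ) := {p | p.1 = p.2}

/-- An edge of the Newton polygon: a proper face (intersection of the polygon with a supporting
line) that is not a single point. -/
def IsEdge (S : ℝ × ℝ → ℝ) (e : Set (ℝ × ℝ)) : Prop :=
  IsExposed ℝ (newtonPolygon S) e ∧ e.Nontrivial ∧ e ≠ newtonPolygon S

/-- A compact (bounded) edge of the Newton polygon. -/
def IsCompactEdge (S : ℝ × ℝ → ℝ) (e : Set (ℝ × ℝ)) : Prop :=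
  IsEdge S e ∧ IsCompact e

/-- An unbounded edge (horizontal or vertical ray) of the Newton polygon. -/
def IsUnboundedEdge (S : ℝ × ℝ → ℝ) (e : Set (ℝ × ℝ)) : Prop :=
  IsEdge S e ∧ ¬ Bornology.IsBounded e

/-- The interior of an edge: the edge without its endpoints. -/
def edgeInterior (e : Set (ℝ × ℝ)) : Set (ℝ × ℝ) := e \ Set.extremePoints ℝ e

/-- The one-variable polynomial `S_e(c, Y)`, where `S_e(x, y)` is the sum of the terms
`s_{ab} xᵃ yᵇ` of the Taylor expansion of `S` with `(a, b) ∈ e`, for a compact edge `e`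
(so that the sum is finite). -/
def edgePolyAt (S : ℝ × ℝ → ℝ) (e : Set (ℝ × ℝ)) (c : ℝ) : ℝ[X] :=
  ∑ᶠ (ab : ℕ × ℕ) (_ : ((ab.1 : ℝ), (ab.2 : ℝ)) ∈ e),
    Polynomial.C (taylorCoeff S ab.1 ab.2 * c ^ ab.1) * Polynomial.X ^ ab.2

/-- `S` is in superadapted coordinates: for each compact edge `e` meeting the bisectrix,
`S_e(1, y)` and `S_e(-1, y)` have no real zero `r ≠ 0` of order at least the Newton distance. -/
def Superadapted (S : ℝ × ℝ → ℝ) : Prop :=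
  ∀ e : Set (ℝ × ℝ), IsCompactEdge S e → (e ∩ bisectrix).Nonempty →
    ∀ r : ℝ, r ≠ 0 →
      ((edgePolyAt S e 1).rootMultiplicity r : ℝ) < newtonDistance S ∧
      ((edgePolyAt S e (-1)).rootMultiplicity r : ℝ) < newtonDistance S

/-- The bisectrix meets the Newton polygon in the interior of a compact edge. -/
def BisectrixMeetsCompactEdge (S : ℝ × ℝ → ℝ) : Prop :=
  ∃ e, IsCompactEdge S e ∧ (edgeInterior e ∩ bisectrix).Nonempty

/-- The bisectrix meets the Newton polygon at a vertex `(d, d)`, `d` the Newton distance. -/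
def BisectrixMeetsVertex (S : ℝ × ℝ → ℝ) : Prop :=
  (newtonDistance S, newtonDistance S) ∈ Set.extremePoints ℝ (newtonPolygon S)

/-- The bisectrix meets the Newton polygon in the interior of an unbounded edge. -/
def BisectrixMeetsUnboundedEdge (S : ℝ × ℝ → ℝ) : Prop :=
  ∃ e, IsUnboundedEdge S e ∧ (edgeInterior e ∩ bisectrix).Nonempty

/-- The three kinds of superadapted coordinates. -/
inductive SuperadaptedCase
  | case1
  | case2
  | case3

/-- `S` is in the given case of superadapted coordinates. -/
def InCase (S : ℝ × ℝ → ℝ) : SuperadaptedCase → Prop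
  | .case1 => Superadapted S ∧ BisectrixMeetsCompactEdge S
  | .case2 => Superadapted S ∧ BisectrixMeetsVertex S
  | .case3 => Superadapted S ∧ BisectrixMeetsUnboundedEdge S

/-- A smooth local coordinate change of the plane fixing the origin. -/
def IsCoordChange (Φ : ℝ × ℝ → ℝ × ℝ) : Prop :=
  Φ 0 = 0 ∧ IsLocalDiffeomorphAt 𝓘(ℝ, ℝ × ℝ) 𝓘(ℝ, ℝ × ℝ) ∞ Φ 0

/-- A coordinate change `(x, y) ↦ (x, y + a(x))` with `a` smooth near `0` and `a(0) = 0`. -/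
def IsVerticalShear (Φ : ℝ × ℝ → ℝ × ℝ) : Prop :=
  ∃ a : ℝ → ℝ, SmoothNear a 0 ∧ a 0 = 0 ∧ Φ = fun p => (p.1, p.2 + a p.1)

/-- A coordinate change `(x, y) ↦ (x - f(y), y)` with `f` smooth near `0` and `f(0) = 0`. -/
def IsHorizontalShear (Φ : ℝ × ℝ → ℝ × ℝ) : Prop :=
  ∃ f : ℝ → ℝ, SmoothNear f 0 ∧ f 0 = 0 ∧ Φ = fun p => (p.1 - f p.2, p.2)

end NewtonPhase

end

open scoped ContDiff Manifold Polynomial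

noncomputable section

namespace NewtonPhase

open Filter Topology Asymptotics

/-! Fix a positive integer normal (p, q). The limit of S(t^p x, t^q y) / t^N as t → 0+ isolates the
quasi-homogeneous part of S on the supporting line p a + q b = N, and a coordinate change with
leading part φ at that scale composes this part with φ (`form_comp`). The bisectrix meets the line
at (d, d) with d = N / (p + q). A normal is `Bad` when this point lies on the face and the edge
polynomial has a nonzero root of order at least d; superadapted coordinates are those without bad
normals (`superadapted_of_not_bad`, `Superadapted.not_bad`).

Existence. A nonzero root of order n forces more than n monomials; for coprime p ≤ q their spacing
on the line then forces p = 1 (`Bad.eq_one_of_le`). The root is thus a curve y = r x^m, which the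
shear y ↦ y + r x^m straightens. Repetition with increasing m either stops or produces a formal
power series, realised by a smooth function through Borel's lemma (`exists_shear`). A bad side that
survives has normal (p, 1) and passes through a vertex (n, n) on the bisectrix (`LowPoint.bad`).
Applying the same process in the other variable removes it, keeps the vertex and creates no new bad
side (`exists_shear_of_lowPoint`).

Uniqueness. Case 1 means that some side has monomials strictly on both sides of the bisectrix
(`StrictStraddle`), case 2 that some (n, n) is the only minimiser of a positive weight
(`DiagonalVertex`), and case 3 is what remains. A coordinate change either rescales the coefficients
on a side or acts by a substitution (α x + β y, γ x^l + δ y) with γ ≠ 0. The latter gives the factor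
(γ + δ y)^B to a form all of whose monomials contain y^B, hence a root of order B; if B reaches the
Newton distance, the new coordinates are bad (`FormRel.bad`). Between superadapted systems this is
impossible, so the features of cases 1 and 2 transfer both ways (`Change.transfer`, `inCase_congr`).
-/

/-! ### Quasi-homogeneous parts, edge polynomials and Taylor jets. -/

/-- The lattice points with nonnegative coordinates on the line `p a + q b = N`. -/
def lineSet (p q N : ℕ) : Finset (ℕ × ℕ) :=
  (Finset.range (N + 1) ×ˢ Finset.range (N + 1)).filter fun ab => p * ab.1 + q * ab.2 = N

theorem mem_lineSet {p q N : ℕ} (hp : 0 < p) (hq : 0 < q) {ab : ℕ × ℕ} :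
    ab ∈ lineSet p q N ↔ p * ab.1 + q * ab.2 = N := by
  simp only [lineSet, Finset.mem_filter, Finset.mem_product, Finset.mem_range,
    and_iff_right_iff_imp]
  intro h
  constructor <;> nlinarith [Nat.zero_le (p * ab.1), Nat.zero_le (q * ab.2)]

/-- The quasi-homogeneous part of weight `N` of the series with coefficients `c`. -/
def form (c : ℕ → ℕ → ℝ) (p q N : ℕ) (z : ℝ × ℝ) : ℝ :=
  ∑ ab ∈ lineSet p q N, c ab.1 ab.2 * z.1 ^ ab.1 * z.2 ^ ab.2

/-- The restriction of a quasi-homogeneous part to the line `x = ε`. -/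
def edgePoly (c : ℕ → ℕ → ℝ) (p q N : ℕ) (ε : ℝ) : ℝ[X] :=
  ∑ ab ∈ lineSet p q N, Polynomial.C (c ab.1 ab.2 * ε ^ ab.1) * Polynomial.X ^ ab.2

theorem eval_edgePoly (c : ℕ → ℕ → ℝ) (p q N : ℕ) (ε y : ℝ) :
    (edgePoly c p q N ε).eval y = form c p q N (ε, y) := by
  simp [edgePoly, form, Polynomial.eval_finsetSum]

theorem coeff_edgePoly (c : ℕ → ℕ → ℝ) {p q N : ℕ} (hp : 0 < p) (hq : 0 < q) (ε : ℝ) {a b : ℕ}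
    (h : p * a + q * b = N) : (edgePoly c p q N ε).coeff b = c a b * ε ^ a := by
  rw [edgePoly, Polynomial.finsetSum_coeff, Finset.sum_eq_single (a, b)]
  · rw [Polynomial.coeff_C_mul_X_pow, if_pos rfl]
  · rintro ⟨a', b'⟩ h1 h2
    rw [mem_lineSet hp hq] at h1
    rw [Polynomial.coeff_C_mul_X_pow, if_neg]
    rintro rfl
    apply h2
    have : p * a' = p * a := by simp only at h1; omega
    simp [Nat.eq_of_mul_eq_mul_left hp this]
  · intro h1
    exact absurd ((mem_lineSet hp hq).2 h) h1

theorem exists_of_coeff_edgePoly_ne_zero {c : ℕ → ℕ → ℝ} {p q N : ℕ} (hp : 0 < p) (hq : 0 < q)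
    {ε : ℝ} {b : ℕ} (h : (edgePoly c p q N ε).coeff b ≠ 0) :
    ∃ a, p * a + q * b = N ∧ c a b ≠ 0 := by
  rw [edgePoly, Polynomial.finsetSum_coeff] at h
  obtain ⟨⟨a, b'⟩, h1, h2⟩ := Finset.exists_ne_zero_of_sum_ne_zero h
  rw [mem_lineSet hp hq] at h1
  rw [Polynomial.coeff_C_mul_X_pow] at h2
  split_ifs at h2 with hb
  · subst hb
    exact ⟨a, h1, fun h0 => h2 (by simp [h0])⟩
  · exact absurd rfl h2

/-- All exponents of nonzero coefficients have weight at least `N`. -/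
def WeightGE (c : ℕ → ℕ → ℝ) (p q N : ℕ) : Prop := ∀ a b, c a b ≠ 0 → N ≤ p * a + q * b

/-- `c` is the family of Taylor coefficients of `S` at the origin, in the sense of Peano. -/
def HasJet (S : ℝ × ℝ → ℝ) (c : ℕ → ℕ → ℝ) : Prop :=
  ∀ M : ℕ, (fun z : ℝ × ℝ => S z - ∑ a ∈ Finset.range (M + 1), ∑ b ∈ Finset.range (M + 1),
    c a b * z.1 ^ a * z.2 ^ b) =O[𝓝 0] fun z => ‖z‖ ^ (M + 1)

/-- `P` is the quasi-homogeneous leading part of weight `N` of `S`. -/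
def HasForm (S : ℝ × ℝ → ℝ) (p q N : ℕ) (P : ℝ × ℝ → ℝ) : Prop :=
  ∀ z : ℝ × ℝ, Tendsto (fun tz : ℝ × (ℝ × ℝ) =>
    S (tz.1 ^ p * tz.2.1, tz.1 ^ q * tz.2.2) / tz.1 ^ N) (𝓝[>] 0 ×ˢ 𝓝 z) (𝓝 (P z))

theorem tendsto_fst_nhds {z : ℝ × ℝ} :
    Tendsto (fun tz : ℝ × (ℝ × ℝ) => tz.1) (𝓝[>] (0:ℝ) ×ˢ 𝓝 z) (𝓝 0) :=
  tendsto_fst.mono_right nhdsWithin_le_nhds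

theorem tendsto_scale {p q : ℕ} (hp : 0 < p) (hq : 0 < q) (z : ℝ × ℝ) :
    Tendsto (fun tz : ℝ × (ℝ × ℝ) => (tz.1 ^ p * tz.2.1, tz.1 ^ q * tz.2.2))
      (𝓝[>] (0:ℝ) ×ˢ 𝓝 z) (𝓝 0) := by
  have h1 : Tendsto (fun tz : ℝ × (ℝ × ℝ) => tz.2) (𝓝[>] (0:ℝ) ×ˢ 𝓝 z) (𝓝 z) := tendsto_snd
  have hx := ((tendsto_fst_nhds (z := z)).pow p).mul ((continuous_fst.tendsto z).comp h1)
  have hy := ((tendsto_fst_nhds (z := z)).pow q).mul ((continuous_snd.tendsto z).comp h1)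
  rw [zero_pow hp.ne', zero_mul] at hx
  rw [zero_pow hq.ne', zero_mul] at hy
  exact hx.prodMk_nhds hy

theorem eventually_fst_pos (z : ℝ × ℝ) :
    ∀ᶠ tz : ℝ × (ℝ × ℝ) in 𝓝[>] (0:ℝ) ×ˢ 𝓝 z, 0 < tz.1 :=
  tendsto_fst.eventually (eventually_mem_nhdsWithin)

theorem eventually_fst_lt_one (z : ℝ × ℝ) :
    ∀ᶠ tz : ℝ × (ℝ × ℝ) in 𝓝[>] (0:ℝ) ×ˢ 𝓝 z, tz.1 < 1 :=
  tendsto_fst_nhds.eventually (eventually_lt_nhds zero_lt_one)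

/-- Both weights are at least 1, so the scaled point has norm at most t‖z‖ and the Taylor remainder
of order N + 1 is o(t^N). Monomials of weight above N disappear in the limit. -/
theorem HasJet.hasForm {S : ℝ × ℝ → ℝ} {c : ℕ → ℕ → ℝ} (h : HasJet S c) {p q N : ℕ} (hp : 0 < p)
    (hq : 0 < q) (hN : WeightGE c p q N) : HasForm S p q N (form c p q N) := by
  intro z
  have hR : Tendsto (fun tz : ℝ × (ℝ × ℝ) =>
      (S (tz.1 ^ p * tz.2.1, tz.1 ^ q * tz.2.2) - ∑ a ∈ Finset.range (N + 1),
        ∑ b ∈ Finset.range (N + 1), c a b * (tz.1 ^ p * tz.2.1) ^ a * (tz.1 ^ q * tz.2.2) ^ b)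
        / tz.1 ^ N) (𝓝[>] 0 ×ˢ 𝓝 z) (𝓝 0) := by
    obtain ⟨C, hC⟩ := (h N).bound
    have h2 := (tendsto_scale hp hq z).eventually hC
    have hlim : Tendsto (fun tz : ℝ × (ℝ × ℝ) => C * (tz.1 * ‖tz.2‖ ^ (N + 1)))
        (𝓝[>] 0 ×ˢ 𝓝 z) (𝓝 0) := by
      have : Tendsto (fun tz : ℝ × (ℝ × ℝ) => tz.2) (𝓝[>] (0:ℝ) ×ˢ 𝓝 z) (𝓝 z) := tendsto_snd
      simpa using ((tendsto_fst_nhds (z := z)).mul (this.norm.pow (N + 1))).const_mul C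
    refine squeeze_zero_norm' ?_ hlim
    filter_upwards [h2, eventually_fst_pos z, eventually_fst_lt_one z] with tz h3 h0 h1
    -- The constant of the O-bound may be negative; then the bound forces the scaled point to be the
    -- origin.
    have hC0 : 0 ≤ C ∨ ‖(tz.1 ^ p * tz.2.1, tz.1 ^ q * tz.2.2)‖ ^ (N + 1) = 0 := by
      by_contra! hcon
      have : 0 < ‖(tz.1 ^ p * tz.2.1, tz.1 ^ q * tz.2.2)‖ ^ (N + 1) :=
        lt_of_le_of_ne (by positivity) (Ne.symm hcon.2)
      have h4 := norm_nonneg (S (tz.1 ^ p * tz.2.1, tz.1 ^ q * tz.2.2) - ∑ a ∈ Finset.range (N + 1),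
        ∑ b ∈ Finset.range (N + 1), c a b * (tz.1 ^ p * tz.2.1) ^ a * (tz.1 ^ q * tz.2.2) ^ b)
      rw [norm_pow, norm_norm] at h3
      nlinarith [h3, hcon.1]
    have hz : ‖(tz.1 ^ p * tz.2.1, tz.1 ^ q * tz.2.2)‖ ≤ tz.1 * ‖tz.2‖ := by
      have hle : ∀ k : ℕ, 0 < k → tz.1 ^ k ≤ tz.1 := fun k hk => by
        simpa using pow_le_pow_of_le_one h0.le h1.le hk
      rw [Prod.norm_def]
      refine max_le ?_ ?_
      · rw [norm_mul, Real.norm_of_nonneg (pow_nonneg h0.le p)]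
        exact mul_le_mul (hle p hp) (norm_fst_le tz.2) (norm_nonneg _) h0.le
      · rw [norm_mul, Real.norm_of_nonneg (pow_nonneg h0.le q)]
        exact mul_le_mul (hle q hq) (norm_snd_le tz.2) (norm_nonneg _) h0.le
    rw [norm_div, Real.norm_of_nonneg (pow_nonneg h0.le N), div_le_iff₀ (pow_pos h0 N)]
    refine h3.trans ?_
    rw [norm_pow, norm_norm]
    rcases hC0 with hC0 | hC0
    · calc C * ‖(tz.1 ^ p * tz.2.1, tz.1 ^ q * tz.2.2)‖ ^ (N + 1)
          ≤ C * (tz.1 * ‖tz.2‖) ^ (N + 1) := by gcongr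
        _ = C * (tz.1 * ‖tz.2‖ ^ (N + 1)) * tz.1 ^ N := by ring
    · rw [hC0]
      by_cases hC' : 0 ≤ C
      · simp only [mul_zero]; positivity
      · have hz0 : ‖(tz.1 ^ p * tz.2.1, tz.1 ^ q * tz.2.2)‖ = 0 := by
          exact pow_eq_zero_iff (Nat.succ_ne_zero N) |>.1 hC0
        have hz1 : tz.2 = 0 := by
          rw [norm_eq_zero, Prod.mk_eq_zero] at hz0
          have h5 := (mul_eq_zero.1 hz0.1).resolve_left (pow_pos h0 p).ne'
          have h6 := (mul_eq_zero.1 hz0.2).resolve_left (pow_pos h0 q).ne'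
          exact Prod.ext h5 h6
        simp [hz1]
  have hmain : Tendsto (fun tz : ℝ × (ℝ × ℝ) => (∑ a ∈ Finset.range (N + 1),
        ∑ b ∈ Finset.range (N + 1), c a b * (tz.1 ^ p * tz.2.1) ^ a * (tz.1 ^ q * tz.2.2) ^ b)
        / tz.1 ^ N) (𝓝[>] 0 ×ˢ 𝓝 z) (𝓝 (form c p q N z)) := by
    have hf : form c p q N z = ∑ a ∈ Finset.range (N + 1), ∑ b ∈ Finset.range (N + 1),
        if p * a + q * b = N then c a b * z.1 ^ a * z.2 ^ b else 0 := by
      rw [form, lineSet, Finset.sum_filter, Finset.sum_product]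
    rw [hf]
    simp_rw [Finset.sum_div]
    refine tendsto_finsetSum _ fun a _ => tendsto_finsetSum _ fun b _ => ?_
    have h1 : Tendsto (fun tz : ℝ × (ℝ × ℝ) => tz.2) (𝓝[>] (0:ℝ) ×ˢ 𝓝 z) (𝓝 z) := tendsto_snd
    have hx := ((continuous_fst.tendsto z).comp h1)
    have hy := ((continuous_snd.tendsto z).comp h1)
    have hxy := (((hx.pow a).const_mul (c a b)).mul (hy.pow b))
    by_cases hc : c a b = 0
    · simp [hc]
    have hw := hN a b hc
    have key : Tendsto (fun tz : ℝ × (ℝ × ℝ) =>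
        tz.1 ^ (p * a + q * b - N) * (c a b * tz.2.1 ^ a * tz.2.2 ^ b)) (𝓝[>] (0:ℝ) ×ˢ 𝓝 z)
        (𝓝 (if p * a + q * b = N then c a b * z.1 ^ a * z.2 ^ b else 0)) := by
      have := ((tendsto_fst_nhds (z := z)).pow (p * a + q * b - N)).mul hxy
      split_ifs with hif
      · simpa [hif] using this
      · rw [zero_pow (by omega), zero_mul] at this
        exact this
    refine key.congr' ?_
    filter_upwards [eventually_fst_pos z] with tz h0
    rw [eq_div_iff (pow_pos h0 N).ne']
    have : tz.1 ^ (p * a + q * b - N) * tz.1 ^ N = (tz.1 ^ p) ^ a * (tz.1 ^ q) ^ b := by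
      rw [← pow_add, ← pow_mul, ← pow_mul, ← pow_add]
      congr 1; omega
    calc _ = (tz.1 ^ (p * a + q * b - N) * tz.1 ^ N) * (c a b * tz.2.1 ^ a * tz.2.2 ^ b) := by ring
      _ = _ := by rw [this]; ring
  have := hR.add hmain
  rw [zero_add] at this
  refine this.congr fun tz => ?_
  rw [← add_div, sub_add_cancel]

theorem form_eq_zero_iff {c : ℕ → ℕ → ℝ} {p q N : ℕ} (hp : 0 < p) (hq : 0 < q) :
    (∀ y, form c p q N (1, y) = 0) ↔ ∀ a b, p * a + q * b = N → c a b = 0 := by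
  constructor
  · intro h a b hab
    have h0 : edgePoly c p q N 1 = 0 := Polynomial.funext fun y => by
      rw [eval_edgePoly, h, Polynomial.eval_zero]
    have := coeff_edgePoly c hp hq 1 hab
    rw [h0] at this
    simpa using this.symm
  · intro h y
    refine Finset.sum_eq_zero fun ab hab => ?_
    rw [h _ _ ((mem_lineSet hp hq).1 hab)]
    simp

instance neBot_scale (z : ℝ × ℝ) : (𝓝[>] (0:ℝ) ×ˢ 𝓝 z).NeBot := inferInstance

/-- If the least weight n were below N, the form of weight n would be the limit of t^(N - n) times a
convergent quantity, hence zero, and its coefficients would vanish. -/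
theorem HasForm.weightGE {S : ℝ × ℝ → ℝ} {c : ℕ → ℕ → ℝ} (h : HasJet S c) {p q N : ℕ} (hp : 0 < p)
    (hq : 0 < q) {P : ℝ × ℝ → ℝ} (hP : HasForm S p q N P) : WeightGE c p q N := by
  classical
  by_contra hcon
  have hex : ∃ n, n < N ∧ ∃ a b, c a b ≠ 0 ∧ p * a + q * b = n := by
    simp only [WeightGE] at hcon
    push Not at hcon
    obtain ⟨a, b, h1, h2⟩ := hcon
    exact ⟨_, h2, a, b, h1, rfl⟩
  obtain ⟨hn, a, b, hab, hw⟩ := Nat.find_spec hex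
  set n := Nat.find hex with hndef
  have hge : WeightGE c p q n := by
    intro a' b' h'
    by_contra! hlt
    exact Nat.find_min hex hlt ⟨hlt.trans hn, a', b', h', rfl⟩
  have hform := h.hasForm hp hq hge
  refine hab ((form_eq_zero_iff hp hq).1 (fun y => ?_) a b hw)
  refine tendsto_nhds_unique (hform (1, y)) ?_
  have := (hP (1, y)).mul ((tendsto_fst_nhds (z := (1, y))).pow (N - n))
  rw [zero_pow (by omega), mul_zero] at this
  refine this.congr' ?_
  filter_upwards [eventually_fst_pos (1, y)] with tz h0
  have hpow : tz.1 ^ N = tz.1 ^ (N - n) * tz.1 ^ n := by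
    rw [← pow_add]; congr 1; omega
  have h1 := (pow_pos h0 N).ne'
  have h2 := (pow_pos h0 n).ne'
  field_simp
  rw [hpow]
  ring

theorem HasForm.unique {S : ℝ × ℝ → ℝ} {p q N : ℕ} {P Q : ℝ × ℝ → ℝ} (hP : HasForm S p q N P)
    (hQ : HasForm S p q N Q) : P = Q := funext fun z => tendsto_nhds_unique (hP z) (hQ z)

theorem HasForm.eq_form {S : ℝ × ℝ → ℝ} {c : ℕ → ℕ → ℝ} (h : HasJet S c) {p q N : ℕ} (hp : 0 < p)
    (hq : 0 < q) {P : ℝ × ℝ → ℝ} (hP : HasForm S p q N P) : P = form c p q N :=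
  hP.unique (h.hasForm hp hq (HasForm.weightGE h hp hq hP))

/-- The difference of the two families is a jet of the zero function, whose forms of every weight
vanish; `HasForm.weightGE` then allows no nonzero coefficient. -/
theorem HasJet.unique {S : ℝ × ℝ → ℝ} {c c' : ℕ → ℕ → ℝ} (h : HasJet S c) (h' : HasJet S c') :
    c = c' := by
  have h0 : HasJet 0 fun a b => c' a b - c a b := by
    intro M
    refine ((h' M).sub (h M)).congr_left fun z => ?_
    simp only [Pi.zero_apply, sub_mul, Finset.sum_sub_distrib]
    ring
  funext a b
  by_contra hne
  have hf : HasForm 0 1 1 (a + b + 1) 0 := by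
    intro z
    simp
  have := HasForm.weightGE h0 one_pos one_pos hf a b (by rw [sub_ne_zero]; exact Ne.symm hne)
  omega

/-- The germ-level coordinate change `Φ` has leading part `φ` for the given weights. -/
def ScaledTo (Φ : ℝ × ℝ → ℝ × ℝ) (p q : ℕ) (φ : ℝ × ℝ → ℝ × ℝ) : Prop :=
  ∀ z : ℝ × ℝ, Tendsto (fun tz : ℝ × (ℝ × ℝ) =>
    ((Φ (tz.1 ^ p * tz.2.1, tz.1 ^ q * tz.2.2)).1 / tz.1 ^ p,
      (Φ (tz.1 ^ p * tz.2.1, tz.1 ^ q * tz.2.2)).2 / tz.1 ^ q)) (𝓝[>] 0 ×ˢ 𝓝 z) (𝓝 (φ z))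

/-- This is why the limits are taken jointly in t and z: after the coordinate change the evaluation
point moves with t. -/
theorem HasForm.comp {S T : ℝ × ℝ → ℝ} {Φ : ℝ × ℝ → ℝ × ℝ} (hT : T =ᶠ[𝓝 0] S ∘ Φ) {p q N : ℕ}
    (hp : 0 < p) (hq : 0 < q) {P : ℝ × ℝ → ℝ} {φ : ℝ × ℝ → ℝ × ℝ} (hP : HasForm S p q N P)
    (hΦ : ScaledTo Φ p q φ) : HasForm T p q N (P ∘ φ) := by
  intro z
  have h1 := (hP (φ z)).comp (tendsto_fst.prodMk (hΦ z))
  refine h1.congr' ?_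
  filter_upwards [eventually_fst_pos z, (tendsto_scale hp hq z).eventually hT] with tz h0 h2
  rw [h2]
  have h3 := (pow_pos h0 p).ne'
  have h4 := (pow_pos h0 q).ne'
  simp only [Function.comp_apply]
  rw [mul_div_cancel₀ _ h3, mul_div_cancel₀ _ h4]

theorem form_comp {S T : ℝ × ℝ → ℝ} {c e : ℕ → ℕ → ℝ} (hS : HasJet S c) (hTe : HasJet T e)
    {Φ : ℝ × ℝ → ℝ × ℝ} (hT : T =ᶠ[𝓝 0] S ∘ Φ) {p q N : ℕ} (hp : 0 < p) (hq : 0 < q)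
    {φ : ℝ × ℝ → ℝ × ℝ} (hΦ : ScaledTo Φ p q φ) (hN : WeightGE c p q N) :
    WeightGE e p q N ∧ ∀ z, form e p q N z = form c p q N (φ z) := by
  have h := HasForm.comp hT hp hq (hS.hasForm hp hq hN) hΦ
  exact ⟨HasForm.weightGE hTe hp hq h, fun z => (congrFun (HasForm.eq_form hTe hp hq h) z).symm⟩

theorem HasJet.swap {S : ℝ × ℝ → ℝ} {c : ℕ → ℕ → ℝ} (h : HasJet S c) :
    HasJet (S ∘ Prod.swap) fun a b => c b a := by
  intro M
  have hs : Tendsto (Prod.swap : ℝ × ℝ → ℝ × ℝ) (𝓝 0) (𝓝 0) :=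
    continuous_swap.tendsto' _ _ rfl
  refine (((h M).comp_tendsto hs).congr_left fun z => ?_).congr_right fun z => ?_
  · simp only [Function.comp_apply, Prod.fst_swap, Prod.snd_swap]
    rw [Finset.sum_comm]
    congr 1
    refine Finset.sum_congr rfl fun a _ => Finset.sum_congr rfl fun b _ => by ring
  · simp [Prod.norm_def, max_comm]

/-! ### Taylor expansions of smooth functions and Borel's lemma. -/

/-- Multiplication by a bump function makes the germ globally smooth, so that results on iterated
derivatives apply without restriction to a domain. -/
theorem SmoothNear.exists_contDiff {E F : Type*} [NormedAddCommGroup E] [NormedSpace ℝ E]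
    [FiniteDimensional ℝ E] [NormedAddCommGroup F] [NormedSpace ℝ F] {f : E → F} {p : E}
    (hf : SmoothNear f p) : ∃ g : E → F, ContDiff ℝ ∞ g ∧ g =ᶠ[𝓝 p] f := by
  obtain ⟨U, hU, hp, hfU⟩ := hf
  obtain ⟨r, hr, hrU⟩ := Metric.isOpen_iff.1 hU p hp
  let χ : ContDiffBump p := ⟨r / 4, r / 2, by positivity, by linarith⟩
  refine ⟨fun x => χ x • f x, ?_, ?_⟩
  · rw [contDiff_iff_contDiffAt]
    intro x
    by_cases hx : x ∈ U
    · exact (χ.contDiff.contDiffAt).smul (hfU.contDiffAt (hU.mem_nhds hx))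
    · have hx' : x ∉ tsupport χ := by
        rw [χ.tsupport_eq]
        intro h
        exact hx (hrU (Metric.closedBall_subset_ball (by change r / 2 < r; linarith) h))
      refine (contDiffAt_const (c := (0 : F))).congr_of_eventuallyEq ?_
      filter_upwards [(isClosed_tsupport χ).isOpen_compl.mem_nhds hx'] with y hy
      rw [image_eq_zero_of_notMem_tsupport hy, zero_smul]
  · filter_upwards [χ.eventuallyEq_one] with x hx
    rw [hx]
    simp

/-- Taylor's theorem with Lagrange remainder, for a smooth function on the line. -/
theorem exists_lagrange_remainder {f : ℝ → ℝ} (hf : ContDiff ℝ ∞ f) (n : ℕ) (x : ℝ) :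
    ∃ x', |x'| ≤ |x| ∧ f x - ∑ k ∈ Finset.range (n + 1),
      iteratedDeriv k f 0 / (Nat.factorial k : ℝ) * x ^ k =
      iteratedDeriv (n + 1) f x' / (Nat.factorial (n + 1) : ℝ) * x ^ (n + 1) := by
  rcases eq_or_ne x 0 with rfl | hx
  · refine ⟨0, le_rfl, ?_⟩
    rw [Finset.sum_range_succ']
    simp
  · obtain ⟨x', hx', h⟩ := taylor_mean_remainder_lagrange_iteratedDeriv (n := n) (f := f) hx.symm
      ((hf.of_le (by exact_mod_cast le_top)).contDiffOn)
    refine ⟨x', ?_, ?_⟩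
    · have h3 := Set.uIoo_subset_uIcc_self hx'
      rcases le_total 0 x with h0 | h0
      · rw [Set.uIcc_of_le h0] at h3
        rw [abs_of_nonneg h0, abs_of_nonneg h3.1]; exact h3.2
      · rw [Set.uIcc_of_ge h0] at h3
        rw [abs_of_nonpos h0, abs_of_nonpos h3.2]; linarith [h3.1]
    · rw [taylor_within_apply, sub_zero] at h
      rw [div_mul_eq_mul_div, ← h]
      congr 1
      refine Finset.sum_congr rfl fun k _ => ?_
      rw [iteratedDerivWithin_eq_iteratedDeriv (uniqueDiffOn_uIcc hx.symm)
        ((hf.of_le (by exact_mod_cast le_top)).contDiffAt) Set.left_mem_uIcc]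
      simp only [smul_eq_mul]
      ring

theorem taylor_isBigO {f : ℝ → ℝ} (hf : ContDiff ℝ ∞ f) (n : ℕ) :
    (fun x => f x - ∑ k ∈ Finset.range (n + 1),
      iteratedDeriv k f 0 / (Nat.factorial k : ℝ) * x ^ k) =O[𝓝 0] fun x => x ^ (n + 1) := by
  have hc : Continuous (iteratedDeriv (n + 1) f) :=
    hf.continuous_iteratedDeriv (n + 1) (by exact_mod_cast le_top)
  obtain ⟨C, hC⟩ := (isCompact_Icc (a := (-1 : ℝ)) (b := 1)).exists_bound_of_continuousOn
    hc.continuousOn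
  refine IsBigO.of_bound (C / (Nat.factorial (n + 1) : ℝ)) ?_
  filter_upwards [Icc_mem_nhds (show (-1 : ℝ) < 0 by norm_num) (show (0 : ℝ) < 1 by norm_num)]
    with x hx
  obtain ⟨x', hx', h⟩ := exists_lagrange_remainder hf n x
  have hx1 : |x| ≤ 1 := abs_le.2 hx
  rw [h, norm_mul, norm_div, Real.norm_natCast]
  exact mul_le_mul_of_nonneg_right (div_le_div_of_nonneg_right
    (hC x' (abs_le.1 (hx'.trans hx1))) (Nat.cast_nonneg _)) (norm_nonneg _)

theorem contDiff_deriv_snd {T : ℝ × ℝ → ℝ} (hT : ContDiff ℝ ∞ T) :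
    ContDiff ℝ ∞ fun z : ℝ × ℝ => deriv (fun y => T (z.1, y)) z.2 := by
  have : (fun z : ℝ × ℝ => deriv (fun y => T (z.1, y)) z.2) = fun z => fderiv ℝ T z (0, 1) := by
    funext z
    have h1 : HasFDerivAt T (fderiv ℝ T z) (z.1, z.2) :=
      (hT.differentiable (by simp) z).hasFDerivAt
    have h2 : HasDerivAt (fun y : ℝ => (z.1, y)) ((0 : ℝ), (1 : ℝ)) z.2 :=
      (hasDerivAt_const z.2 z.1).prodMk (hasDerivAt_id z.2)
    exact (h1.comp_hasDerivAt z.2 h2).deriv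
  rw [this]
  exact (hT.fderiv_right (m := ∞) (by simp)).clm_apply contDiff_const

theorem contDiff_iteratedDeriv_snd {T : ℝ × ℝ → ℝ} (hT : ContDiff ℝ ∞ T) (b : ℕ) :
    ContDiff ℝ ∞ fun z : ℝ × ℝ => iteratedDeriv b (fun y => T (z.1, y)) z.2 := by
  induction b with
  | zero => simpa using hT
  | succ b ih =>
    simp_rw [iteratedDeriv_succ]
    exact contDiff_deriv_snd ih

theorem taylorCoeff_congr {S T : ℝ × ℝ → ℝ} (h : S =ᶠ[𝓝 0] T) :
    taylorCoeff S = taylorCoeff T := by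
  funext a b
  rw [taylorCoeff, taylorCoeff]
  congr 1
  refine Filter.EventuallyEq.iteratedDeriv_eq a ?_
  have h' : ∀ᶠ z in 𝓝 ((0 : ℝ), (0 : ℝ)), S z = T z := h
  rw [nhds_prod_eq] at h'
  filter_upwards [h'.curry] with x hx
  exact Filter.EventuallyEq.iteratedDeriv_eq b hx

/-- The coefficients are iterated one-variable derivatives, so the expansion is done first in y with
coefficients depending on x, then in x for each of these coefficients. -/
theorem hasJet_of_contDiff {T : ℝ × ℝ → ℝ} (hT : ContDiff ℝ ∞ T) : HasJet T (taylorCoeff T) := by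
  intro M
  set g : ℕ → ℝ → ℝ := fun b x => iteratedDeriv b (fun y => T (x, y)) 0 with hg
  have hgs : ∀ b, ContDiff ℝ ∞ (g b) := fun b =>
    (contDiff_iteratedDeriv_snd hT b).comp (contDiff_id.prodMk contDiff_const)
  have hfst : (fun z : ℝ × ℝ => z.1) =O[𝓝 0] fun z => ‖z‖ :=
    IsBigO.of_bound 1 (Eventually.of_forall fun z => by simpa using norm_fst_le z)
  have hsnd : (fun z : ℝ × ℝ => z.2) =O[𝓝 0] fun z => ‖z‖ :=
    IsBigO.of_bound 1 (Eventually.of_forall fun z => by simpa using norm_snd_le z)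
  have h1 : (fun z : ℝ × ℝ => T z - ∑ b ∈ Finset.range (M + 1),
      g b z.1 / (Nat.factorial b : ℝ) * z.2 ^ b) =O[𝓝 0] fun z => ‖z‖ ^ (M + 1) := by
    obtain ⟨C, hC⟩ := ((isCompact_Icc (a := (-1 : ℝ)) (b := 1)).prod
      (isCompact_Icc (a := (-1 : ℝ)) (b := 1))).exists_bound_of_continuousOn
      (contDiff_iteratedDeriv_snd hT (M + 1)).continuous.continuousOn
    refine IsBigO.of_bound (C / (Nat.factorial (M + 1) : ℝ)) ?_
    filter_upwards [Metric.closedBall_mem_nhds (0 : ℝ × ℝ) one_pos] with z hz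
    rw [mem_closedBall_zero_iff] at hz
    obtain ⟨y', hy', h⟩ := exists_lagrange_remainder
      (f := fun y => T (z.1, y)) (hT.comp (contDiff_const.prodMk contDiff_id)) M z.2
    rw [h, norm_mul, norm_div]
    have hy1 : |y'| ≤ 1 := hy'.trans ((norm_snd_le z).trans hz)
    have hx1 : |z.1| ≤ 1 := (norm_fst_le z).trans hz
    have := hC (z.1, y') ⟨abs_le.1 hx1, abs_le.1 hy1⟩
    have h2 : ‖z.2 ^ (M + 1)‖ ≤ ‖‖z‖ ^ (M + 1)‖ := by
      rw [norm_pow, norm_pow, norm_norm]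
      exact pow_le_pow_left₀ (norm_nonneg _) (norm_snd_le z) _
    rw [Real.norm_natCast]
    exact mul_le_mul (div_le_div_of_nonneg_right this (Nat.cast_nonneg _)) h2 (norm_nonneg _)
      (div_nonneg ((norm_nonneg _).trans this) (Nat.cast_nonneg _))
  have h2 : (fun z : ℝ × ℝ => ∑ b ∈ Finset.range (M + 1), (g b z.1 / (Nat.factorial b : ℝ) * z.2 ^ b
      - ∑ a ∈ Finset.range (M + 1), taylorCoeff T a b * z.1 ^ a * z.2 ^ b))
      =O[𝓝 0] fun z => ‖z‖ ^ (M + 1) := by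
    refine IsBigO.fun_sum fun b _ => ?_
    have h3 := (taylor_isBigO (hgs b) M).comp_tendsto
      (continuous_fst.tendsto' (0 : ℝ × ℝ) 0 rfl)
    have h4 := h3.trans (hfst.pow (M + 1))
    have h5 : (fun z : ℝ × ℝ => z.2 ^ b / (Nat.factorial b : ℝ)) =O[𝓝 0] fun _ => (1 : ℝ) := by
      refine Tendsto.isBigO_one ℝ (c := (0:ℝ × ℝ).2 ^ b / (Nat.factorial b : ℝ)) ?_
      exact (by fun_prop : Continuous fun z : ℝ × ℝ => z.2 ^ b / (Nat.factorial b : ℝ)).tendsto 0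
    refine ((h4.mul h5).congr_left fun z => ?_).congr_right fun z => mul_one _
    simp only [Function.comp_apply, sub_mul, Finset.sum_mul]
    congr 1
    · ring
    · refine Finset.sum_congr rfl fun a _ => ?_
      simp only [taylorCoeff, partialAtZero, hg]
      field_simp
  refine (h1.add h2).congr_left fun z => ?_
  rw [Finset.sum_sub_distrib, Finset.sum_comm (s := Finset.range (M + 1))]
  ring

theorem SmoothNear.hasJet {S : ℝ × ℝ → ℝ} (hS : SmoothNear S 0) : HasJet S (taylorCoeff S) := by
  obtain ⟨T, hT, hTS⟩ := hS.exists_contDiff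
  rw [taylorCoeff_congr hTS.symm]
  intro M
  refine (hasJet_of_contDiff hT M).congr' ?_ EventuallyEq.rfl
  filter_upwards [hTS] with z hz
  rw [hz]

/-- A smooth function of one variable has a Taylor expansion of every order. -/
theorem SmoothNear.exists_taylor {f : ℝ → ℝ} (hf : SmoothNear f 0) :
    ∃ c : ℕ → ℝ, ∀ n, (fun x => f x - ∑ k ∈ Finset.range (n + 1), c k * x ^ k) =O[𝓝 0]
      fun x => x ^ (n + 1) := by
  obtain ⟨g, hg, hgf⟩ := hf.exists_contDiff
  refine ⟨fun k => iteratedDeriv k g 0 / (Nat.factorial k : ℝ), fun n => ?_⟩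
  refine (taylor_isBigO hg n).congr' ?_ EventuallyEq.rfl
  filter_upwards [hgf] with z hz
  rw [hz]

/-- Borel's lemma: every real sequence is the sequence of Taylor coefficients of a smooth
function. -/
theorem exists_contDiff_of_taylor (c : ℕ → ℝ) : ∃ f : ℝ → ℝ, ContDiff ℝ ∞ f ∧
    ∀ n, (fun x => f x - ∑ k ∈ Finset.range (n + 1), c k * x ^ k) =O[𝓝 0]
      fun x => x ^ (n + 1) := by
  let χ : ContDiffBump (0 : ℝ) := ⟨1, 2, one_pos, by norm_num⟩
  set h : ℕ → ℝ → ℝ := fun n y => y ^ n * χ y with hh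
  have hhs : ∀ n, ContDiff ℝ ∞ (h n) := fun n => (contDiff_id.pow n).mul χ.contDiff
  have hhc : ∀ n, HasCompactSupport (h n) := fun n => χ.hasCompactSupport.mul_left
  have hB : ∀ n k, ∃ B, ∀ y, ‖iteratedDeriv k (h n) y‖ ≤ B := by
    intro n k
    refine ((hhs n).continuous_iteratedDeriv k (by exact_mod_cast le_top)
      ).bounded_above_of_compact_support ?_
    have := (hhc n).iteratedFDeriv (𝕜 := ℝ) k
    rw [HasCompactSupport] at this ⊢
    refine this.of_isClosed_subset (isClosed_tsupport _) (closure_mono fun x hx => ?_)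
    rw [Function.mem_support] at hx ⊢
    rw [← norm_ne_zero_iff] at hx ⊢
    rwa [norm_iteratedFDeriv_eq_norm_iteratedDeriv]
  choose B hB using hB
  -- The n-th summand will be c_n x^n χ(R x). The second bound on R serves the remainder estimate,
  -- the third makes the derivatives of order k < n summable.
  have hR : ∀ n, ∃ R : ℝ, 2 ≤ R ∧ |c n| * 2 ^ n ≤ R * (1 / 2) ^ n ∧
      ∀ k ∈ Finset.range n, |c n| * B n k ≤ R * (1 / 2) ^ n := by
    intro n
    have hp : (0 : ℝ) < (1 / 2) ^ n := by positivity
    have e1 : ∀ A : ℝ, ∀ᶠ R : ℝ in atTop, A ≤ R * (1 / 2) ^ n := fun A =>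
      (tendsto_id.atTop_mul_const hp).eventually_ge_atTop A
    have := (eventually_ge_atTop (2 : ℝ)).and ((e1 (|c n| * 2 ^ n)).and
      ((Finset.eventually_all (Finset.range n)).2 fun k _ => e1 (|c n| * B n k)))
    exact this.exists
  choose R hR2 hRc hRB using hR
  have hR0 : ∀ n, 0 < R n := fun n => by linarith [hR2 n]
  set f : ℕ → ℝ → ℝ := fun n x => c n / R n ^ n * h n (R n * x) with hf
  have hfs : ∀ n, ContDiff ℝ ∞ (f n) := fun n =>
    contDiff_const.mul ((hhs n).comp (contDiff_const.mul contDiff_id))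
  have hsum : Summable fun n : ℕ => (1 / 2 : ℝ) ^ n :=
    summable_geometric_of_lt_one (by norm_num) (by norm_num)
  refine ⟨fun x => ∑' n, f n x, ?_, fun M => ?_⟩
  · refine contDiff_tsum_of_eventually (N := ⊤) (v := fun _ n => (1 / 2 : ℝ) ^ n) hfs
      (fun _ _ => hsum) fun k _ => ?_
    rw [Nat.cofinite_eq_atTop]
    filter_upwards [eventually_gt_atTop k] with n hn x
    rw [norm_iteratedFDeriv_eq_norm_iteratedDeriv]
    have e1 : iteratedDeriv k (f n) x
        = c n / R n ^ n * (R n ^ k * iteratedDeriv k (h n) (R n * x)) := by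
      have e2 : ContDiff ℝ k (h n) := (hhs n).of_le (by exact_mod_cast le_top)
      rw [hf]
      simp only
      rw [iteratedDeriv_const_mul_field, iteratedDeriv_comp_const_mul e2]
    rw [e1]
    have hp : (0 : ℝ) < R n ^ n := pow_pos (hR0 n) n
    -- As k < n, a factor 1 / R remains after k differentiations, which compensates for c_n and the
    -- derivative bound.
    have e3 : R n ^ k ≤ R n ^ n / R n := by
      rw [le_div_iff₀ (hR0 n), ← pow_succ]
      exact pow_le_pow_right₀ (by linarith [hR2 n]) hn
    rw [norm_mul, norm_div, norm_mul, Real.norm_of_nonneg hp.le,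
      Real.norm_of_nonneg (pow_pos (hR0 n) k).le, Real.norm_eq_abs]
    calc |c n| / R n ^ n * (R n ^ k * ‖iteratedDeriv k (h n) (R n * x)‖)
        ≤ |c n| / R n ^ n * ((R n ^ n / R n) * B n k) := by
          gcongr
          · exact div_nonneg hp.le (hR0 n).le
          · exact hB n k _
      _ = |c n| * B n k / R n := by field_simp
      _ ≤ (1 / 2) ^ n := by
          rw [div_le_iff₀ (hR0 n)]
          linarith [hRB n k (Finset.mem_range.2 hn)]
  -- With n ≥ M + 2 one more factor |x| is available beyond |x|^(M + 1); on the support of the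
  -- cutoff it is at most 2 / R.
  · have hbd : ∀ n, ∀ x, |x| ≤ 1 → M + 2 ≤ n → ‖f n x‖ ≤ |x| ^ (M + 1) * (1 / 2) ^ n := by
      intro n x hx hn
      have hp : (0 : ℝ) < R n ^ n := pow_pos (hR0 n) n
      have e1 : f n x = c n * x ^ n * χ (R n * x) := by
        simp only [hf, hh, mul_pow]
        field_simp
      rw [e1]
      by_cases hxR : |R n * x| < 2
      · rw [norm_mul, norm_mul, norm_pow, Real.norm_eq_abs, Real.norm_eq_abs,
          Real.norm_of_nonneg (χ.nonneg)]
        have hx2 : |x| ≤ 2 / R n := by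
          rw [abs_mul, abs_of_pos (hR0 n)] at hxR
          rw [le_div_iff₀ (hR0 n)]
          linarith
        have hx3 : |x| ^ n ≤ |x| ^ (M + 1) * (2 ^ n / R n) := by
          have : n = (M + 1) + 1 + (n - (M + 2)) := by omega
          calc |x| ^ n = |x| ^ (M + 1) * (|x| * |x| ^ (n - (M + 2))) := by
                conv_lhs => rw [this]
                ring
            _ ≤ |x| ^ (M + 1) * (2 / R n * 1) := by
                gcongr
                · exact div_nonneg zero_le_two (hR0 n).le
                · exact pow_le_one₀ (abs_nonneg x) hx
            _ ≤ |x| ^ (M + 1) * (2 ^ n / R n) := by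
                have : (2 : ℝ) ≤ 2 ^ n := by
                  simpa using pow_le_pow_right₀ (by norm_num : (1 : ℝ) ≤ 2) (show 1 ≤ n by omega)
                rw [mul_one]
                have := (hR0 n).le
                gcongr
        calc |c n| * |x| ^ n * χ (R n * x) ≤ |c n| * (|x| ^ (M + 1) * (2 ^ n / R n)) * 1 := by
              gcongr
              · exact χ.nonneg
              · have := (hR0 n).le
                positivity
              · exact χ.le_one
          _ = |x| ^ (M + 1) * (|c n| * 2 ^ n / R n) := by ring
          _ ≤ |x| ^ (M + 1) * (1 / 2) ^ n := by
              gcongr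
              rw [div_le_iff₀ (hR0 n)]
              linarith [hRc n]
      · have : χ (R n * x) = 0 := by
          apply χ.zero_of_le_dist
          rw [Real.dist_eq, sub_zero]
          exact not_lt.1 hxR
        rw [this, mul_zero, norm_zero]
        positivity
    have hlow : ∀ᶠ x in 𝓝 (0 : ℝ), ∀ n ∈ Finset.range (M + 2), f n x = c n * x ^ n := by
      rw [Finset.eventually_all]
      intro n _
      have : Tendsto (fun x => R n * x) (𝓝 0) (𝓝 0) :=
        (continuous_const.mul continuous_id).tendsto' _ _ (mul_zero _)
      filter_upwards [this.eventually χ.eventuallyEq_one] with x hx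
      simp only [hf, hh, hx, mul_pow, Pi.one_apply]
      have := (pow_pos (hR0 n) n).ne'
      field_simp
    refine IsBigO.of_bound (|c (M + 1)| + ∑' n : ℕ, (1 / 2 : ℝ) ^ (n + (M + 2))) ?_
    filter_upwards [hlow, Icc_mem_nhds (show (-1 : ℝ) < 0 by norm_num)
      (show (0 : ℝ) < 1 by norm_num)] with x hx hx1
    have hx1 : |x| ≤ 1 := abs_le.2 hx1
    have hs1 : Summable fun n : ℕ => |x| ^ (M + 1) * (1 / 2 : ℝ) ^ (n + (M + 2)) :=
      ((summable_nat_add_iff (M + 2)).2 hsum).mul_left _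
    have hs2 : Summable fun n => f (n + (M + 2)) x :=
      Summable.of_norm_bounded hs1 fun n => hbd _ x hx1 (by omega)
    have hs3 : Summable fun n => f n x := (summable_nat_add_iff (M + 2)).1 hs2
    rw [← hs3.sum_add_tsum_nat_add (M + 2), Finset.sum_congr rfl hx, Finset.sum_range_succ]
    have e1 : ‖∑' n, f (n + (M + 2)) x‖ ≤ |x| ^ (M + 1) * ∑' n : ℕ, (1 / 2 : ℝ) ^ (n + (M + 2)) := by
      rw [← tsum_mul_left]
      exact tsum_of_norm_bounded hs1.hasSum fun n => hbd _ x hx1 (by omega)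
    rw [show ∀ s t u : ℝ, s + t + u - s = t + u from fun s t u => by ring]
    refine (norm_add_le _ _).trans ?_
    rw [norm_mul, norm_pow, Real.norm_eq_abs, Real.norm_eq_abs]
    linarith

/-! ### Root orders of real polynomials. -/

open Polynomial in
/-- A nonzero polynomial with a nonzero root of order `n` has more than `n` monomials. -/
theorem lt_card_support_of_pow_dvd {r : ℝ} (hr : r ≠ 0) :
    ∀ (n : ℕ) (P : ℝ[X]), P ≠ 0 → (X - C r) ^ n ∣ P → n < P.support.card := by
  intro n
  induction n with
  | zero =>
    intro P hP _
    exact Finset.card_pos.2 (nonempty_support_iff.2 hP)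
  | succ n ih =>
    intro P hP hdvd
    -- Dividing out the lowest power of X makes the constant term nonzero. Differentiation then
    -- loses at least one monomial and at most one order of the root, which drives the induction.
    obtain ⟨Q, hQ⟩ := (X_pow_dvd_iff (f := P) (n := P.natTrailingDegree)).2
      fun d hd => coeff_eq_zero_of_lt_natTrailingDegree hd
    set k := P.natTrailingDegree with hk
    have hQ0 : Q.coeff 0 ≠ 0 := by
      have h1 : P.coeff k ≠ 0 := by
        rw [hk]; exact trailingCoeff_nonzero_iff_nonzero.2 hP
      rw [hQ, coeff_X_pow_mul'] at h1
      simpa using h1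
    have hcop : IsCoprime ((X - C r) ^ (n + 1)) ((X : ℝ[X]) ^ k) := by
      apply IsCoprime.pow
      have := isCoprime_X_sub_C_of_isUnit_sub (R := ℝ) (a := r) (b := 0)
        (by simpa using hr.isUnit)
      simpa using this
    have hdQ : (X - C r) ^ (n + 1) ∣ Q := by
      rw [hQ] at hdvd
      exact hcop.dvd_of_dvd_mul_left hdvd
    have hcard : P.support.card = Q.support.card := by
      rw [hQ, mul_comm, ← Finset.card_map (addRightEmbedding k) (s := Q.support)]
      congr 1
      ext d
      simp only [mem_support_iff, coeff_mul_X_pow', Finset.mem_map, addRightEmbedding_apply]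
      constructor
      · intro h
        split_ifs at h with hd
        · exact ⟨d - k, h, by omega⟩
        · exact absurd rfl h
      · rintro ⟨a, ha, rfl⟩
        simpa using ha
    have hD : (X - C r) ^ n ∣ derivative Q := by
      obtain ⟨R, hR⟩ := hdQ
      rw [hR, derivative_mul, derivative_X_sub_C_pow]
      refine dvd_add (Dvd.dvd.mul_right ?_ _) (Dvd.dvd.mul_right (pow_dvd_pow _ (by omega)) _)
      exact Dvd.intro_left _ rfl
    have hD0 : derivative Q ≠ 0 := by
      intro h0
      have hdeg := derivative_eq_zero.1 h0
      have hQne : Q ≠ 0 := fun h => hQ0 (by simp [h])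
      have := natDegree_le_of_dvd hdQ hQne
      rw [natDegree_pow, natDegree_X_sub_C, hdeg] at this
      omega
    have h1 := ih _ hD0 hD
    have h2 : (derivative Q).support.card < Q.support.card := by
      have hsub : (derivative Q).support.map (addRightEmbedding 1) ⊆ Q.support.erase 0 := by
        intro d hd
        simp only [Finset.mem_map, mem_support_iff, addRightEmbedding_apply, coeff_derivative]
          at hd
        obtain ⟨a, ha, rfl⟩ := hd
        rw [Finset.mem_erase, mem_support_iff]
        exact ⟨by omega, left_ne_zero_of_mul ha⟩
      have h3 := Finset.card_le_card hsub
      rw [Finset.card_map, Finset.card_erase_of_mem (mem_support_iff.2 hQ0)] at h3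
      have : 0 < Q.support.card := Finset.card_pos.2 ⟨0, mem_support_iff.2 hQ0⟩
      omega
    omega

-- Expressing root order as a growth condition makes it stable under the fractional-power
-- substitutions of `Bad.swap`.
open Polynomial in
theorem X_sub_C_pow_dvd_iff_isBigO {P : ℝ[X]} {r : ℝ} {n : ℕ} :
    (X - C r) ^ n ∣ P ↔ (fun y => P.eval y) =O[𝓝 r] fun y => (y - r) ^ n := by
  constructor
  · rintro ⟨Q, rfl⟩
    have h : (fun y => Q.eval y) =O[𝓝 r] fun _ => (1 : ℝ) :=
      (Q.continuous.tendsto r).isBigO_one ℝ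
    refine (((isBigO_refl (fun y => (y - r) ^ n) (𝓝 r)).mul h).congr_left fun y => ?_).congr_right
      fun y => mul_one _
    simp
  · intro h
    by_cases hP : P = 0
    · rw [hP]; exact dvd_zero _
    rw [← le_rootMultiplicity_iff hP]
    by_contra! hlt
    obtain ⟨Q, hQ, hQr⟩ := exists_eq_pow_rootMultiplicity_mul_and_not_dvd P hP r
    set m := rootMultiplicity r P
    rw [dvd_iff_isRoot, IsRoot.def] at hQr
    apply hQr
    have h1 : (fun y => Q.eval y) =O[𝓝[≠] r] fun y => (y - r) ^ (n - m) := by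
      obtain ⟨K, hK⟩ := (h.mono nhdsWithin_le_nhds).bound
      refine IsBigO.of_bound K ?_
      filter_upwards [hK, self_mem_nhdsWithin] with y hy hne
      have h0 : 0 < ‖(y - r) ^ m‖ := norm_pos_iff.2 (pow_ne_zero _ (sub_ne_zero.2 hne))
      rw [hQ, eval_mul, eval_pow, eval_sub, eval_X, eval_C, norm_mul,
        show n = m + (n - m) by omega, pow_add, norm_mul] at hy
      refine le_of_mul_le_mul_left ?_ h0
      linarith
    have h2 : Tendsto (fun y : ℝ => (y - r) ^ (n - m)) (𝓝[≠] r) (𝓝 0) := by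
      have : Continuous fun y : ℝ => (y - r) ^ (n - m) := by fun_prop
      refine (this.tendsto' r 0 ?_).mono_left nhdsWithin_le_nhds
      rw [sub_self, zero_pow (by omega)]
    exact tendsto_nhds_unique ((Q.continuous.tendsto r).mono_left nhdsWithin_le_nhds)
      (h1.trans_tendsto h2)

/-! ### Sides carrying a root of large order. -/

theorem form_smul (c : ℕ → ℕ → ℝ) (p q N : ℕ) (t x y : ℝ) :
    form c p q N (t ^ p * x, t ^ q * y) = t ^ N * form c p q N (x, y) := by
  rw [form, form, Finset.mul_sum]
  refine Finset.sum_congr rfl fun ab hab => ?_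
  rw [lineSet, Finset.mem_filter] at hab
  rw [← hab.2]
  simp only [mul_pow, pow_add, pow_mul]
  ring

theorem form_swap {c : ℕ → ℕ → ℝ} {p q N : ℕ} (z : ℝ × ℝ) :
    form (fun a b => c b a) q p N z = form c p q N z.swap := by
  rw [form, form]
  refine Finset.sum_nbij' Prod.swap Prod.swap ?_ ?_ ?_ ?_ ?_
  · intro ab h
    simp only [lineSet, Finset.mem_filter, Finset.mem_product, Prod.fst_swap, Prod.snd_swap] at h ⊢
    exact ⟨⟨h.1.2, h.1.1⟩, by omega⟩
  · intro ab h
    simp only [lineSet, Finset.mem_filter, Finset.mem_product, Prod.fst_swap, Prod.snd_swap] at h ⊢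
    exact ⟨⟨h.1.2, h.1.1⟩, by omega⟩
  · intro ab _; simp
  · intro ab _; simp
  · intro ab _
    simp only [Prod.fst_swap, Prod.snd_swap]
    ring

theorem WeightGE.swap {c : ℕ → ℕ → ℝ} {p q N : ℕ} (h : WeightGE c p q N) :
    WeightGE (fun a b => c b a) q p N := fun a b hab => by
  have := h b a hab
  omega

/-- On the side of the polygon with normal `(p, q)`, which meets the bisectrix, there is a root of
order at least the Newton distance. -/
def Bad (c : ℕ → ℕ → ℝ) (p q : ℕ) : Prop :=
  ∃ N n : ℕ, WeightGE c p q N ∧ (∃ a b, c a b ≠ 0 ∧ p * a + q * b = N ∧ a ≤ b) ∧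
    (∃ a b, c a b ≠ 0 ∧ p * a + q * b = N ∧ b ≤ a) ∧ N ≤ (p + q) * n ∧
    ∃ r ε : ℝ, r ≠ 0 ∧ (ε = 1 ∨ ε = -1) ∧
      (Polynomial.X - Polynomial.C r) ^ n ∣ edgePoly c p q N ε

theorem edgePoly_ne_zero {c : ℕ → ℕ → ℝ} {p q N : ℕ} (hp : 0 < p) (hq : 0 < q) {ε : ℝ}
    (hε : ε ≠ 0) {a b : ℕ} (hab : c a b ≠ 0) (hw : p * a + q * b = N) :
    edgePoly c p q N ε ≠ 0 := by
  intro h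
  have := coeff_edgePoly c hp hq ε hw
  rw [h, Polynomial.coeff_zero] at this
  exact mul_ne_zero hab (pow_ne_zero a hε) this.symm

/-- Roots in y on x = ±1 and roots in x on y = ±1 correspond along the orbits (t^p x, t^q y), t > 0.
The correspondence is differentiable away from the axes, so orders are preserved. -/
theorem Bad.swap {c : ℕ → ℕ → ℝ} {p q : ℕ} (hp : 0 < p) (hq : 0 < q) (h : Bad c p q) :
    Bad (fun a b => c b a) q p := by
  obtain ⟨N, n, hW, ⟨a, b, hab, hw, hle⟩, ⟨a', b', hab', hw', hle'⟩, hN, r, ε, hr, hε, hdvd⟩ := h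
  refine ⟨N, n, hW.swap, ⟨b', a', hab', by omega, hle'⟩, ⟨b, a, hab, by omega, hle⟩,
    by rw [add_comm q p]; exact hN, ?_⟩
  rw [X_sub_C_pow_dvd_iff_isBigO] at hdvd
  obtain ⟨s, hs, hsr⟩ : ∃ s : ℝ, (s = 1 ∨ s = -1) ∧ s * |r| = r := by
    rcases le_total 0 r with h0 | h0
    · exact ⟨1, Or.inl rfl, by rw [abs_of_nonneg h0]; ring⟩
    · exact ⟨-1, Or.inr rfl, by rw [abs_of_nonpos h0]; ring⟩
  have hεε : ε * ε = 1 := by rcases hε with rfl | rfl <;> norm_num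
  have hr0 : 0 < |r| := abs_pos.2 hr
  -- The orbit of (ε, r) meets the line y = s, with s the sign of r, at (x₀, s).
  set x₀ : ℝ := ε * |r| ^ (-((p : ℝ) / q)) with hx₀
  have hp' : (p : ℝ) ≠ 0 := by exact_mod_cast hp.ne'
  have hq' : (q : ℝ) ≠ 0 := by exact_mod_cast hq.ne'
  refine ⟨x₀, s, mul_ne_zero (fun h => by simp [h] at hεε) (Real.rpow_pos_of_pos hr0 _).ne', hs, ?_⟩
  rw [X_sub_C_pow_dvd_iff_isBigO]
  -- The orbit of (x, s) meets the line of first coordinate ε at height Y x; the scaling parameter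
  -- is t = (ε x)^(1/p).
  set Y : ℝ → ℝ := fun x => s * (ε * x) ^ (-((q : ℝ) / p)) with hY
  have hεx₀ : ε * x₀ = |r| ^ (-((p : ℝ) / q)) := by
    rw [hx₀, ← mul_assoc, hεε, one_mul]
  have hYx₀ : Y x₀ = r := by
    simp only [hY]
    rw [hεx₀, ← Real.rpow_mul hr0.le, show -((p : ℝ) / q) * -((q : ℝ) / p) = 1 by field_simp,
      Real.rpow_one, hsr]
  have hpos₀ : 0 < ε * x₀ := by rw [hεx₀]; exact Real.rpow_pos_of_pos hr0 _
  have hpos : ∀ᶠ x in 𝓝 x₀, 0 < ε * x :=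
    (continuous_const.mul continuous_id).continuousAt.eventually (lt_mem_nhds hpos₀)
  have hYd : DifferentiableAt ℝ Y x₀ := by
    refine (DifferentiableAt.rpow_const (by fun_prop) (Or.inl hpos₀.ne')).const_mul s
  have hYO : (fun x => Y x - r) =O[𝓝 x₀] fun x => x - x₀ := by
    rw [← hYx₀]; exact hYd.isBigO_sub
  have h1 : (fun x => (edgePoly c p q N ε).eval (Y x)) =O[𝓝 x₀] fun x => (x - x₀) ^ n := by
    have := hdvd.comp_tendsto (show Tendsto Y (𝓝 x₀) (𝓝 r) by
      rw [← hYx₀]; exact hYd.continuousAt)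
    exact this.trans (hYO.pow n)
  have h2 : (fun x => ((ε * x) ^ ((1 : ℝ) / p)) ^ N) =O[𝓝 x₀] fun _ => (1 : ℝ) := by
    have : ContinuousAt (fun x => ((ε * x) ^ ((1 : ℝ) / p)) ^ N) x₀ :=
      (ContinuousAt.rpow_const (by fun_prop) (Or.inl hpos₀.ne')).pow N
    exact this.isBigO_one ℝ
  refine ((h2.mul h1).congr' ?_ (Eventually.of_forall fun x => one_mul _))
  filter_upwards [hpos] with x hx
  rw [eval_edgePoly, eval_edgePoly, form_swap, ← form_smul]
  have e1 : ((ε * x) ^ ((1 : ℝ) / p)) ^ p = ε * x := by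
    rw [← Real.rpow_natCast, ← Real.rpow_mul hx.le, one_div_mul_cancel hp', Real.rpow_one]
  have e2 : ((ε * x) ^ ((1 : ℝ) / p)) ^ q = (ε * x) ^ ((q : ℝ) / p) := by
    rw [← Real.rpow_natCast, ← Real.rpow_mul hx.le]
    congr 1; ring
  have e3 : (ε * x) ^ ((q : ℝ) / p) * (ε * x) ^ (-((q : ℝ) / p)) = 1 := by
    rw [← Real.rpow_add hx, add_neg_cancel, Real.rpow_zero]
  congr 1
  rw [e1, e2, Prod.swap_prod_mk]
  refine Prod.ext ?_ ?_
  · simp only [hY]; linear_combination s * e3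
  · simp only; linear_combination x * hεε

theorem lineSet_mul {g p q N : ℕ} (hg : 0 < g) (hp : 0 < p) (hq : 0 < q) :
    lineSet (g * p) (g * q) (g * N) = lineSet p q N := by
  ext ab
  rw [mem_lineSet (Nat.mul_pos hg hp) (Nat.mul_pos hg hq), mem_lineSet hp hq]
  rw [mul_assoc, mul_assoc, ← mul_add]
  exact Nat.mul_right_inj hg.ne'

theorem Bad.exists_coprime {c : ℕ → ℕ → ℝ} {p q : ℕ} (hp : 0 < p) (hq : 0 < q) (h : Bad c p q) :
    ∃ g p' q', 0 < g ∧ p = g * p' ∧ q = g * q' ∧ 0 < p' ∧ 0 < q' ∧ Nat.Coprime p' q' ∧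
      Bad c p' q' := by
  obtain ⟨N, n, hW, ⟨a, b, hab, hw, hle⟩, ⟨a', b', hab', hw', hle'⟩, hN, r, ε, hr, hε, hdvd⟩ := h
  have hg : 0 < Nat.gcd p q := Nat.gcd_pos_of_pos_left q hp
  obtain ⟨p', q', hcop, hp', hq'⟩ := Nat.exists_coprime p q
  set g := Nat.gcd p q
  rw [mul_comm] at hp' hq'
  have hp0 : 0 < p' := Nat.pos_of_ne_zero fun h => by rw [h, mul_zero] at hp'; omega
  have hq0 : 0 < q' := Nat.pos_of_ne_zero fun h => by rw [h, mul_zero] at hq'; omega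
  have key : ∀ x y : ℕ, p * x + q * y = g * (p' * x + q' * y) := fun x y => by
    rw [hp', hq']; ring
  refine ⟨g, p', q', hg, hp', hq', hp0, hq0, hcop, p' * a + q' * b, n, ?_, ⟨a, b, hab, rfl, hle⟩,
    ⟨a', b', hab', ?_, hle'⟩, ?_, r, ε, hr, hε, ?_⟩
  · intro x y hxy
    have := hW x y hxy
    rw [← hw, key, key] at this
    exact Nat.le_of_mul_le_mul_left this hg
  · rw [← hw, key, key] at hw'
    exact Nat.eq_of_mul_eq_mul_left hg hw'
  · rw [← hw, key, hp', hq', ← mul_add, mul_assoc] at hN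
    exact Nat.le_of_mul_le_mul_left hN hg
  · have : edgePoly c p' q' (p' * a + q' * b) ε = edgePoly c p q N ε := by
      rw [edgePoly, edgePoly, ← hw, key, hp', hq', lineSet_mul hg hp0 hq0]
    rw [this]; exact hdvd

/-- Finitely many distinct naturals congruent modulo `p` cannot all be small. -/
theorem exists_mul_le_of_card {p n : ℕ} (hp : 0 < p) {s : Finset ℕ} (hn : n < s.card)
    (hs : ∀ x ∈ s, ∀ y ∈ s, x ≡ y [MOD p]) : ∃ x ∈ s, p * n ≤ x := by
  by_contra! hcon
  have hinj : Set.InjOn (fun x => x / p) (s : Set ℕ) := by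
    intro x hx y hy hxy
    have h1 := hs x hx y hy
    rw [← Nat.div_add_mod x p, ← Nat.div_add_mod y p, h1]
    simp only at hxy
    rw [hxy]
  have hmaps : Set.MapsTo (fun x => x / p) (s : Set ℕ) (Finset.range n : Set ℕ) := by
    intro x hx
    simp only [Finset.coe_range, Set.mem_Iio]
    exact (Nat.div_lt_iff_lt_mul hp).2 (by rw [mul_comm]; exact hcon x hx)
  have := Finset.card_le_card_of_injOn _ hmaps hinj
  rw [Finset.card_range] at this
  omega

/-- On a line with coprime normal all y-exponents agree modulo p. More than n of them occur, so one
is at least p n. -/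
theorem exists_snd_ge_of_pow_dvd {c : ℕ → ℕ → ℝ} {p q N n : ℕ} (hp : 0 < p) (hq : 0 < q)
    (hcop : Nat.Coprime p q) {r ε : ℝ} (hr : r ≠ 0) (h0 : edgePoly c p q N ε ≠ 0)
    (hdvd : (Polynomial.X - Polynomial.C r) ^ n ∣ edgePoly c p q N ε) :
    ∃ a b, c a b ≠ 0 ∧ p * a + q * b = N ∧ p * n ≤ b := by
  obtain ⟨b, hb, hle⟩ := exists_mul_le_of_card hp (lt_card_support_of_pow_dvd hr n _ h0 hdvd) (by
    intro x hx y hy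
    rw [Polynomial.mem_support_iff] at hx hy
    obtain ⟨a, ha, -⟩ := exists_of_coeff_edgePoly_ne_zero hp hq hx
    obtain ⟨a', ha', -⟩ := exists_of_coeff_edgePoly_ne_zero hp hq hy
    refine Nat.ModEq.cancel_left_of_coprime (c := q) hcop ?_
    have h1 : p * a + q * x ≡ p * a' + q * y [MOD p] := by rw [ha, ha']
    have h2 : ∀ u v : ℕ, p * u + v ≡ v [MOD p] := fun u v => by
      simp [Nat.ModEq]
    exact ((h2 a _).symm.trans h1).trans (h2 a' _))
  rw [Polynomial.mem_support_iff] at hb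
  obtain ⟨a, ha, hab⟩ := exists_of_coeff_edgePoly_ne_zero hp hq hb
  exact ⟨a, b, hab, ha, hle⟩

/-- There is a nonzero root `r` of order at least the Newton distance, for weights `(1, m)`. -/
def BadRoot (c : ℕ → ℕ → ℝ) (m : ℕ) (r : ℝ) : Prop :=
  r ≠ 0 ∧ ∃ N n : ℕ, WeightGE c 1 m N ∧ (∃ a b, c a b ≠ 0 ∧ a + m * b = N) ∧ N ≤ (1 + m) * n ∧
    (Polynomial.X - Polynomial.C r) ^ n ∣ edgePoly c 1 m N 1

/-- Scaling by t = ε, possibly -1, exchanges the lines x = 1 and x = ε because the first weight is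
1. -/
theorem pow_dvd_edgePoly_one {c : ℕ → ℕ → ℝ} {q N n : ℕ} {r ε : ℝ} (hε : ε = 1 ∨ ε = -1)
    (h : (Polynomial.X - Polynomial.C r) ^ n ∣ edgePoly c 1 q N ε) :
    (Polynomial.X - Polynomial.C (ε ^ q * r)) ^ n ∣ edgePoly c 1 q N 1 := by
  have hεε : ε * ε = 1 := by rcases hε with rfl | rfl <;> norm_num
  have hq : ε ^ q * ε ^ q = 1 := by rw [← mul_pow, hεε, one_pow]
  rw [X_sub_C_pow_dvd_iff_isBigO] at h ⊢
  have ht : Tendsto (fun y => ε ^ q * y) (𝓝 (ε ^ q * r)) (𝓝 r) := by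
    refine (continuous_const.mul continuous_id).tendsto' _ _ ?_
    change ε ^ q * (ε ^ q * r) = r
    rw [← mul_assoc, hq, one_mul]
  have h1 := h.comp_tendsto ht
  have h2 : (fun y => ε ^ q * y - r) =O[𝓝 (ε ^ q * r)] fun y => y - ε ^ q * r := by
    refine (isBigO_refl (fun y => y - ε ^ q * r) _).const_mul_left (ε ^ q) |>.congr_left fun y => ?_
    linear_combination -r * hq
  refine ((h1.trans (h2.pow n)).const_mul_left (ε ^ N)).congr_left fun y => ?_
  simp only [Function.comp_apply, eval_edgePoly]
  rw [← form_smul, pow_one, hεε, ← mul_assoc, hq, one_mul]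

theorem Bad.weight_pos {c : ℕ → ℕ → ℝ} (h0 : c 0 0 = 0) {p q N : ℕ} (hp : 0 < p) (hq : 0 < q)
    {a b : ℕ} (hab : c a b ≠ 0) (hw : p * a + q * b = N) : 0 < N := by
  rcases Nat.eq_zero_or_pos N with rfl | h
  · have h1 : p * a = 0 := by omega
    have h2 : q * b = 0 := by omega
    rw [Nat.mul_eq_zero] at h1 h2
    have : a = 0 := by omega
    have : b = 0 := by omega
    subst a b
    exact absurd h0 hab
  · exact h

theorem Bad.badRoot {c : ℕ → ℕ → ℝ} {q : ℕ} (h : Bad c 1 q) : ∃ r, BadRoot c q r := by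
  obtain ⟨N, n, hW, ⟨a, b, hab, hw, hle⟩, -, hN, r, ε, hr, hε, hdvd⟩ := h
  have hε0 : ε ≠ 0 := by rcases hε with rfl | rfl <;> norm_num
  exact ⟨ε ^ q * r, mul_ne_zero (pow_ne_zero _ hε0) hr, N, n, hW, ⟨a, b, hab, by omega⟩, hN,
    pow_dvd_edgePoly_one hε hdvd⟩

/-- Some monomial has y-exponent at least p n, so q p n ≤ N ≤ (p + q) n and hence p q ≤ p + q. With
p ≤ q this leaves p = 1 or p = q = 2, and the latter is not coprime. -/
theorem Bad.eq_one_of_le {c : ℕ → ℕ → ℝ} (h0 : c 0 0 = 0) {p q : ℕ} (hp : 0 < p)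
    (hcop : Nat.Coprime p q) (hpq : p ≤ q) (h : Bad c p q) : p = 1 := by
  obtain ⟨N, n, hW, ⟨a, b, hab, hw, hle⟩, -, hN, r, ε, hr, hε, hdvd⟩ := h
  have hq : 0 < q := hp.trans_le hpq
  have hε0 : ε ≠ 0 := by rcases hε with rfl | rfl <;> norm_num
  obtain ⟨a', b', -, hw', hle'⟩ := exists_snd_ge_of_pow_dvd hp hq hcop hr
    (edgePoly_ne_zero hp hq hε0 hab hw) hdvd
  have hNpos := Bad.weight_pos h0 hp hq hab hw
  have hn : 0 < n := Nat.pos_of_ne_zero fun h => by subst h; omega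
  have h1 : q * (p * n) ≤ (p + q) * n :=
    (Nat.mul_le_mul_left q hle').trans ((Nat.le_add_left _ _).trans (hw'.le.trans hN))
  have h2 : q * p ≤ p + q := by
    rw [← mul_assoc] at h1
    exact Nat.le_of_mul_le_mul_right h1 hn
  have h3 : p ≤ 2 := by
    by_contra! h3
    nlinarith
  interval_cases p
  · rfl
  · have : q = 2 := by omega
    subst this
    simp at hcop

/-- A root of large order forces two different monomials on the line. -/
theorem Bad.exists_snd_ne {c : ℕ → ℕ → ℝ} (h0 : c 0 0 = 0) {p q : ℕ} (hp : 0 < p) (hq : 0 < q)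
    (h : Bad c p q) : ∃ N, WeightGE c p q N ∧ (∃ a b, c a b ≠ 0 ∧ p * a + q * b = N) ∧
      ∀ b₀, ∃ a b, c a b ≠ 0 ∧ p * a + q * b = N ∧ b ≠ b₀ := by
  obtain ⟨N, n, hW, ⟨a, b, hab, hw, hle⟩, -, hN, r, ε, hr, hε, hdvd⟩ := h
  have hε0 : ε ≠ 0 := by rcases hε with rfl | rfl <;> norm_num
  refine ⟨N, hW, ⟨a, b, hab, hw⟩, fun b₀ => ?_⟩
  have hcard := lt_card_support_of_pow_dvd hr n _ (edgePoly_ne_zero hp hq hε0 hab hw) hdvd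
  have hNpos := Bad.weight_pos h0 hp hq hab hw
  have hn : 0 < n := Nat.pos_of_ne_zero fun h => by subst h; omega
  obtain ⟨b', hb', hne⟩ := Finset.exists_mem_ne (show 1 < _ from lt_of_le_of_lt hn hcard) b₀
  rw [Polynomial.mem_support_iff] at hb'
  obtain ⟨a', ha', hab'⟩ := exists_of_coeff_edgePoly_ne_zero hp hq hb'
  exact ⟨a', b', hab', ha', hne⟩

/-- `(A, n)` is the lowest support point of the face with normal `(1, m)`. -/
def LowPoint (c : ℕ → ℕ → ℝ) (m A n : ℕ) : Prop :=
  c A n ≠ 0 ∧ ∀ a b, c a b ≠ 0 → A + m * n ≤ a + m * b ∧ (a + m * b = A + m * n → n ≤ b)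

/-- Translating by r moves the root to 0, so X^n divides the new edge polynomial. Its lowest
monomial (A, k) has k ≥ n, and A + m k = N ≤ (1 + m) n gives A ≤ k. -/
theorem BadRoot.lowPoint {c e : ℕ → ℕ → ℝ} {m : ℕ} (hm : 0 < m) {r : ℝ} (h : BadRoot c m r)
    (hce : ∀ N, WeightGE c 1 m N → WeightGE e 1 m N ∧
      ∀ z : ℝ × ℝ, form e 1 m N z = form c 1 m N (z.1, z.2 + r * z.1 ^ m)) :
    ∃ A n, A ≤ n ∧ LowPoint e m A n := by
  obtain ⟨hr, N, n, hW, ⟨a, b, hab, hw⟩, hN, hdvd⟩ := h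
  obtain ⟨hWe, hform⟩ := hce N hW
  have hcomp : edgePoly e 1 m N 1
      = (edgePoly c 1 m N 1).comp (Polynomial.X + Polynomial.C r) := by
    refine Polynomial.funext fun y => ?_
    rw [eval_edgePoly, Polynomial.eval_comp, eval_edgePoly, hform]
    simp
  have hc0 := edgePoly_ne_zero one_pos hm one_ne_zero hab (N := N) (by omega)
  have he0 : edgePoly e 1 m N 1 ≠ 0 := by
    rw [hcomp]
    intro h
    apply hc0
    have h2 := congrArg (fun P => Polynomial.comp P (Polynomial.X - Polynomial.C r)) h
    simpa [Polynomial.comp_assoc] using h2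
  have hX : Polynomial.X ^ n ∣ edgePoly e 1 m N 1 := by
    obtain ⟨Q, hQ⟩ := hdvd
    rw [hcomp, hQ, Polynomial.mul_comp]
    refine Dvd.dvd.mul_right ?_ _
    simp
  set k := (edgePoly e 1 m N 1).natTrailingDegree with hk
  have hkc : (edgePoly e 1 m N 1).coeff k ≠ 0 :=
    Polynomial.trailingCoeff_nonzero_iff_nonzero.2 he0
  obtain ⟨A, hA, hAk⟩ := exists_of_coeff_edgePoly_ne_zero one_pos hm hkc
  have hnk : n ≤ k := by
    by_contra! hlt
    exact hkc (Polynomial.X_pow_dvd_iff.1 hX k hlt)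
  refine ⟨A, k, ?_, hAk, fun a' b' hab' => ⟨?_, fun heq => ?_⟩⟩
  · nlinarith
  · have := hWe a' b' hab'
    omega
  · apply Polynomial.natTrailingDegree_le_of_ne_zero
    rw [coeff_edgePoly e one_pos hm 1 (by omega : 1 * a' + m * b' = N), one_pow, mul_one]
    exact hab'

/-- Every support point on the bad side has y ≥ n, and one has y ≤ x, so N ≥ (p + q) n; comparison
with (A, n) gives equality and A = n. The more than n monomials then have x-exponents at most n and
congruent modulo q, which leaves only q = 1. -/
theorem LowPoint.bad {c : ℕ → ℕ → ℝ} (h0 : c 0 0 = 0) {m A n : ℕ} (hL : LowPoint c m A n)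
    (hA : A ≤ n) {p q : ℕ} (hp : 0 < p) (hq : 0 < q) (hcop : Nat.Coprime p q) (hqm : q ≤ m * p)
    (h : Bad c p q) : A = n ∧ q = 1 ∧ WeightGE c p q ((p + q) * n) ∧
      ∀ a b, c a b ≠ 0 → p * a + q * b = (p + q) * n → n ≤ b := by
  obtain ⟨N, k, hW, -, ⟨a, b, hab, hw, hle⟩, hN, r, ε, hr, hε, hdvd⟩ := h
  have hε0 : ε ≠ 0 := by rcases hε with rfl | rfl <;> norm_num
  have hNpos := Bad.weight_pos h0 hp hq hab hw
  have hAN := hW A n hL.1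
  -- For q / p < m, moving below height n along a line of normal (p, q) would cross the supporting
  -- line of normal (1, m); for q / p = m the two lines coincide and the low-point property applies.
  have hline : ∀ x y, c x y ≠ 0 → p * x + q * y = N → n ≤ y := by
    intro x y hxy hxyw
    obtain ⟨h1, h2⟩ := hL.2 x y hxy
    rcases hqm.lt_or_eq with hlt | heq
    · by_contra! hy
      have h3 := Nat.mul_le_mul_left p h1
      zify at *
      nlinarith
    · refine h2 ?_
      have h3 : p * (x + m * y) = N := by rw [← hxyw, heq]; ring
      have h4 : N ≤ p * (A + m * n) := by rw [heq] at hAN; linarith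
      exact le_antisymm (Nat.le_of_mul_le_mul_left (h3 ▸ h4) hp) h1
  have hn := hline a b hab hw
  have hNle : N ≤ (p + q) * n := by nlinarith
  have hNge : (p + q) * n ≤ N := by nlinarith
  have hNeq := le_antisymm hNle hNge
  have hAn : A = n := by nlinarith
  have hnpos : 0 < n := Nat.pos_of_ne_zero fun h => by subst h; omega
  have hnk : n ≤ k := by
    rw [hNeq] at hN
    exact Nat.le_of_mul_le_mul_left hN (by omega)
  refine ⟨hAn, ?_, hNeq ▸ hW, fun x y hxy hw => hline x y hxy (hw.trans hNeq.symm)⟩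
  have hcard := lt_card_support_of_pow_dvd hr k _ (edgePoly_ne_zero hp hq hε0 hab hw) hdvd
  have hex : ∀ y ∈ (edgePoly c p q N ε).support, ∃ x, p * x + q * y = N ∧ c x y ≠ 0 := by
    intro y hy
    exact exists_of_coeff_edgePoly_ne_zero hp hq (Polynomial.mem_support_iff.1 hy)
  choose! f hf using hex
  have hinj : Set.InjOn f ((edgePoly c p q N ε).support : Set ℕ) := by
    intro x hx y hy hxy
    have h1 := (hf x hx).1
    have h2 := (hf y hy).1
    rw [hxy] at h1
    have : q * x = q * y := by omega
    exact Nat.eq_of_mul_eq_mul_left hq this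
  rw [← Finset.card_image_of_injOn hinj] at hcard
  obtain ⟨x, hx, hqx⟩ := exists_mul_le_of_card hq (hnk.trans_lt hcard) (by
    intro x hx y hy
    obtain ⟨u, hu, rfl⟩ := Finset.mem_image.1 hx
    obtain ⟨v, hv, rfl⟩ := Finset.mem_image.1 hy
    refine Nat.ModEq.cancel_left_of_coprime (c := p) hcop.symm ?_
    have h1 : p * f u + q * u ≡ p * f v + q * v [MOD q] := by rw [(hf u hu).1, (hf v hv).1]
    have h2 : ∀ s t : ℕ, s + q * t ≡ s [MOD q] := fun s t => by
      simp [Nat.ModEq]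
    exact ((h2 _ u).symm.trans h1).trans (h2 _ v))
  obtain ⟨u, hu, rfl⟩ := Finset.mem_image.1 hx
  have h1 := (hf u hu).1
  have h2 := hline _ _ (hf u hu).2 h1
  have h3 : f u ≤ n := by
    by_contra! h3
    nlinarith
  have h4 : q * n ≤ 1 * n := by omega
  have := Nat.le_of_mul_le_mul_right h4 hnpos
  omega

/-! ### Vertical shears and the iterative removal of bad roots. -/

/-- The coordinate change `(x, y) ↦ (x, y + a(x))`. -/
def vShear (a : ℝ → ℝ) (z : ℝ × ℝ) : ℝ × ℝ := (z.1, z.2 + a z.1)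

theorem tendsto_scaled_of_isBigO {a : ℝ → ℝ} {p q k : ℕ} (hp : 0 < p) (hpk : q < p * k)
    (ha : a =O[𝓝 0] fun x => x ^ k) (z : ℝ × ℝ) :
    Tendsto (fun tz : ℝ × (ℝ × ℝ) => a (tz.1 ^ p * tz.2.1) / tz.1 ^ q) (𝓝[>] 0 ×ˢ 𝓝 z) (𝓝 0) := by
  obtain ⟨K, hK⟩ := ha.bound
  have h1 : Tendsto (fun tz : ℝ × (ℝ × ℝ) => tz.1 ^ p * tz.2.1) (𝓝[>] 0 ×ˢ 𝓝 z) (𝓝 0) :=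
    (continuous_fst.tendsto _).comp (tendsto_scale hp one_pos z)
  have h2 : Tendsto (fun tz : ℝ × (ℝ × ℝ) => K * (tz.1 ^ (p * k - q) * ‖tz.2.1‖ ^ k))
      (𝓝[>] 0 ×ˢ 𝓝 z) (𝓝 0) := by
    have h3 : Tendsto (fun tz : ℝ × (ℝ × ℝ) => tz.2) (𝓝[>] (0:ℝ) ×ˢ 𝓝 z) (𝓝 z) := tendsto_snd
    have := (((tendsto_fst_nhds (z := z)).pow (p * k - q)).mul
      ((((continuous_fst.tendsto z).comp h3).norm).pow k)).const_mul K
    rwa [zero_pow (by omega), zero_mul, mul_zero] at this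
  refine squeeze_zero_norm' ?_ h2
  filter_upwards [h1.eventually hK, eventually_fst_pos z] with tz h3 h0
  rw [norm_div, Real.norm_of_nonneg (pow_nonneg h0.le q), div_le_iff₀ (pow_pos h0 q)]
  refine h3.trans (le_of_eq ?_)
  rw [norm_pow, norm_mul, Real.norm_of_nonneg (pow_nonneg h0.le p), mul_pow, ← pow_mul,
    show p * k = (p * k - q) + q by omega, pow_add]
  simp only [Nat.add_sub_cancel]
  ring

theorem tendsto_snd_scale {p q : ℕ} (z : ℝ × ℝ) :
    Tendsto (fun tz : ℝ × (ℝ × ℝ) => (tz.1 ^ p * tz.2.1 / tz.1 ^ p, tz.1 ^ q * tz.2.2 / tz.1 ^ q))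
      (𝓝[>] (0:ℝ) ×ˢ 𝓝 z) (𝓝 z) := by
  have h3 : Tendsto (fun tz : ℝ × (ℝ × ℝ) => tz.2) (𝓝[>] (0:ℝ) ×ˢ 𝓝 z) (𝓝 z) := tendsto_snd
  refine h3.congr' ?_
  filter_upwards [eventually_fst_pos z] with tz h0
  rw [mul_div_cancel_left₀ _ (pow_pos h0 p).ne', mul_div_cancel_left₀ _ (pow_pos h0 q).ne']

theorem scaledTo_vShear_id {a : ℝ → ℝ} {p q k : ℕ} (hp : 0 < p) (hpk : q < p * k)
    (ha : a =O[𝓝 0] fun x => x ^ k) : ScaledTo (vShear a) p q id := by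
  intro z
  have h1 := tendsto_snd_scale (p := p) (q := q) z
  have hx := (continuous_fst.tendsto _).comp h1
  have hy := ((continuous_snd.tendsto _).comp h1).add (tendsto_scaled_of_isBigO hp hpk ha z)
  rw [add_zero] at hy
  refine (hx.prodMk_nhds hy).congr fun tz => ?_
  simp only [vShear, Function.comp_apply, add_div]

theorem scaledTo_vShear {a : ℝ → ℝ} {m : ℕ} {r : ℝ}
    (ha : (fun x => a x - r * x ^ m) =O[𝓝 0] fun x => x ^ (m + 1)) :
    ScaledTo (vShear a) 1 m fun z => (z.1, z.2 + r * z.1 ^ m) := by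
  intro z
  have h1 := tendsto_snd_scale (p := 1) (q := m) z
  have hx := (continuous_fst.tendsto _).comp h1
  have h3 : Tendsto (fun tz : ℝ × (ℝ × ℝ) => tz.2) (𝓝[>] (0:ℝ) ×ˢ 𝓝 z) (𝓝 z) := tendsto_snd
  have hr : Tendsto (fun tz : ℝ × (ℝ × ℝ) => r * tz.2.1 ^ m) (𝓝[>] (0:ℝ) ×ˢ 𝓝 z)
      (𝓝 (r * z.1 ^ m)) := (((continuous_fst.tendsto z).comp h3).pow m).const_mul r
  have hy := (((continuous_snd.tendsto _).comp h1).add hr).add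
    (tendsto_scaled_of_isBigO one_pos (show m < 1 * (m + 1) by omega) ha z)
  rw [add_zero] at hy
  refine (hx.prodMk_nhds hy).congr' ?_
  filter_upwards [eventually_fst_pos z] with tz h0
  have := (pow_pos h0 m).ne'
  simp only [vShear, Function.comp_apply]
  refine Prod.ext rfl ?_
  simp only
  field_simp
  ring

theorem SmoothNear.comp_contDiff {S : ℝ × ℝ → ℝ} (hS : SmoothNear S 0) {Φ : ℝ × ℝ → ℝ × ℝ}
    (hΦ : ContDiff ℝ ∞ Φ) (h0 : Φ 0 = 0) : SmoothNear (S ∘ Φ) 0 := by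
  obtain ⟨U, hU, h0U, hSU⟩ := hS
  refine ⟨Φ ⁻¹' U, hU.preimage hΦ.continuous, ?_, hSU.comp hΦ.contDiffOn fun x hx => hx⟩
  rw [Set.mem_preimage, h0]
  exact h0U

theorem contDiff_vShear {a : ℝ → ℝ} (ha : ContDiff ℝ ∞ a) : ContDiff ℝ ∞ (vShear a) :=
  contDiff_fst.prodMk (contDiff_snd.add (ha.comp contDiff_fst))

theorem vShear_zero {a : ℝ → ℝ} (ha : a 0 = 0) : vShear a 0 = 0 := by
  simp [vShear, ha]

theorem vShear_comp (a b : ℝ → ℝ) : vShear a ∘ vShear b = vShear (a + b) := by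
  funext z
  simp [vShear, add_comm, add_left_comm]

theorem SmoothNear.comp_vShear {S : ℝ × ℝ → ℝ} (hS : SmoothNear S 0) {a : ℝ → ℝ}
    (ha : ContDiff ℝ ∞ a) (h0 : a 0 = 0) : SmoothNear (S ∘ vShear a) 0 :=
  hS.comp_contDiff (contDiff_vShear ha) (vShear_zero h0)

theorem SmoothNear.comp_swap {S : ℝ × ℝ → ℝ} (hS : SmoothNear S 0) :
    SmoothNear (S ∘ Prod.swap) 0 :=
  hS.comp_contDiff (contDiff_snd.prodMk contDiff_fst) rfl

theorem taylorCoeff_zero_zero (S : ℝ × ℝ → ℝ) : taylorCoeff S 0 0 = S 0 := by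
  simp [taylorCoeff, partialAtZero]
  rfl

theorem SmoothNear.taylorCoeff_swap {S : ℝ × ℝ → ℝ} (hS : SmoothNear S 0) :
    taylorCoeff (S ∘ Prod.swap) = fun a b => taylorCoeff S b a :=
  hS.comp_swap.hasJet.unique hS.hasJet.swap

theorem eq_zero_of_isBigO_pow {f : ℝ → ℝ} {k : ℕ} (hk : 0 < k) (h : f =O[𝓝 0] fun x => x ^ k) :
    f 0 = 0 := by
  obtain ⟨K, hK⟩ := h.bound
  have := hK.self_of_nhds
  rw [zero_pow hk.ne', norm_zero, mul_zero] at this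
  exact norm_le_zero_iff.1 this

theorem exists_lowPoint {S : ℝ × ℝ → ℝ} (hS : SmoothNear S 0) {a b : ℝ → ℝ} (ha : ContDiff ℝ ∞ a)
    (ha0 : a 0 = 0) (hb : ContDiff ℝ ∞ b) {m : ℕ} (hm : 0 < m) {r : ℝ}
    (hbr : (fun x => b x - r * x ^ m) =O[𝓝 0] fun x => x ^ (m + 1))
    (h : BadRoot (taylorCoeff (S ∘ vShear a)) m r) :
    ∃ A n, A ≤ n ∧ LowPoint (taylorCoeff (S ∘ vShear (a + b))) m A n := by
  have hb0 : b 0 = 0 := by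
    have := eq_zero_of_isBigO_pow (Nat.succ_pos m) hbr
    simpa [hm.ne'] using this
  have h1 := hS.comp_vShear ha ha0
  have h2 := hS.comp_vShear (ha.add hb) (show (a + b) 0 = 0 by simp [ha0, hb0])
  refine h.lowPoint hm fun N hN => ?_
  refine form_comp h1.hasJet h2.hasJet (Φ := vShear b) ?_ one_pos hm (scaledTo_vShear hbr) hN
  rw [Function.comp_assoc, vShear_comp]
  rfl

theorem contDiff_eval (P : ℝ[X]) : ContDiff ℝ ∞ fun x => P.eval x := by
  simpa using P.contDiff_aeval (𝕜 := ℝ) ∞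

theorem eval_isBigO_of_X_pow_dvd {P : ℝ[X]} {k : ℕ} (h : Polynomial.X ^ k ∣ P) :
    (fun x => P.eval x) =O[𝓝 0] fun x => x ^ k := by
  have := (X_sub_C_pow_dvd_iff_isBigO (P := P) (r := 0) (n := k)).1 (by simpa using h)
  simpa using this

/-- This drives the iteration: a bad side with q / p > k supplies the next shear term, of exponent m
> k. -/
theorem Bad.exists_badRoot {c : ℕ → ℕ → ℝ} (h0 : c 0 0 = 0) {p q k : ℕ} (hp : 0 < p) (hq : 0 < q)
    (hkpq : k * p < q) (hk : 0 < k) (h : Bad c p q) : ∃ m r, k < m ∧ BadRoot c m r := by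
  obtain ⟨g, p', q', hg, rfl, rfl, hp', hq', hcop, hbad⟩ := h.exists_coprime hp hq
  have hlt : k * p' < q' := by
    by_contra! hle
    have := Nat.mul_le_mul_left g hle
    nlinarith
  have hle : p' ≤ q' := by nlinarith
  obtain rfl := hbad.eq_one_of_le h0 hp' hcop hle
  obtain ⟨r, hr⟩ := hbad.badRoot
  exact ⟨q', r, by omega, hr⟩

/-- This is the case where the process never stops. The polynomials P k converge coefficientwise and
Borel's lemma sums them. The resulting low points descend to a constant height, below which there is
no support point, so no steeper side can be bad. -/
theorem exists_shear_of_chain {S : ℝ × ℝ → ℝ} (hS : SmoothNear S 0) (h0 : S 0 = 0)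
    {P : ℕ → ℝ[X]} {m : ℕ → ℕ} {r : ℕ → ℝ} (hm0 : 0 < m 0) (hm : ∀ k, m k < m (k + 1))
    (hP : ∀ k, P (k + 1) = P k + Polynomial.C (r k) * Polynomial.X ^ m k)
    (hP0 : P 0 = 0) (hbad : ∀ k, BadRoot (taylorCoeff (S ∘ vShear fun x => (P k).eval x)) (m k) (r k)) :
    ∃ a : ℝ → ℝ, ContDiff ℝ ∞ a ∧
      (fun x => a x - r 0 * x ^ m 0) =O[𝓝 0] (fun x => x ^ (m 0 + 1)) ∧
      ∃ k A n, m 0 ≤ k ∧ A ≤ n ∧ LowPoint (taylorCoeff (S ∘ vShear a)) k A n ∧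
        ∀ p q, 0 < p → 0 < q → k * p < q → ¬ Bad (taylorCoeff (S ∘ vShear a)) p q := by
  have hmono : StrictMono m := strictMono_nat_of_lt_succ hm
  have hmk : ∀ k, k < m k := by
    intro k
    induction k with
    | zero => exact hm0
    | succ k ih => exact lt_of_le_of_lt ih (hm k)
  have hdiff : ∀ i j, i ≤ j → Polynomial.X ^ m i ∣ P j - P i := by
    intro i j hij
    induction j, hij using Nat.le_induction with
    | base => simp
    | succ j hij ih =>
      rw [hP, add_sub_right_comm]
      exact dvd_add ih (Dvd.dvd.mul_left (pow_dvd_pow _ (hmono.monotone hij)) _)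
  have hcoeff : ∀ i j d, i ≤ j → d < m i → (P j).coeff d = (P i).coeff d := by
    intro i j d hij hd
    have := Polynomial.X_pow_dvd_iff.1 (hdiff i j hij) d hd
    rwa [Polynomial.coeff_sub, sub_eq_zero] at this
  -- The coefficient of degree i no longer changes from P (i + 1) on, since later terms have degree
  -- at least m (i + 1) > i.
  obtain ⟨a, ha, haT⟩ := exists_contDiff_of_taylor fun i => (P (i + 1)).coeff i
  have hajet : ∀ k, (fun x => a x - (P (k + 1)).eval x) =O[𝓝 0] fun x => x ^ (m k + 1) := by
    intro k
    have h1 := haT (m k)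
    have h2 : Polynomial.X ^ (m k + 1) ∣ (∑ i ∈ Finset.range (m k + 1),
        Polynomial.C ((P (i + 1)).coeff i) * Polynomial.X ^ i) - P (k + 1) := by
      rw [Polynomial.X_pow_dvd_iff]
      intro d hd
      rw [Polynomial.coeff_sub, Polynomial.finsetSum_coeff, Finset.sum_eq_single d]
      · rw [Polynomial.coeff_C_mul_X_pow, if_pos rfl, sub_eq_zero]
        have hd1 : d < m (d + 1) := (Nat.lt_succ_self d).trans (hmk (d + 1))
        have hd2 : d < m (k + 1) := by have := hm k; omega
        rcases le_total (d + 1) (k + 1) with h | h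
        · exact (hcoeff _ _ d h hd1).symm
        · exact hcoeff _ _ d h hd2
      · intro b _ hb
        rw [Polynomial.coeff_C_mul_X_pow, if_neg (Ne.symm hb)]
      · intro h
        exact absurd (Finset.mem_range.2 hd) h
    refine (h1.add (eval_isBigO_of_X_pow_dvd h2)).congr_left fun x => ?_
    simp only [Polynomial.eval_sub, Polynomial.eval_finsetSum, Polynomial.eval_mul,
      Polynomial.eval_C, Polynomial.eval_pow, Polynomial.eval_X]
    ring
  have hr : ∀ k, (fun x => (a x - (P k).eval x) - r k * x ^ m k) =O[𝓝 0]
      fun x => x ^ (m k + 1) := fun k => (hajet k).congr_left fun x => by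
    rw [hP]; simp; ring
  refine ⟨a, ha, by simpa [hP0] using hr 0, ?_⟩
  have hlow : ∀ k, ∃ A n, A ≤ n ∧ LowPoint (taylorCoeff (S ∘ vShear a)) (m k) A n := by
    intro k
    have hPk0 : (P k).eval 0 = 0 := by
      rw [← Polynomial.coeff_zero_eq_eval_zero, hcoeff 0 k 0 (Nat.zero_le k) hm0, hP0]
      simp
    have hmpos : 0 < m k := (Nat.zero_le k).trans_lt (hmk k)
    have := exists_lowPoint hS (a := fun x => (P k).eval x) (b := fun x => a x - (P k).eval x)
      (contDiff_eval (P k)) hPk0 (ha.sub (contDiff_eval (P k))) hmpos (hr k) (hbad k)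
    have he : ((fun x => (P k).eval x) + fun x => a x - (P k).eval x) = a := by
      funext x; simp
    rwa [he] at this
  choose A n hAn hlow using hlow
  set c := taylorCoeff (S ∘ vShear a) with hc
  -- Each of two successive low points minimises its own weight; adding the two inequalities gives
  -- (m (k + 1) - m k) (n (k + 1) - n k) ≤ 0.
  have hstep : ∀ k, n (k + 1) ≤ n k := by
    intro k
    have h1 := ((hlow k).2 _ _ (hlow (k + 1)).1).1
    have h2 := ((hlow (k + 1)).2 _ _ (hlow k).1).1
    have h3 := hm k
    by_contra! h4
    zify at *
    nlinarith
  have hanti : Antitone n := antitone_nat_of_succ_le hstep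
  obtain ⟨k, hk⟩ : ∃ k, ∀ j, n k ≤ n j := by
    have := Nat.sInf_mem (Set.range_nonempty n)
    obtain ⟨k, hk⟩ := this
    exact ⟨k, fun j => hk ▸ Nat.sInf_le ⟨j, rfl⟩⟩
  -- A support point below the minimal height n k would violate minimality of the low point for a
  -- weight (1, m j) with m j > x.
  have hge : ∀ x y, c x y ≠ 0 → n k ≤ y := by
    intro x y hxy
    by_contra! hlt
    have h1 := ((hlow (max k (x + 1))).2 x y hxy).1
    have h2 : x + 1 < m (max k (x + 1)) := lt_of_le_of_lt (le_max_right _ _) (hmk _)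
    have h3 := hk (max k (x + 1))
    nlinarith
  refine ⟨m k, A k, n k, hmono.monotone (Nat.zero_le k), hAn k, hlow k, ?_⟩
  intro p q hp hq hpq hB
  have hc0 : c 0 0 = 0 := by
    have ha0 : a 0 = 0 := by
      have := eq_zero_of_isBigO_pow (Nat.succ_pos _) (hr 0)
      simpa [hP0, hm0.ne'] using this
    rw [hc, taylorCoeff_zero_zero, Function.comp_apply, vShear_zero ha0, h0]
  -- A bad side has a support point at a height other than n k, hence higher; for q > m k · p its
  -- weight would exceed that of (A k, n k).
  obtain ⟨N, hW, -, hne⟩ := hB.exists_snd_ne hc0 hp hq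
  obtain ⟨x, y, hxy, hw, hy⟩ := hne (n k)
  have h1 := hge x y hxy
  have h2 := hW _ _ (hlow k).1
  have h3 := ((hlow k).2 x y hxy).1
  have h4 : n k < y := lt_of_le_of_ne h1 (Ne.symm hy)
  have h5 := Nat.mul_le_mul_left p h3
  zify at *
  nlinarith

/-- Either some state reached by the process leaves no bad side beyond its last exponent, and its
polynomial is the shear, or states can be chosen forever and `exists_shear_of_chain` applies. -/
theorem exists_shear {S : ℝ × ℝ → ℝ} (hS : SmoothNear S 0) (h0 : S 0 = 0)
    {m₀ : ℕ} {r₀ : ℝ} (hm₀ : 0 < m₀) (hbad : BadRoot (taylorCoeff S) m₀ r₀) :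
    ∃ a : ℝ → ℝ, ContDiff ℝ ∞ a ∧
      (fun x => a x - r₀ * x ^ m₀) =O[𝓝 0] (fun x => x ^ (m₀ + 1)) ∧
      ∃ k A n, m₀ ≤ k ∧ A ≤ n ∧ LowPoint (taylorCoeff (S ∘ vShear a)) k A n ∧
        ∀ p q, 0 < p → 0 < q → k * p < q → ¬ Bad (taylorCoeff (S ∘ vShear a)) p q := by
  -- A state is the shear polynomial so far together with the exponent and coefficient of the next
  -- term. The divisibility records that the prescribed leading term r₀ x^m₀ is never disturbed.
  let V : ℝ[X] × ℕ × ℝ → Prop := fun s => m₀ ≤ s.2.1 ∧ Polynomial.X ∣ s.1 ∧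
    Polynomial.X ^ (m₀ + 1) ∣
      s.1 + Polynomial.C s.2.2 * Polynomial.X ^ s.2.1 - Polynomial.C r₀ * Polynomial.X ^ m₀ ∧
    BadRoot (taylorCoeff (S ∘ vShear fun x => s.1.eval x)) s.2.1 s.2.2
  let nextP : ℝ[X] × ℕ × ℝ → ℝ[X] := fun s =>
    s.1 + Polynomial.C s.2.2 * Polynomial.X ^ s.2.1
  by_cases hterm : ∃ s, V s ∧ ∀ p q, 0 < p → 0 < q → s.2.1 * p < q →
      ¬ Bad (taylorCoeff (S ∘ vShear fun x => (nextP s).eval x)) p q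
  · obtain ⟨⟨P, m, r⟩, ⟨hm, hX, hdvd, hb⟩, hno⟩ := hterm
    simp only at hm hX hdvd hb
    have hP0 : P.eval 0 = 0 := by
      rw [← Polynomial.coeff_zero_eq_eval_zero]
      exact Polynomial.X_dvd_iff.1 hX
    have hlow := exists_lowPoint hS (a := fun x => P.eval x) (b := fun x => r * x ^ m)
      (contDiff_eval P) hP0 (contDiff_const.mul (contDiff_id.pow m)) (hm₀.trans_le hm)
      (by simpa using isBigO_zero _ _) hb
    obtain ⟨A, n, hAn, hlow⟩ := hlow
    have he : ((fun x => P.eval x) + fun x => r * x ^ m) = fun x => (nextP (P, m, r)).eval x := by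
      funext x; simp [nextP]
    rw [he] at hlow
    refine ⟨fun x => (nextP (P, m, r)).eval x, contDiff_eval (nextP (P, m, r)), ?_, m, A, n, hm, hAn,
      hlow, hno⟩
    exact (eval_isBigO_of_X_pow_dvd hdvd).congr_left fun x => by simp [nextP]
  · push Not at hterm
    have hnext : ∀ s : {s // V s}, ∃ s' : {s // V s}, s'.1.1 = nextP s.1 ∧ s.1.2.1 < s'.1.2.1 := by
      rintro ⟨⟨P, m, r⟩, hV⟩
      obtain ⟨p, q, hp, hq, hpq, hB⟩ := hterm _ hV
      obtain ⟨hm, hX, hdvd, hb⟩ := hV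
      simp only at hm hX hdvd hb hpq
      have hXn : Polynomial.X ∣ nextP (P, m, r) :=
        dvd_add hX (Dvd.dvd.mul_left (dvd_pow_self _ (hm₀.trans_le hm).ne') _)
      have hc0 : taylorCoeff (S ∘ vShear fun x => (nextP (P, m, r)).eval x) 0 0 = 0 := by
        rw [taylorCoeff_zero_zero, Function.comp_apply, vShear_zero, h0]
        rw [← Polynomial.coeff_zero_eq_eval_zero]
        exact Polynomial.X_dvd_iff.1 hXn
      obtain ⟨m', r', hmm', hb'⟩ := hB.exists_badRoot hc0 hp hq hpq (hm₀.trans_le hm)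
      refine ⟨⟨(nextP (P, m, r), m', r'), hm.trans hmm'.le, hXn, ?_, hb'⟩, rfl, hmm'⟩
      simp only [nextP]
      rw [add_sub_right_comm]
      exact dvd_add hdvd (Dvd.dvd.mul_left (pow_dvd_pow _ (by omega)) _)
    choose f hf1 hf2 using hnext
    have hV0 : V (0, m₀, r₀) := by
      refine ⟨le_rfl, dvd_zero _, by simp, ?_⟩
      have : (vShear fun x => (0 : ℝ[X]).eval x) = id := by
        funext z; simp [vShear]
      rw [this]
      exact hbad
    let s : ℕ → {s // V s} := fun k => f^[k] ⟨_, hV0⟩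
    have hs : ∀ k, s (k + 1) = f (s k) := fun k => Function.iterate_succ_apply' f k _
    exact exists_shear_of_chain hS h0 (P := fun k => (s k).1.1) (m := fun k => (s k).1.2.1)
      (r := fun k => (s k).1.2.2) hm₀ (fun k => by simp only [hs]; exact hf2 _)
      (fun k => by simp only [hs]; exact hf1 _) rfl (fun k => (s k).2.2.2.2)

/-! ### Diagonal vertices and the shear in the other variable. -/

/-- The point `(n, n)` is the only support point minimising some positive weight. -/
def DiagonalVertex (c : ℕ → ℕ → ℝ) : Prop :=
  ∃ p q n : ℕ, 0 < p ∧ 0 < q ∧ c n n ≠ 0 ∧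
    ∀ a b, c a b ≠ 0 → p * a + q * b ≤ (p + q) * n → a = n ∧ b = n

theorem LowPoint.diagonalVertex {c : ℕ → ℕ → ℝ} {m n : ℕ} (h : LowPoint c m n n) :
    DiagonalVertex c := by
  -- The weight is (n + 1)(a + m b) + b: points off the face lose by at least n + 1, more than the
  -- tie-breaking term b can recover, and on the face b singles out the lowest point.
  refine ⟨n + 1, (n + 1) * m + 1, n, Nat.succ_pos n, Nat.succ_pos _, h.1, fun a b hab hle => ?_⟩
  obtain ⟨h1, h2⟩ := h.2 a b hab
  have h3 : a + m * b = n + m * n := by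
    refine le_antisymm ?_ h1
    by_contra! h3
    have h4 : (n + 1) * (n + m * n + 1) ≤ (n + 1) * (a + m * b) := Nat.mul_le_mul_left _ h3
    nlinarith
  have h4 := h2 h3
  have h5 : b ≤ n := by nlinarith
  have h6 : b = n := le_antisymm h5 h4
  subst h6
  exact ⟨by omega, rfl⟩

theorem bad_congr {c e : ℕ → ℕ → ℝ} {p q : ℕ} (hp : 0 < p) (hq : 0 < q) {N : ℕ}
    (hWe : WeightGE e p q N) (hc : ∃ a b, c a b ≠ 0 ∧ p * a + q * b = N) (hWc : WeightGE c p q N)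
    (h : ∀ a b, p * a + q * b = N → e a b = c a b) (hB : Bad c p q) : Bad e p q := by
  obtain ⟨N', n, hW, ⟨a, b, hab, hw, hle⟩, ⟨a', b', hab', hw', hle'⟩, hN, r, ε, hr, hε, hdvd⟩ := hB
  obtain ⟨x, y, hxy, hwxy⟩ := hc
  have hNN : N' = N := le_antisymm (by have := hW x y hxy; omega) (by have := hWc a b hab; omega)
  subst hNN
  refine ⟨N', n, hWe, ⟨a, b, by rwa [h a b hw], hw, hle⟩, ⟨a', b', by rwa [h a' b' hw'], hw', hle'⟩,
    hN, r, ε, hr, hε, ?_⟩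
  have : edgePoly e p q N' ε = edgePoly c p q N' ε := by
    refine Finset.sum_congr rfl fun ab hab => ?_
    rw [h _ _ ((mem_lineSet hp hq).1 hab)]
  rwa [this]

theorem form_congr_coeff {c e : ℕ → ℕ → ℝ} {p q N : ℕ} (hp : 0 < p) (hq : 0 < q)
    (h : ∀ z, form e p q N z = form c p q N z) {a b : ℕ} (hab : p * a + q * b = N) :
    e a b = c a b := by
  have h1 : edgePoly e p q N 1 = edgePoly c p q N 1 := Polynomial.funext fun y => by
    rw [eval_edgePoly, eval_edgePoly, h]
  have h2 := coeff_edgePoly e hp hq 1 hab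
  have h3 := coeff_edgePoly c hp hq 1 hab
  rw [h1, h3] at h2
  simpa using h2.symm

/-- On the line, P (A - x) = Q (y - A) ≥ p P (y - A), so A - x ≥ p (y - A). -/
theorem add_mul_le_of_weight_eq {p P Q A x y : ℕ} (hP : 0 < P) (hpQ : p * P ≤ Q) (hy : A < y)
    (hx : x < A) (hw : P * x + Q * y = (P + Q) * A) : x + p * y ≤ A + p * A := by
  obtain ⟨s, rfl⟩ := Nat.exists_eq_add_of_lt hy
  obtain ⟨t, rfl⟩ := Nat.exists_eq_add_of_lt hx
  have h5 : P * (t + 1) = Q * (s + 1) := by linarith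
  have h6 : P * (p * (s + 1)) ≤ P * (t + 1) := by
    rw [h5]
    calc P * (p * (s + 1)) = p * P * (s + 1) := by ring
      _ ≤ Q * (s + 1) := Nat.mul_le_mul_right _ hpQ
  have h7 := Nat.le_of_mul_le_mul_left h6 hP
  linarith

theorem isBigO_pow_of_sub {a : ℝ → ℝ} {r : ℝ} {p : ℕ}
    (har : (fun x => a x - r * x ^ p) =O[𝓝 0] fun x => x ^ (p + 1)) :
    a =O[𝓝 0] fun x => x ^ p := by
  have h4 : (fun x : ℝ => r * x ^ p) =O[𝓝 0] fun x => x ^ p :=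
    (isBigO_refl (fun x : ℝ => x ^ p) _).const_mul_left r
  have h5 : (fun x : ℝ => x ^ (p + 1)) =O[𝓝 0] fun x => x ^ p := by
    refine (((continuous_id.tendsto (0 : ℝ)).isBigO_one ℝ).mul
      (isBigO_refl (fun x : ℝ => x ^ p) _)).congr (fun x => ?_) fun x => one_mul _
    simp [pow_succ, mul_comm]
  exact ((har.trans h5).add h4).congr_left fun x => sub_add_cancel _ _

/-- A shear of high order does not change the leading parts for small weights. -/
theorem taylorCoeff_comp_vShear_eq {S : ℝ × ℝ → ℝ} (hS : SmoothNear S 0) {a : ℝ → ℝ}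
    (ha : ContDiff ℝ ∞ a) (ha0 : a 0 = 0) {k p q N : ℕ} (hp : 0 < p) (hq : 0 < q)
    (hpk : q < p * k) (hak : a =O[𝓝 0] fun x => x ^ k)
    (hW : WeightGE (taylorCoeff (S ∘ vShear a)) p q N) : WeightGE (taylorCoeff S) p q N ∧
      ∀ x y, p * x + q * y = N → taylorCoeff S x y = taylorCoeff (S ∘ vShear a) x y := by
  obtain ⟨h1, h2⟩ := form_comp (hS.comp_vShear ha ha0).hasJet hS.hasJet (Φ := vShear (-a))
    (by
      rw [Function.comp_assoc, vShear_comp, add_neg_cancel]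
      have : vShear 0 = id := by funext z; simp [vShear]
      rw [this, Function.comp_id]) hp hq (scaledTo_vShear_id hp hpk hak.neg_left) hW
  exact ⟨h1, fun x y h => form_congr_coeff hp hq h2 h⟩

/-- The surviving bad side has normal (p, 1) and lowest point (A, A). After the swap its edge
polynomial has degree at most A and a root of order at least A, so it is a constant times (X - r)^A.
The next shear turns it into a monomial and (A, A) into a vertex; higher-order shear terms do not
affect this side. -/
theorem exists_shear_of_lowPoint {T : ℝ × ℝ → ℝ} (hT : SmoothNear T 0) (h0 : T 0 = 0) {m A n : ℕ}
    (hA : A ≤ n) (hlow : LowPoint (taylorCoeff T) m A n)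
    (hno : ∀ p q, 0 < p → 0 < q → m * p < q → ¬ Bad (taylorCoeff T) p q)
    {p₀ q₀ : ℕ} (hp₀ : 0 < p₀) (hq₀ : 0 < q₀) (hbad : Bad (taylorCoeff T) p₀ q₀) :
    DiagonalVertex (taylorCoeff T) ∧ ∃ a : ℝ → ℝ, ContDiff ℝ ∞ a ∧ a 0 = 0 ∧
      DiagonalVertex (taylorCoeff (T ∘ Prod.swap ∘ vShear a)) ∧
      ∀ p q, 0 < p → 0 < q → ¬ Bad (taylorCoeff (T ∘ Prod.swap ∘ vShear a)) p q := by
  set c := taylorCoeff T with hc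
  have hc0 : c 0 0 = 0 := by rw [hc, taylorCoeff_zero_zero, h0]
  obtain ⟨g, p, q, -, -, -, hp, hq, hcop, hB⟩ := hbad.exists_coprime hp₀ hq₀
  have hqm : q ≤ m * p := not_lt.1 fun h => hno p q hp hq h hB
  obtain ⟨rfl, rfl, hW, hline⟩ := hlow.bad hc0 hA hp hq hcop hqm hB
  refine ⟨hlow.diagonalVertex, ?_⟩
  have hT2 := hT.comp_swap
  have hc2 : taylorCoeff (T ∘ Prod.swap) = fun a b => c b a := hT.taylorCoeff_swap
  have hB2 : Bad (taylorCoeff (T ∘ Prod.swap)) 1 p := by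
    rw [hc2]; exact hB.swap hp one_pos
  set N := (p + 1) * A with hN
  have hW2 : WeightGE (taylorCoeff (T ∘ Prod.swap)) 1 p N := by rw [hc2]; exact hW.swap
  have hwA : 1 * A + p * A = N := by rw [hN]; ring
  obtain ⟨r, hr⟩ := hB2.badRoot
  obtain ⟨a, ha, har, m', A', n', hm', hA', hlow', hno'⟩ := exists_shear hT2 (by simpa using h0) hp hr
  have ha0 : a 0 = 0 := by
    have := eq_zero_of_isBigO_pow (Nat.succ_pos p) har
    simpa [hp.ne'] using this
  have hT3 := hT2.comp_vShear ha ha0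
  rw [Function.comp_assoc] at hT3 hlow'
  refine ⟨a, ha, ha0, ?_⟩
  set c3 := taylorCoeff (T ∘ Prod.swap ∘ vShear a) with hc3
  have hc30 : c3 0 0 = 0 := by
    rw [hc3, taylorCoeff_zero_zero]
    simp [vShear_zero ha0, h0]
  obtain ⟨hW3, hform3⟩ := form_comp hT2.hasJet hT3.hasJet (Φ := vShear a)
    (by rw [Function.comp_assoc]) one_pos hp (scaledTo_vShear har) hW2
  -- the leading part for the weights `(1, p)` is a monomial after the shear
  have hE2deg : (edgePoly (taylorCoeff (T ∘ Prod.swap)) 1 p N 1).natDegree ≤ A := by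
    refine Polynomial.natDegree_le_iff_coeff_eq_zero.2 fun b hb => ?_
    by_contra hne
    obtain ⟨x, hx, hxb⟩ := exists_of_coeff_edgePoly_ne_zero one_pos hp hne
    rw [hc2] at hxb
    have h1 := hline b x hxb (by linarith)
    nlinarith
  have hA2 : taylorCoeff (T ∘ Prod.swap) A A ≠ 0 := by rw [hc2]; exact hlow.1
  have hE2ne := edgePoly_ne_zero one_pos hp one_ne_zero hA2 hwA
  have hcomp : edgePoly c3 1 p N 1 = (edgePoly (taylorCoeff (T ∘ Prod.swap)) 1 p N 1).comp
      (Polynomial.X + Polynomial.C r) := by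
    refine Polynomial.funext fun y => ?_
    rw [eval_edgePoly, Polynomial.eval_comp, eval_edgePoly, hform3]
    simp
  have hE3deg : (edgePoly c3 1 p N 1).natDegree ≤ A := by
    rw [hcomp, Polynomial.natDegree_comp, Polynomial.natDegree_X_add_C, mul_one]
    exact hE2deg
  have hE3ne : edgePoly c3 1 p N 1 ≠ 0 := by
    rw [hcomp]
    intro h
    apply hE2ne
    have h2 := congrArg (fun P => Polynomial.comp P (Polynomial.X - Polynomial.C r)) h
    simpa [Polynomial.comp_assoc] using h2
  have hE3dvd : Polynomial.X ^ A ∣ edgePoly c3 1 p N 1 := by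
    obtain ⟨-, N', k, hWN', ⟨x, y, hxy, hwxy⟩, hN', hdvd⟩ := hr
    have hNN : N' = N := le_antisymm (by have := hWN' A A hA2; omega)
      (by have := hW2 x y hxy; omega)
    subst hNN
    have hk : A ≤ k := by
      rw [hN, add_comm p 1] at hN'
      exact Nat.le_of_mul_le_mul_left hN' (by omega)
    refine (pow_dvd_pow _ hk).trans ?_
    obtain ⟨Q, hQ⟩ := hdvd
    rw [hcomp, hQ, Polynomial.mul_comp]
    refine Dvd.dvd.mul_right ?_ _
    simp
  -- Degree at most A and divisibility by X^A leave only the monomial X^A.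
  have hon3 : ∀ x y, c3 x y ≠ 0 → 1 * x + p * y = N → y = A ∧ x = A := by
    intro x y hxy hw
    have h1 : (edgePoly c3 1 p N 1).coeff y ≠ 0 := by
      rw [coeff_edgePoly c3 one_pos hp 1 hw]
      simpa using hxy
    have h2 : y ≤ A := (Polynomial.le_natDegree_of_ne_zero h1).trans hE3deg
    have h3 : A ≤ y := by
      by_contra! hlt
      exact h1 (Polynomial.X_pow_dvd_iff.1 hE3dvd y hlt)
    have h4 := le_antisymm h2 h3
    subst h4
    exact ⟨rfl, by omega⟩
  have hA3 : c3 A A ≠ 0 := by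
    obtain ⟨y, hy⟩ := Polynomial.nonempty_support_iff.2 hE3ne
    rw [Polynomial.mem_support_iff] at hy
    obtain ⟨x, hw, hxy⟩ := exists_of_coeff_edgePoly_ne_zero one_pos hp hy
    obtain ⟨rfl, rfl⟩ := hon3 x y hxy hw
    exact hxy
  refine ⟨⟨1, p, A, one_pos, hp, hA3, fun x y hxy hle => ?_⟩, ?_⟩
  · have h1 := hW3 x y hxy
    have h2 := hon3 x y hxy (by nlinarith)
    exact ⟨h2.2, h2.1⟩
  intro P₀ Q₀ hP₀ hQ₀ hB3
  obtain ⟨-, P, Q, -, -, -, hP, hQ, hcopPQ, hB3⟩ := hB3.exists_coprime hP₀ hQ₀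
  have hQm : Q ≤ m' * P := not_lt.1 fun h => hno' P Q hP hQ h hB3
  obtain ⟨rfl, -, hWPQ, hlinePQ⟩ := hlow'.bad hc30 hA' hP hQ hcopPQ hQm hB3
  have hAA : A' = A := by
    refine le_antisymm ?_ ?_
    · have h1 := hWPQ A A hA3
      rw [← add_mul] at h1
      exact Nat.le_of_mul_le_mul_left h1 (by omega)
    · have h1 := hW3 A' A' hlow'.1
      have h2 : (1 + p) * A ≤ (1 + p) * A' := by nlinarith
      exact Nat.le_of_mul_le_mul_left h2 (by omega)
  subst hAA
  obtain ⟨N', hWN', ⟨u, v, huv, hwuv⟩, hne⟩ := hB3.exists_snd_ne hc30 hP hQ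
  have hNN : N' = (P + Q) * A' := le_antisymm (by have := hWN' A' A' hA3; nlinarith)
    (by have := hWPQ u v huv; omega)
  obtain ⟨x, y, hxy, hw, hy⟩ := hne A'
  have hy1 := hlinePQ x y hxy (hw.trans hNN)
  have hy2 : A' < y := lt_of_le_of_ne hy1 (Ne.symm hy)
  have hx : x < A' := by
    by_contra! h
    nlinarith
  have h3 := hW3 x y hxy
  -- If Q ≥ p P, the second support point (x, y) would lie on or below x + p y = (1 + p) A, where
  -- only (A, A) occurs. Otherwise the side was already bad before this shear, contradicting the
  -- first low point.
  rcases le_or_gt (p * P) Q with hle | hlt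
  · have h4 := add_mul_le_of_weight_eq hP hle hy2 hx (hw.trans hNN)
    exact hy (hon3 x y hxy (by omega)).1
  · -- below slope `p` the leading parts before and after the shear agree
    obtain ⟨hW2', hco⟩ := taylorCoeff_comp_vShear_eq hT2 ha ha0 hP hQ
      (by rw [mul_comm P p]; exact hlt) (isBigO_pow_of_sub har) hWPQ
    have hBc2 : Bad (taylorCoeff (T ∘ Prod.swap)) P Q :=
      bad_congr hP hQ hW2' ⟨u, v, huv, by omega⟩ hWPQ hco hB3
    rw [hc2] at hBc2
    have hBc : Bad c Q P := hBc2.swap hP hQ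
    have hPm : P ≤ m * Q := not_lt.1 fun h => hno Q P hQ hP h hBc
    obtain ⟨-, -, -, hline'⟩ := hlow.bad hc0 le_rfl hQ hP hcopPQ.symm hPm hBc
    have h4 : c y x ≠ 0 := by
      have := hco x y (hw.trans hNN)
      rw [hc2] at this
      simp only at this
      rwa [this]
    have := hline' y x h4 (by rw [add_comm Q P, ← hNN, ← hw]; ring)
    omega

/-- The smooth coordinate changes needed to remove all roots of large order, when one of them
occurs for a weight `(p, q)` with `p ≤ q`. -/
theorem exists_shears_of_bad {S : ℝ × ℝ → ℝ} (hS : SmoothNear S 0) (h0 : S 0 = 0) {p q : ℕ}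
    (hp : 0 < p) (hpq : p ≤ q) (hB : Bad (taylorCoeff S) p q) :
    ∃ a : ℝ → ℝ, ContDiff ℝ ∞ a ∧ a 0 = 0 ∧
      ((∀ p q, 0 < p → 0 < q → ¬ Bad (taylorCoeff (S ∘ vShear a)) p q) ∨
      DiagonalVertex (taylorCoeff (S ∘ vShear a)) ∧ ∃ b : ℝ → ℝ, ContDiff ℝ ∞ b ∧ b 0 = 0 ∧
        DiagonalVertex (taylorCoeff (S ∘ vShear a ∘ Prod.swap ∘ vShear b)) ∧
        ∀ p q, 0 < p → 0 < q →
          ¬ Bad (taylorCoeff (S ∘ vShear a ∘ Prod.swap ∘ vShear b)) p q) := by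
  have hc0 : taylorCoeff S 0 0 = 0 := by rw [taylorCoeff_zero_zero, h0]
  obtain ⟨g, p', q', hg, rfl, rfl, hp', hq', hcop, hB⟩ := hB.exists_coprime hp (hp.trans_le hpq)
  have hpq' : p' ≤ q' := Nat.le_of_mul_le_mul_left hpq hg
  obtain rfl := hB.eq_one_of_le hc0 hp' hcop hpq'
  obtain ⟨r, hr⟩ := hB.badRoot
  obtain ⟨a, ha, har, m, A, n, -, hA, hlow, hno⟩ := exists_shear hS h0 hq' hr
  have ha0 : a 0 = 0 := by
    have := eq_zero_of_isBigO_pow (Nat.succ_pos q') har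
    simpa [hq'.ne'] using this
  refine ⟨a, ha, ha0, ?_⟩
  by_cases h : ∃ p q, 0 < p ∧ 0 < q ∧ Bad (taylorCoeff (S ∘ vShear a)) p q
  · obtain ⟨p₁, q₁, hp₁, hq₁, hB₁⟩ := h
    right
    exact exists_shear_of_lowPoint (hS.comp_vShear ha ha0) (by simp [vShear_zero ha0, h0]) hA hlow
      hno hp₁ hq₁ hB₁
  · left
    push Not at h
    exact h

/-! ### Convex geometry of the Newton polygon. -/

/-- The union of the quadrants whose corners are the support points. -/
def quadrants (c : ℕ → ℕ → ℝ) : Set (ℝ × ℝ) :=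
  {z | ∃ a b : ℕ, c a b ≠ 0 ∧ (a : ℝ) ≤ z.1 ∧ (b : ℝ) ≤ z.2}

theorem newtonPolygon_eq (S : ℝ × ℝ → ℝ) :
    newtonPolygon S = convexHull ℝ (quadrants (taylorCoeff S)) := rfl

variable {c : ℕ → ℕ → ℝ}

theorem mem_hull_of_ne_zero {a b : ℕ} (h : c a b ≠ 0) :
    ((a : ℝ), (b : ℝ)) ∈ convexHull ℝ (quadrants c) :=
  subset_convexHull ℝ _ ⟨a, b, h, le_rfl, le_rfl⟩

theorem convex_halfPlane_ge (u v K : ℝ) : Convex ℝ {z : ℝ × ℝ | K ≤ u * z.1 + v * z.2} := by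
  intro x hx y hy s t hs ht hst
  simp only [Set.mem_ofPred_eq, Prod.fst_add, Prod.snd_add, Prod.smul_fst, Prod.smul_snd,
    smul_eq_mul] at *
  have : s * K + t * K = K := by rw [← add_mul, hst, one_mul]
  linarith [mul_le_mul_of_nonneg_left hx hs, mul_le_mul_of_nonneg_left hy ht]

theorem le_of_mem_hull {u v K : ℝ} (hu : 0 ≤ u) (hv : 0 ≤ v)
    (h : ∀ a b : ℕ, c a b ≠ 0 → K ≤ u * a + v * b) {z : ℝ × ℝ}
    (hz : z ∈ convexHull ℝ (quadrants c)) : K ≤ u * z.1 + v * z.2 := by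
  refine convexHull_min ?_ (convex_halfPlane_ge u v K) hz
  rintro w ⟨a, b, hab, h1, h2⟩
  have := h a b hab
  simp only [Set.mem_ofPred_eq]
  nlinarith [mul_le_mul_of_nonneg_left h1 hu, mul_le_mul_of_nonneg_left h2 hv]

theorem nonneg_of_mem_hull {z : ℝ × ℝ} (hz : z ∈ convexHull ℝ (quadrants c)) :
    0 ≤ z.1 ∧ 0 ≤ z.2 := by
  have h1 := le_of_mem_hull (c := c) (u := 1) (v := 0) (K := 0) zero_le_one le_rfl
    (fun a b _ => by simp) hz
  have h2 := le_of_mem_hull (c := c) (u := 0) (v := 1) (K := 0) le_rfl zero_le_one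
    (fun a b _ => by simp) hz
  simp only [one_mul, zero_mul, add_zero, zero_add] at h1 h2
  exact ⟨h1, h2⟩

/-- A face with positive normal is spanned by the support points on it. -/
theorem mem_convexHull_of_weight_eq {u v K : ℝ} (hu : 0 < u) (hv : 0 < v)
    (h : ∀ a b : ℕ, c a b ≠ 0 → K ≤ u * a + v * b) {z : ℝ × ℝ}
    (hz : z ∈ convexHull ℝ (quadrants c)) (hzK : u * z.1 + v * z.2 = K) :
    z ∈ convexHull ℝ {w : ℝ × ℝ | ∃ a b : ℕ, c a b ≠ 0 ∧ u * a + v * b = K ∧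
      w = ((a : ℝ), (b : ℝ))} := by
  set F := {w : ℝ × ℝ | ∃ a b : ℕ, c a b ≠ 0 ∧ u * a + v * b = K ∧ w = ((a : ℝ), (b : ℝ))}
  have hconv : Convex ℝ {w : ℝ × ℝ | K ≤ u * w.1 + v * w.2 ∧
      (u * w.1 + v * w.2 = K → w ∈ convexHull ℝ F)} := by
    intro x hx y hy s t hs ht hst
    refine ⟨convex_halfPlane_ge u v K hx.1 hy.1 hs ht hst, fun heq => ?_⟩
    simp only [Prod.fst_add, Prod.snd_add, Prod.smul_fst, Prod.smul_snd, smul_eq_mul] at heq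
    rcases hs.eq_or_lt with rfl | hs'
    · obtain rfl : t = 1 := by linarith
      simp only [zero_smul, one_smul, zero_add]
      exact hy.2 (by linarith)
    rcases ht.eq_or_lt with rfl | ht'
    · obtain rfl : s = 1 := by linarith
      simp only [zero_smul, one_smul, add_zero]
      exact hx.2 (by linarith)
    have h1 : s * (u * x.1 + v * x.2 - K) + t * (u * y.1 + v * y.2 - K) = 0 := by
      linear_combination heq - K * hst
    have h2 := mul_nonneg hs (sub_nonneg.2 hx.1)
    have h3 := mul_nonneg ht (sub_nonneg.2 hy.1)
    have h4 : s * (u * x.1 + v * x.2 - K) = 0 := by linarith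
    have h5 : t * (u * y.1 + v * y.2 - K) = 0 := by linarith
    exact convex_convexHull ℝ F (hx.2 (by linarith [(mul_eq_zero.1 h4).resolve_left hs'.ne']))
      (hy.2 (by linarith [(mul_eq_zero.1 h5).resolve_left ht'.ne'])) hs ht hst
  refine (convexHull_min ?_ hconv hz).2 hzK
  rintro w ⟨a, b, hab, h1, h2⟩
  have h0 := h a b hab
  have h3 := mul_le_mul_of_nonneg_left h1 hu.le
  have h4 := mul_le_mul_of_nonneg_left h2 hv.le
  refine ⟨by linarith, fun heq => subset_convexHull ℝ _ ⟨a, b, hab, by linarith, ?_⟩⟩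
  have h5 : u * (w.1 - a) = 0 := by linarith
  have h6 : v * (w.2 - b) = 0 := by linarith
  have h7 := (mul_eq_zero.1 h5).resolve_left hu.ne'
  have h8 := (mul_eq_zero.1 h6).resolve_left hv.ne'
  exact Prod.ext (by simp only; linarith) (by simp only; linarith)

theorem add_mem_hull {z w : ℝ × ℝ} (hz : z ∈ convexHull ℝ (quadrants c)) (h1 : 0 ≤ w.1)
    (h2 : 0 ≤ w.2) : z + w ∈ convexHull ℝ (quadrants c) := by
  have hconv : Convex ℝ {x : ℝ × ℝ | x + w ∈ convexHull ℝ (quadrants c)} :=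
    (convex_convexHull ℝ (quadrants c)).translate_preimage_left w
  refine convexHull_min ?_ hconv hz
  rintro x ⟨a, b, hab, h3, h4⟩
  refine subset_convexHull ℝ _ ⟨a, b, hab, ?_, ?_⟩
  · simp only [Prod.fst_add]; linarith
  · simp only [Prod.snd_add]; linarith

-- By Dickson's lemma there are finitely many minimal support points; the polygon is their compact
-- hull plus a closed quadrant.
open Pointwise in
theorem isClosed_hull (c : ℕ → ℕ → ℝ) : IsClosed (convexHull ℝ (quadrants c)) := by
  set A : Set (ℕ × ℕ) := {ab | c ab.1 ab.2 ≠ 0}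
  set F : Set (ℕ × ℕ) := {ab | Minimal (· ∈ A) ab}
  have hF : F.Finite := WellQuasiOrderedLE.finite_of_isAntichain (setOfPred_minimal_antichain _)
  set G : Set (ℝ × ℝ) := (fun ab : ℕ × ℕ => ((ab.1 : ℝ), (ab.2 : ℝ))) '' F
  have hG : IsCompact (convexHull ℝ G) := Set.Finite.isCompact_convexHull ℝ (hF.image _)
  have heq : convexHull ℝ (quadrants c) = convexHull ℝ G + Set.Ici (0 : ℝ × ℝ) := by
    apply Set.Subset.antisymm
    · refine convexHull_min ?_ ((convex_convexHull ℝ G).add (convex_Ici 0))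
      rintro z ⟨a, b, hab, h1, h2⟩
      obtain ⟨⟨a', b'⟩, hle, hmin⟩ := exists_minimal_le_of_wellFoundedLT (· ∈ A) (a, b) hab
      refine ⟨((a' : ℝ), (b' : ℝ)), subset_convexHull ℝ _ ⟨(a', b'), hmin, rfl⟩,
        z - ((a' : ℝ), (b' : ℝ)), ?_, by simp⟩
      have h3 : (a' : ℝ) ≤ a := by exact_mod_cast hle.1
      have h4 : (b' : ℝ) ≤ b := by exact_mod_cast hle.2
      rw [Set.mem_Ici, Prod.le_def]
      simp only [Prod.fst_zero, Prod.snd_zero, Prod.fst_sub, Prod.snd_sub, sub_nonneg]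
      exact ⟨h3.trans h1, h4.trans h2⟩
    · rintro _ ⟨x, hx, w, hw, rfl⟩
      refine add_mem_hull (convexHull_mono ?_ hx) hw.1 hw.2
      rintro _ ⟨ab, hab, rfl⟩
      exact ⟨ab.1, ab.2, hab.1, le_rfl, le_rfl⟩
  rw [heq]
  exact isClosed_Ici.add_left_of_isCompact hG

theorem newtonDistance_eq {S : ℝ × ℝ → ℝ} {u v t : ℝ} (huv : 0 < u + v)
    (h : ∀ z ∈ newtonPolygon S, (u + v) * t ≤ u * z.1 + v * z.2) (ht : (t, t) ∈ newtonPolygon S) :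
    newtonDistance S = t := by
  refine IsLeast.csInf_eq ⟨ht, fun s hs => ?_⟩
  have := h _ hs
  simp only at this
  rw [← add_mul] at this
  exact le_of_mul_le_mul_left this huv

/-- The polygon is stable under adding nonnegative vectors, so a functional maximised on it has
nonpositive coefficients; they are not both zero because the edge is a proper face. -/
theorem IsEdge.exists_weight {S : ℝ × ℝ → ℝ} {e : Set (ℝ × ℝ)} (he : IsEdge S e) :
    ∃ u v K : ℝ, 0 ≤ u ∧ 0 ≤ v ∧ 0 < u + v ∧ (∀ z ∈ newtonPolygon S, K ≤ u * z.1 + v * z.2) ∧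
      e = {z ∈ newtonPolygon S | u * z.1 + v * z.2 = K} := by
  obtain ⟨hexp, hnt, hne⟩ := he
  obtain ⟨z₀, hz₀⟩ := hnt.nonempty
  obtain ⟨l, hl⟩ := hexp ⟨z₀, hz₀⟩
  have hl2 : ∀ z : ℝ × ℝ, l z = l (1, 0) * z.1 + l (0, 1) * z.2 := by
    intro z
    have : z = z.1 • ((1 : ℝ), (0 : ℝ)) + z.2 • ((0 : ℝ), (1 : ℝ)) := by ext <;> simp
    conv_lhs => rw [this, map_add, map_smul, map_smul]
    simp only [smul_eq_mul]; ring
  have hz₀' := hz₀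
  rw [hl] at hz₀'
  obtain ⟨hz₀N, hmax⟩ := hz₀'
  have hu : 0 ≤ -l (1, 0) := by
    have := hmax (z₀ + (1, 0)) (add_mem_hull hz₀N zero_le_one le_rfl)
    rw [map_add] at this
    linarith
  have hv : 0 ≤ -l (0, 1) := by
    have := hmax (z₀ + (0, 1)) (add_mem_hull hz₀N le_rfl zero_le_one)
    rw [map_add] at this
    linarith
  refine ⟨-l (1, 0), -l (0, 1), -l z₀, hu, hv, ?_, ?_, ?_⟩
  · refine lt_of_le_of_ne (add_nonneg hu hv) fun h0 => hne ?_
    have e1 : l (1, 0) = 0 := by linarith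
    have e2 : l (0, 1) = 0 := by linarith
    rw [hl]
    refine Set.Subset.antisymm (fun z hz => hz.1) fun z hz => ⟨hz, fun y hy => ?_⟩
    rw [hl2 y, hl2 z, e1, e2]; simp
  · intro z hz
    have := hmax z hz
    rw [hl2 z] at this
    linarith
  · ext z
    conv_lhs => rw [hl]
    refine and_congr_right fun hz => ⟨fun h => ?_, fun h y hy => ?_⟩
    · have h1 := h z₀ hz₀N
      have h2 := hmax z hz
      rw [hl2 z] at h1 h2
      linarith
    · have h2 := hmax y hy
      rw [hl2 z]
      linarith

/-- The face of the Newton polygon with normal `(p, q)`. -/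
def face (S : ℝ × ℝ → ℝ) (p q N : ℕ) : Set (ℝ × ℝ) :=
  {z ∈ newtonPolygon S | (p : ℝ) * z.1 + q * z.2 = N}

/-- Boundedness makes both weights positive, so the edge is spanned by support points. It contains
two different ones, and their difference vector makes the normal rational. -/
theorem IsCompactEdge.exists_face {S : ℝ × ℝ → ℝ} {e : Set (ℝ × ℝ)} (he : IsCompactEdge S e) :
    ∃ p q N : ℕ, 0 < p ∧ 0 < q ∧ WeightGE (taylorCoeff S) p q N ∧ e = face S p q N := by
  obtain ⟨u, v, K, hu, hv, huv, hK, he2⟩ := he.1.exists_weight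
  have hbdd := he.2.isBounded
  obtain ⟨R, hR⟩ := hbdd.subset_closedBall 0
  obtain ⟨z₀, hz₀⟩ := he.1.2.1.nonempty
  have hz₀' := hz₀
  rw [he2] at hz₀'
  -- A nonnegative vector annihilated by the functional can be added to a point of the edge without
  -- leaving it, so its size is bounded.
  have hbig : ∀ w : ℝ × ℝ, 0 ≤ w.1 → 0 ≤ w.2 → u * w.1 + v * w.2 = 0 →
      ‖w‖ ≤ R + ‖z₀‖ := by
    intro w h1 h2 h3
    have : z₀ + w ∈ e := by
      rw [he2]
      refine ⟨add_mem_hull hz₀'.1 h1 h2, ?_⟩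
      simp only [Prod.fst_add, Prod.snd_add]
      linarith [hz₀'.2]
    have h4 := hR this
    rw [mem_closedBall_zero_iff] at h4
    calc ‖w‖ = ‖(z₀ + w) - z₀‖ := by rw [add_sub_cancel_left]
      _ ≤ ‖z₀ + w‖ + ‖z₀‖ := norm_sub_le _ _
      _ ≤ R + ‖z₀‖ := by linarith
  have hRpos : 0 ≤ R + ‖z₀‖ := by simpa using hbig 0 le_rfl le_rfl (by simp)
  have hu' : 0 < u := by
    refine lt_of_le_of_ne hu fun h0 => ?_
    have := hbig (R + ‖z₀‖ + 1, 0) (by simp only; linarith) le_rfl (by simp [← h0])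
    have h2 := (norm_fst_le ((R + ‖z₀‖ + 1, 0) : ℝ × ℝ)).trans this
    rw [Real.norm_of_nonneg (by simp only; linarith)] at h2
    simp only at h2
    linarith
  have hv' : 0 < v := by
    refine lt_of_le_of_ne hv fun h0 => ?_
    have := hbig (0, R + ‖z₀‖ + 1) le_rfl (by simp only; linarith) (by simp [← h0])
    have h2 := (norm_snd_le ((0, R + ‖z₀‖ + 1) : ℝ × ℝ)).trans this
    rw [Real.norm_of_nonneg (by simp only; linarith)] at h2
    simp only at h2
    linarith
  have hsupp : ∀ a b : ℕ, taylorCoeff S a b ≠ 0 → K ≤ u * a + v * b := fun a b hab =>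
    hK _ (mem_hull_of_ne_zero hab)
  have hsub : e ⊆ convexHull ℝ {w : ℝ × ℝ | ∃ a b : ℕ, taylorCoeff S a b ≠ 0 ∧ u * a + v * b = K ∧
      w = ((a : ℝ), (b : ℝ))} := by
    intro z hz
    rw [he2] at hz
    exact mem_convexHull_of_weight_eq hu' hv' hsupp hz.1 hz.2
  obtain ⟨a₁, b₁, a₂, b₂, h1, hw1, h2, hw2, hlt⟩ : ∃ a₁ b₁ a₂ b₂ : ℕ, taylorCoeff S a₁ b₁ ≠ 0 ∧
      u * a₁ + v * b₁ = K ∧ taylorCoeff S a₂ b₂ ≠ 0 ∧ u * a₂ + v * b₂ = K ∧ a₁ < a₂ := by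
    by_contra! hcon
    have hall : ∀ a b a' b' : ℕ, taylorCoeff S a b ≠ 0 → u * a + v * b = K →
        taylorCoeff S a' b' ≠ 0 → u * a' + v * b' = K → a = a' ∧ b = b' := by
      intro a b a' b' h1 hw1 h2 hw2
      have haa : a = a' := le_antisymm (hcon _ _ _ _ h2 hw2 h1 hw1) (hcon _ _ _ _ h1 hw1 h2 hw2)
      refine ⟨haa, ?_⟩
      rw [haa] at hw1
      have : v * ((b : ℝ) - b') = 0 := by linarith
      have := (mul_eq_zero.1 this).resolve_left hv'.ne'
      exact_mod_cast (sub_eq_zero.1 this)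
    have hne : (convexHull ℝ {w : ℝ × ℝ | ∃ a b : ℕ, taylorCoeff S a b ≠ 0 ∧ u * a + v * b = K ∧
      w = ((a : ℝ), (b : ℝ))}).Nonempty := ⟨z₀, hsub hz₀⟩
    rw [convexHull_nonempty_iff] at hne
    obtain ⟨w, a, b, hab, hw, rfl⟩ := hne
    have hss : {w : ℝ × ℝ | ∃ a b : ℕ, taylorCoeff S a b ≠ 0 ∧ u * a + v * b = K ∧
      w = ((a : ℝ), (b : ℝ))} ⊆ {((a : ℝ), (b : ℝ))} := by
      rintro _ ⟨a', b', hab', hw', rfl⟩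
      obtain ⟨rfl, rfl⟩ := hall _ _ _ _ hab' hw' hab hw
      rfl
    have := hsub.trans (convexHull_mono hss)
    rw [convexHull_singleton] at this
    exact Set.not_subsingleton_iff.2 he.1.2.1 (Set.subsingleton_singleton.anti this)
  have hlt' : (a₁ : ℝ) < a₂ := by exact_mod_cast hlt
  have hb : b₂ < b₁ := by
    have h3 : v * (b₂ : ℝ) < v * b₁ := by nlinarith
    exact_mod_cast lt_of_mul_lt_mul_left h3 hv'.le
  -- The integer normal is (p + 1, q + 1) = (b₁ - b₂, a₂ - a₁).
  obtain ⟨q, rfl⟩ := Nat.exists_eq_add_of_lt hlt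
  obtain ⟨p, rfl⟩ := Nat.exists_eq_add_of_lt hb
  have hrel : u * (q + 1 : ℕ) = v * (p + 1 : ℕ) := by
    push_cast at *
    linarith
  have hconv : ∀ x y : ℝ, u * ((p + 1 : ℕ) * x + (q + 1 : ℕ) * y)
      = (p + 1 : ℕ) * (u * x + v * y) := fun x y => by
    linear_combination y * hrel
  have hp0 : (0 : ℝ) < (p + 1 : ℕ) := by positivity
  have hNK := hconv a₁ (b₂ + p + 1 : ℕ)
  rw [hw1] at hNK
  refine ⟨p + 1, q + 1, (p + 1) * a₁ + (q + 1) * (b₂ + p + 1), by omega, by omega, ?_, ?_⟩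
  · intro a b hab
    have h3 := mul_le_mul_of_nonneg_left (hsupp a b hab) hp0.le
    rw [← hconv, ← hNK] at h3
    have := le_of_mul_le_mul_left h3 hu'
    exact_mod_cast this
  · rw [he2]
    ext z
    refine and_congr_right fun _ => ?_
    have h4 : (((p + 1) * a₁ + (q + 1) * (b₂ + p + 1) : ℕ) : ℝ)
        = (p + 1 : ℕ) * (a₁ : ℝ) + (q + 1 : ℕ) * ((b₂ + p + 1 : ℕ) : ℝ) := by push_cast; ring
    rw [h4]
    constructor
    · intro h
      refine mul_left_cancel₀ hu'.ne' ?_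
      rw [hconv, h, hNK]
    · intro h
      refine mul_left_cancel₀ hp0.ne' ?_
      rw [← hconv, h, hNK]

theorem WeightGE.cast_le {S : ℝ × ℝ → ℝ} {p q N : ℕ} (hW : WeightGE (taylorCoeff S) p q N)
    {z : ℝ × ℝ} (hz : z ∈ newtonPolygon S) : (N : ℝ) ≤ p * z.1 + q * z.2 :=
  le_of_mem_hull (Nat.cast_nonneg p) (Nat.cast_nonneg q)
    (fun a b hab => by exact_mod_cast hW a b hab) hz

theorem mem_face_iff_of_nat {S : ℝ × ℝ → ℝ} {p q N a b : ℕ} (hab : taylorCoeff S a b ≠ 0) :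
    ((a : ℝ), (b : ℝ)) ∈ face S p q N ↔ p * a + q * b = N := by
  constructor
  · intro h
    have := h.2
    simp only at this
    exact_mod_cast this
  · intro h
    refine ⟨mem_hull_of_ne_zero hab, ?_⟩
    simp only
    exact_mod_cast h

theorem isCompact_face (S : ℝ × ℝ → ℝ) {p q : ℕ} (hp : 0 < p) (hq : 0 < q) (N : ℕ) :
    IsCompact (face S p q N) := by
  have hcl : IsClosed (face S p q N) := by
    refine (isClosed_hull (taylorCoeff S)).inter (s₂ := {z : ℝ × ℝ | (p : ℝ) * z.1 + q * z.2 = N}) ?_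
    exact isClosed_eq (by fun_prop) continuous_const
  refine isCompact_Icc.of_isClosed_subset hcl (s := Set.Icc (0 : ℝ × ℝ) ((N : ℝ), (N : ℝ))) ?_
  intro z hz
  obtain ⟨h1, h2⟩ := nonneg_of_mem_hull hz.1
  have h3 := hz.2
  have hp' : (1 : ℝ) ≤ p := by exact_mod_cast hp
  have hq' : (1 : ℝ) ≤ q := by exact_mod_cast hq
  refine ⟨⟨h1, h2⟩, ?_, ?_⟩
  · simp only; nlinarith [mul_le_mul_of_nonneg_right hp' h1, mul_nonneg (Nat.cast_nonneg (α := ℝ) q) h2]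
  · simp only; nlinarith [mul_le_mul_of_nonneg_right hq' h2, mul_nonneg (Nat.cast_nonneg (α := ℝ) p) h1]

theorem isCompactEdge_face {S : ℝ × ℝ → ℝ} {p q N : ℕ} (hp : 0 < p) (hq : 0 < q)
    (hW : WeightGE (taylorCoeff S) p q N) {a b a' b' : ℕ} (h1 : taylorCoeff S a b ≠ 0)
    (hw1 : p * a + q * b = N) (h2 : taylorCoeff S a' b' ≠ 0) (hw2 : p * a' + q * b' = N)
    (hne : b ≠ b') : IsCompactEdge S (face S p q N) := by
  refine ⟨⟨fun _ => ?_, ?_, ?_⟩, isCompact_face S hp hq N⟩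
  · refine ⟨-((p : ℝ) • ContinuousLinearMap.fst ℝ ℝ ℝ + (q : ℝ) • ContinuousLinearMap.snd ℝ ℝ ℝ), ?_⟩
    have hz1 := (mem_face_iff_of_nat h1).2 hw1
    ext z
    refine and_congr_right fun hz => ⟨fun h y hy => ?_, fun h => ?_⟩
    · have := hW.cast_le hy
      simp
      linarith
    · have h3 := h _ hz1.1
      have h4 := hW.cast_le hz
      have h5 := hz1.2
      simp at h3 h5
      linarith
  · refine ⟨_, (mem_face_iff_of_nat h1).2 hw1, _, (mem_face_iff_of_nat h2).2 hw2, ?_⟩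
    intro h
    have h3 := (Prod.ext_iff.1 h).2
    simp only at h3
    exact hne (by exact_mod_cast h3)
  · intro h
    have h3 : ((a : ℝ), (b : ℝ)) + (0, 1) ∈ face S p q N := by
      rw [h]; exact add_mem_hull (mem_hull_of_ne_zero h1) le_rfl zero_le_one
    have h4 := h3.2
    have h5 := ((mem_face_iff_of_nat h1).2 hw1).2
    simp at h4 h5
    have : (q : ℝ) = 0 := by linarith
    exact hq.ne' (by exact_mod_cast this)

/-- The two index sets can differ only in lattice points with zero coefficient. -/
theorem edgePolyAt_face {S : ℝ × ℝ → ℝ} {p q N : ℕ} (hp : 0 < p) (hq : 0 < q) (ε : ℝ) :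
    edgePolyAt S (face S p q N) ε = edgePoly (taylorCoeff S) p q N ε := by
  refine finsum_mem_eq_sum_of_inter_support_eq (s := {ab : ℕ × ℕ | ((ab.1 : ℝ), (ab.2 : ℝ)) ∈
    face S p q N}) _ ?_
  ext ab
  refine and_congr_left fun hab => ?_
  have hab' : taylorCoeff S ab.1 ab.2 ≠ 0 := by
    intro h
    apply hab
    simp [h]
  rw [Finset.mem_coe, mem_lineSet hp hq]
  exact mem_face_iff_of_nat hab'

theorem mem_convexHull_of_mem_face {S : ℝ × ℝ → ℝ} {p q N : ℕ} (hp : 0 < p) (hq : 0 < q)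
    (hW : WeightGE (taylorCoeff S) p q N) {z : ℝ × ℝ} (hz : z ∈ face S p q N) :
    z ∈ convexHull ℝ {w : ℝ × ℝ | ∃ a b : ℕ, taylorCoeff S a b ≠ 0 ∧ p * a + q * b = N ∧
      w = ((a : ℝ), (b : ℝ))} := by
  have := mem_convexHull_of_weight_eq (u := p) (v := q) (K := N) (by exact_mod_cast hp)
    (by exact_mod_cast hq) (fun a b hab => by exact_mod_cast hW a b hab) hz.1 hz.2
  refine convexHull_mono ?_ this
  rintro w ⟨a, b, hab, hw, rfl⟩
  exact ⟨a, b, hab, by exact_mod_cast hw, rfl⟩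

/-- If all support points of the face lay strictly on one side of the bisectrix, so would their
hull, which contains (t, t). -/
theorem exists_le_of_mem_face {S : ℝ × ℝ → ℝ} {p q N : ℕ} (hp : 0 < p) (hq : 0 < q)
    (hW : WeightGE (taylorCoeff S) p q N) {t : ℝ} (hz : (t, t) ∈ face S p q N) :
    (∃ a b, taylorCoeff S a b ≠ 0 ∧ p * a + q * b = N ∧ a ≤ b) ∧
    (∃ a b, taylorCoeff S a b ≠ 0 ∧ p * a + q * b = N ∧ b ≤ a) := by
  have h := mem_convexHull_of_mem_face hp hq hW hz
  constructor
  · by_contra! hcon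
    have hconv : Convex ℝ {w : ℝ × ℝ | w.2 - w.1 < 0} :=
      convex_halfSpace_lt (f := fun w : ℝ × ℝ => w.2 - w.1)
        ⟨fun x y => by simp; ring, fun s x => by simp; ring⟩ 0
    have := convexHull_min (t := {w : ℝ × ℝ | w.2 - w.1 < 0}) ?_ hconv h
    · simp at this
    · rintro w ⟨a, b, hab, hw, rfl⟩
      have : (b : ℝ) < a := by exact_mod_cast hcon a b hab hw
      change (b : ℝ) - a < 0
      linarith
  · by_contra! hcon
    have hconv : Convex ℝ {w : ℝ × ℝ | w.1 - w.2 < 0} :=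
      convex_halfSpace_lt (f := fun w : ℝ × ℝ => w.1 - w.2)
        ⟨fun x y => by simp; ring, fun s x => by simp; ring⟩ 0
    have := convexHull_min (t := {w : ℝ × ℝ | w.1 - w.2 < 0}) ?_ hconv h
    · simp at this
    · rintro w ⟨a, b, hab, hw, rfl⟩
      have : (a : ℝ) < b := by exact_mod_cast hcon a b hab hw
      change (a : ℝ) - b < 0
      linarith

theorem newtonDistance_of_mem_face {S : ℝ × ℝ → ℝ} {p q N : ℕ} (hp : 0 < p)
    (hW : WeightGE (taylorCoeff S) p q N) {t : ℝ} (hz : (t, t) ∈ face S p q N) :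
    newtonDistance S = t ∧ ((p : ℝ) + q) * t = N := by
  have h2 : ((p : ℝ) + q) * t = N := by rw [add_mul]; exact hz.2
  refine ⟨newtonDistance_eq (u := p) (v := q) (by positivity) (fun z hz' => ?_) hz.1, h2⟩
  rw [h2]
  exact hW.cast_le hz'

theorem diag_mem_openSegment {p q N a b a' b' : ℕ} (hp : 0 < p)
    (hw : p * a + q * b = N) (hlt : a < b) (hw' : p * a' + q * b' = N) (hlt' : b' < a') :
    ((N : ℝ) / (p + q), (N : ℝ) / (p + q)) ∈
      openSegment ℝ ((a : ℝ), (b : ℝ)) ((a' : ℝ), (b' : ℝ)) := by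
  have h1 : (0 : ℝ) < (b : ℝ) - a := sub_pos.2 (by exact_mod_cast hlt)
  have h2 : (0 : ℝ) < (a' : ℝ) - b' := sub_pos.2 (by exact_mod_cast hlt')
  have hpq : (0 : ℝ) < (p : ℝ) + q := by positivity
  have e1 : (p : ℝ) * a + q * b = N := by exact_mod_cast hw
  have e2 : (p : ℝ) * a' + q * b' = N := by exact_mod_cast hw'
  refine ⟨(a' - b') / ((b - a) + (a' - b')), (b - a) / ((b - a) + (a' - b')), by positivity,
    by positivity, by field_simp; ring, ?_⟩
  have h3 : (b : ℝ) - a + (a' - b') ≠ 0 := by positivity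
  ext
  · simp only [Prod.smul_mk, Prod.mk_add_mk, smul_eq_mul]
    field_simp
    linear_combination (b - a : ℝ) * e2 + (a' - b' : ℝ) * e1
  · simp only [Prod.smul_mk, Prod.mk_add_mk, smul_eq_mul]
    field_simp
    linear_combination (b - a : ℝ) * e2 + (a' - b' : ℝ) * e1

theorem diag_mem_face {S : ℝ × ℝ → ℝ} {p q N a b a' b' : ℕ} (hp : 0 < p)
    (h1 : taylorCoeff S a b ≠ 0) (hw : p * a + q * b = N) (hle : a ≤ b)
    (h2 : taylorCoeff S a' b' ≠ 0) (hw' : p * a' + q * b' = N) (hle' : b' ≤ a') :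
    ((N : ℝ) / (p + q), (N : ℝ) / (p + q)) ∈ face S p q N := by
  have hpq : (0 : ℝ) < (p : ℝ) + q := by positivity
  refine ⟨?_, by simp only; field_simp⟩
  rcases hle.eq_or_lt with rfl | hlt
  · have : (N : ℝ) / (p + q) = a := by
      rw [← hw]; push_cast; field_simp
    rw [this]
    exact mem_hull_of_ne_zero h1
  rcases hle'.eq_or_lt with rfl | hlt'
  · have : (N : ℝ) / (p + q) = b' := by
      rw [← hw']; push_cast; field_simp
    rw [this]
    exact mem_hull_of_ne_zero h2
  exact (convex_convexHull ℝ _).openSegment_subset (mem_hull_of_ne_zero h1)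
    (mem_hull_of_ne_zero h2) (diag_mem_openSegment hp hw hlt hw' hlt')

/-! ### Superadaptedness and the three cases in terms of coefficients. -/

theorem superadapted_of_not_bad {S : ℝ × ℝ → ℝ}
    (h : ∀ p q, 0 < p → 0 < q → ¬ Bad (taylorCoeff S) p q) : Superadapted S := by
  intro e he hne r hr
  obtain ⟨p, q, N, hp, hq, hW, rfl⟩ := he.exists_face
  obtain ⟨⟨t, t'⟩, hz, (htt : t = t')⟩ := hne
  subst htt
  obtain ⟨hd, hN⟩ := newtonDistance_of_mem_face hp hW hz
  obtain ⟨hs1, hs2⟩ := exists_le_of_mem_face hp hq hW hz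
  have key : ∀ ε : ℝ, (ε = 1 ∨ ε = -1) →
      ((edgePolyAt S (face S p q N) ε).rootMultiplicity r : ℝ) < newtonDistance S := by
    intro ε hε
    by_contra! hle
    refine h p q hp hq ⟨N, (edgePolyAt S (face S p q N) ε).rootMultiplicity r, hW, hs1, hs2, ?_,
      r, ε, hr, hε, ?_⟩
    · have hpq : (0 : ℝ) < (p : ℝ) + q := by positivity
      have := mul_le_mul_of_nonneg_left hle hpq.le
      rw [hd, hN] at this
      exact_mod_cast this
    · rw [← edgePolyAt_face hp hq]
      exact Polynomial.pow_rootMultiplicity_dvd _ _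
  exact ⟨key 1 (Or.inl rfl), key (-1) (Or.inr rfl)⟩

/-- A bad side carries two different monomials by `Bad.exists_snd_ne`, so its supporting line cuts
out a genuine compact edge. -/
theorem Superadapted.not_bad {S : ℝ × ℝ → ℝ} (hS : Superadapted S) (h0 : S 0 = 0) {p q : ℕ}
    (hp : 0 < p) (hq : 0 < q) : ¬ Bad (taylorCoeff S) p q := by
  intro hB
  obtain ⟨N', hW', ⟨a₀, b₀, hab₀, hw₀⟩, hne⟩ :=
    hB.exists_snd_ne (by rw [taylorCoeff_zero_zero, h0]) hp hq
  obtain ⟨a₁, b₁, hab₁, hw₁, hb⟩ := hne b₀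
  obtain ⟨N, n, hW, ⟨a, b, hab, hw, hle⟩, ⟨a', b', hab', hw', hle'⟩, hN, r, ε, hr, hε, hdvd⟩ := hB
  obtain rfl : N' = N := le_antisymm (by have := hW' a b hab; omega)
    (by have := hW a₀ b₀ hab₀; omega)
  have he := isCompactEdge_face hp hq hW hab₁ hw₁ hab₀ hw₀ hb
  have hdiag := diag_mem_face hp hab hw hle hab' hw' hle'
  obtain ⟨hd, hNd⟩ := newtonDistance_of_mem_face hp hW hdiag
  have h1 := hS _ he ⟨_, hdiag, rfl⟩ r hr
  rw [edgePolyAt_face hp hq, edgePolyAt_face hp hq] at h1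
  have hlt : ((edgePoly (taylorCoeff S) p q N' ε).rootMultiplicity r : ℝ) < newtonDistance S := by
    rcases hε with rfl | rfl
    · exact h1.1
    · exact h1.2
  have hε0 : ε ≠ 0 := by rcases hε with rfl | rfl <;> norm_num
  have hmult := (Polynomial.le_rootMultiplicity_iff (edgePoly_ne_zero hp hq hε0 hab hw)).2 hdvd
  have hpq : (0 : ℝ) < (p : ℝ) + q := by positivity
  have h2 : ((p : ℝ) + q) * newtonDistance S ≤ (p + q) * n := by
    rw [hd, hNd]
    exact_mod_cast hN
  have h3 := le_of_mul_le_mul_left h2 hpq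
  have h4 : (n : ℝ) ≤ (edgePoly (taylorCoeff S) p q N' ε).rootMultiplicity r := by
    exact_mod_cast hmult
  linarith

/-- Some side of the polygon has support points strictly on either side of the bisectrix. -/
def StrictStraddle (c : ℕ → ℕ → ℝ) (p q : ℕ) : Prop :=
  ∃ N, WeightGE c p q N ∧ (∃ a b, c a b ≠ 0 ∧ p * a + q * b = N ∧ a < b) ∧
    ∃ a b, c a b ≠ 0 ∧ p * a + q * b = N ∧ b < a

/-- The function w.2 - w.1 is nonnegative at both ends and zero at an interior point, so it vanishes
at x; the weight then determines x. -/
theorem eq_of_le_of_openSegment {p q : ℝ} (hpq : 0 < p + q) {x y : ℝ × ℝ} {t N : ℝ}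
    (hx : p * x.1 + q * x.2 = N) (hN : p * t + q * t = N) (hle : x.1 ≤ x.2)
    (hle' : y.1 ≤ y.2) (ht : (t, t) ∈ openSegment ℝ x y) : x = (t, t) := by
  obtain ⟨s, s', hs, hs', -, heq⟩ := ht
  have e1 := (Prod.ext_iff.1 heq).1
  have e2 := (Prod.ext_iff.1 heq).2
  simp only [Prod.fst_add, Prod.smul_fst, Prod.snd_add, Prod.smul_snd, smul_eq_mul] at e1 e2
  have h1 := mul_nonneg hs.le (sub_nonneg.2 hle)
  have h2 := mul_nonneg hs'.le (sub_nonneg.2 hle')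
  have h3 : s * (x.2 - x.1) = 0 := by linarith
  have h4 := (mul_eq_zero.1 h3).resolve_left hs.ne'
  have h5 : (p + q) * (x.1 - t) = 0 := by linear_combination hx - hN - q * h4
  have h6 := (mul_eq_zero.1 h5).resolve_left hpq.ne'
  exact Prod.ext (by simp only; linarith) (by simp only; linarith)

/-- If a face lies weakly on one side of the bisectrix, its diagonal point is extreme. With support
points strictly on both sides, it is interior to the segment between them. -/
theorem bisectrixMeetsCompactEdge_iff {S : ℝ × ℝ → ℝ} : BisectrixMeetsCompactEdge S ↔
    ∃ p q, 0 < p ∧ 0 < q ∧ StrictStraddle (taylorCoeff S) p q := by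
  constructor
  · rintro ⟨e, he, ⟨t, t'⟩, ⟨hze, hext⟩, (htt : t = t')⟩
    subst htt
    obtain ⟨p, q, N, hp, hq, hW, rfl⟩ := he.exists_face
    have hpq : (0 : ℝ) < (p : ℝ) + q := by positivity
    refine ⟨p, q, hp, hq, N, hW, ?_, ?_⟩
    · by_contra! hcon
      apply hext
      have hsub : ∀ z ∈ face S p q N, z.2 ≤ z.1 := by
        intro z hz
        have := convexHull_min (t := {w : ℝ × ℝ | w.2 - w.1 ≤ 0}) ?_
          (convex_halfSpace_le (f := fun w : ℝ × ℝ => w.2 - w.1)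
            ⟨fun x y => by simp; ring, fun s x => by simp; ring⟩ 0)
          (mem_convexHull_of_mem_face hp hq hW hz)
        · simpa using this
        · rintro w ⟨a, b, hab, hw, rfl⟩
          have : (b : ℝ) ≤ a := by exact_mod_cast hcon a b hab hw
          change (b : ℝ) - a ≤ 0
          linarith
      refine mem_extremePoints_iff_left.2 ⟨hze, fun x hx y hy hxy => ?_⟩
      have hsw : (t, t) ∈ openSegment ℝ x.swap y.swap := by
        obtain ⟨s, s', hs, hs', hss, heq⟩ := hxy
        refine ⟨s, s', hs, hs', hss, ?_⟩
        have := congrArg Prod.swap heq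
        simpa using this
      have := eq_of_le_of_openSegment (p := q) (q := p) (N := N) (by rw [add_comm]; exact hpq)
        (by rw [add_comm]; exact hx.2) (by rw [add_comm]; exact hze.2) (hsub x hx) (hsub y hy) hsw
      rw [← Prod.swap_swap x, this]
      rfl
    · by_contra! hcon
      apply hext
      have hsub : ∀ z ∈ face S p q N, z.1 ≤ z.2 := by
        intro z hz
        have := convexHull_min (t := {w : ℝ × ℝ | w.1 - w.2 ≤ 0}) ?_
          (convex_halfSpace_le (f := fun w : ℝ × ℝ => w.1 - w.2)
            ⟨fun x y => by simp; ring, fun s x => by simp; ring⟩ 0)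
          (mem_convexHull_of_mem_face hp hq hW hz)
        · simpa using this
        · rintro w ⟨a, b, hab, hw, rfl⟩
          have : (a : ℝ) ≤ b := by exact_mod_cast hcon a b hab hw
          change (a : ℝ) - b ≤ 0
          linarith
      refine mem_extremePoints_iff_left.2 ⟨hze, fun x hx y hy hxy => ?_⟩
      exact eq_of_le_of_openSegment hpq hx.2 hze.2 (hsub x hx) (hsub y hy) hxy
  · rintro ⟨p, q, hp, hq, N, hW, ⟨a, b, hab, hw, hlt⟩, ⟨a', b', hab', hw', hlt'⟩⟩
    have hbb : b ≠ b' := by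
      rintro rfl
      have h1 : p * a < p * a' := (Nat.mul_lt_mul_left hp).2 (by omega)
      omega
    refine ⟨face S p q N, isCompactEdge_face hp hq hW hab hw hab' hw' hbb, _,
      ⟨diag_mem_face hp hab hw hlt.le hab' hw' hlt'.le, fun hext => ?_⟩, rfl⟩
    have := (mem_extremePoints_iff_left.1 hext).2 _ ((mem_face_iff_of_nat hab).2 hw) _
      ((mem_face_iff_of_nat hab').2 hw') (diag_mem_openSegment hp hw hlt hw' hlt')
    have h1 := (Prod.ext_iff.1 this).1
    have h2 := (Prod.ext_iff.1 this).2
    simp only at h1 h2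
    have : (a : ℝ) = b := by rw [h1, h2]
    exact hlt.ne (by exact_mod_cast this)

theorem DiagonalVertex.bisectrixMeetsVertex {S : ℝ × ℝ → ℝ}
    (h : DiagonalVertex (taylorCoeff S)) : BisectrixMeetsVertex S := by
  obtain ⟨p, q, n, hp, hq, hn, hmin⟩ := h
  have hW : WeightGE (taylorCoeff S) p q ((p + q) * n) := by
    intro a b hab
    by_contra! hlt
    obtain ⟨rfl, rfl⟩ := hmin a b hab hlt.le
    rw [add_mul] at hlt
    exact lt_irrefl _ hlt
  have hmem : ((n : ℝ), (n : ℝ)) ∈ face S p q ((p + q) * n) :=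
    (mem_face_iff_of_nat hn).2 (by ring)
  have hface : ∀ z ∈ face S p q ((p + q) * n), z = ((n : ℝ), (n : ℝ)) := by
    intro z hz
    have h1 := mem_convexHull_of_mem_face hp hq hW hz
    have h2 : z ∈ convexHull ℝ {((n : ℝ), (n : ℝ))} := by
      refine convexHull_mono ?_ h1
      rintro _ ⟨a, b, hab, hw, rfl⟩
      obtain ⟨rfl, rfl⟩ := hmin a b hab hw.le
      rfl
    rwa [convexHull_singleton] at h2
  obtain ⟨hd, -⟩ := newtonDistance_of_mem_face hp hW hmem
  rw [BisectrixMeetsVertex, hd]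
  refine mem_extremePoints_iff_left.2 ⟨hmem.1, fun x hx y hy hxy => hface x ⟨hx, ?_⟩⟩
  obtain ⟨s, s', hs, hs', hss, heq⟩ := hxy
  have e1 := (Prod.ext_iff.1 heq).1
  have e2 := (Prod.ext_iff.1 heq).2
  simp only [Prod.fst_add, Prod.smul_fst, Prod.snd_add, Prod.smul_snd, smul_eq_mul] at e1 e2
  have h1 := hW.cast_le hx
  have h2 := hW.cast_le hy
  have h3 := hmem.2
  simp only at h3
  have h4 := mul_nonneg hs.le (sub_nonneg.2 h1)
  have h5 := mul_nonneg hs'.le (sub_nonneg.2 h2)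
  have h6 : s * ((p : ℝ) * x.1 + q * x.2 - ((p + q) * n : ℕ)) = 0 := by
    have : s * ((p : ℝ) * x.1 + q * x.2 - ((p + q) * n : ℕ))
        + s' * ((p : ℝ) * y.1 + q * y.2 - ((p + q) * n : ℕ)) = 0 := by
      linear_combination p * e1 + q * e2 + h3 - (((p + q) * n : ℕ) : ℝ) * hss
    linarith
  linarith [(mul_eq_zero.1 h6).resolve_left hs.ne']

/-- The real normal is multiplied by a large M and rounded up. Rounding adds at most 2 n at (n, n),
less than the margin M (U - (u + v) n); adding 1 to the floors also makes the weights positive. -/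
theorem exists_nat_weights {u v U : ℝ} (hu : 0 ≤ u) (hv : 0 ≤ v) {n : ℕ}
    (hU : u * n + v * n < U) {c : ℕ → ℕ → ℝ}
    (h : ∀ a b : ℕ, c a b ≠ 0 → (a, b) ≠ (n, n) → U < u * a + v * b) :
    ∃ p q : ℕ, 0 < p ∧ 0 < q ∧
      ∀ a b, c a b ≠ 0 → p * a + q * b ≤ (p + q) * n → a = n ∧ b = n := by
  obtain ⟨M, hM⟩ := exists_nat_gt (2 * n / (U - (u * n + v * n)))
  have hpos : 0 < U - (u * n + v * n) := sub_pos.2 hU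
  rw [div_lt_iff₀ hpos] at hM
  have hMu : 0 ≤ (M : ℝ) * u := by positivity
  have hMv : 0 ≤ (M : ℝ) * v := by positivity
  refine ⟨⌊(M : ℝ) * u⌋₊ + 1, ⌊(M : ℝ) * v⌋₊ + 1, Nat.succ_pos _, Nat.succ_pos _, ?_⟩
  intro a b hab hle
  by_contra hne
  have h1 := h a b hab (fun h => hne (Prod.ext_iff.1 h))
  have hp1 := Nat.floor_le hMu
  have hq1 := Nat.floor_le hMv
  have hp2 := Nat.lt_floor_add_one ((M : ℝ) * u)
  have hq2 := Nat.lt_floor_add_one ((M : ℝ) * v)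
  have hle' : ((⌊(M : ℝ) * u⌋₊ + 1 : ℝ)) * a + (⌊(M : ℝ) * v⌋₊ + 1) * b
      ≤ ((⌊(M : ℝ) * u⌋₊ + 1) + (⌊(M : ℝ) * v⌋₊ + 1)) * n := by exact_mod_cast hle
  have ha : (0 : ℝ) ≤ a := Nat.cast_nonneg a
  have hb : (0 : ℝ) ≤ b := Nat.cast_nonneg b
  have hn : (0 : ℝ) ≤ n := Nat.cast_nonneg n
  have e1 := mul_le_mul_of_nonneg_right hp2.le ha
  have e2 := mul_le_mul_of_nonneg_right hq2.le hb
  have e3 := mul_le_mul_of_nonneg_right hp1 hn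
  have e4 := mul_le_mul_of_nonneg_right hq1 hn
  have e5 := mul_le_mul_of_nonneg_left h1.le (Nat.cast_nonneg (α := ℝ) M)
  nlinarith

/-- An extreme point of the polygon is itself a support point (n, n). It does not lie in the closed
hull of the remaining quadrants, so Hahn–Banach separates it, and the normal can be made integral.
-/
theorem BisectrixMeetsVertex.diagonalVertex {S : ℝ × ℝ → ℝ} (h : BisectrixMeetsVertex S) :
    DiagonalVertex (taylorCoeff S) := by
  set c := taylorCoeff S with hc
  obtain ⟨n, m, hnm, h1, h2⟩ := extremePoints_convexHull_subset h
  have hext := mem_extremePoints.1 h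
  rw [newtonPolygon_eq, ← hc] at hext
  set d := newtonDistance S
  have hnmd : ((n : ℝ), (m : ℝ)) = (d, d) := by
    have hx : (((n : ℝ), (m : ℝ)) : ℝ × ℝ) ∈ convexHull ℝ (quadrants c) := mem_hull_of_ne_zero hnm
    have hy : (d, d) + ((d, d) - ((n : ℝ), (m : ℝ))) ∈ convexHull ℝ (quadrants c) :=
      add_mem_hull hext.1 (sub_nonneg.2 h1) (sub_nonneg.2 h2)
    -- The extreme point is the midpoint of the quadrant's corner and the reflection of that corner,
    -- so it equals the corner.
    refine (hext.2 _ hx _ hy ⟨1 / 2, 1 / 2, by norm_num, by norm_num, by norm_num, ?_⟩).1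
    ext <;> simp <;> ring
  have hn : (n : ℝ) = d := (Prod.ext_iff.1 hnmd).1
  have hm : (m : ℝ) = d := (Prod.ext_iff.1 hnmd).2
  obtain rfl : n = m := by exact_mod_cast hn.trans hm.symm
  rw [← hn] at hext
  set c' : ℕ → ℕ → ℝ := fun a b => if (a, b) = (n, n) then 0 else c a b with hc'
  have hc'ne : ∀ a b, c' a b ≠ 0 ↔ c a b ≠ 0 ∧ (a, b) ≠ (n, n) := by
    intro a b
    simp only [hc']
    split_ifs with hif
    · simp [hif]
    · simp [hif]
  have hsub : convexHull ℝ (quadrants c') ⊆ convexHull ℝ (quadrants c) := by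
    refine convexHull_mono ?_
    rintro z ⟨a, b, hab, h⟩
    exact ⟨a, b, ((hc'ne a b).1 hab).1, h⟩
  have hnot : ((n : ℝ), (n : ℝ)) ∉ convexHull ℝ (quadrants c') := by
    intro hin
    have hext' : ((n : ℝ), (n : ℝ)) ∈ Set.extremePoints ℝ (convexHull ℝ (quadrants c')) :=
      mem_extremePoints.2 ⟨hin, fun x hx y hy => hext.2 x (hsub hx) y (hsub hy)⟩
    obtain ⟨a, b, hab, h3, h4⟩ := extremePoints_convexHull_subset hext'
    rw [hc'ne] at hab
    simp only at h3 h4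
    have hx : (((a : ℝ), (b : ℝ)) : ℝ × ℝ) ∈ convexHull ℝ (quadrants c) :=
      mem_hull_of_ne_zero hab.1
    have hy : ((n : ℝ), (n : ℝ)) + (((n : ℝ), (n : ℝ)) - ((a : ℝ), (b : ℝ)))
        ∈ convexHull ℝ (quadrants c) :=
      add_mem_hull hext.1 (sub_nonneg.2 h3) (sub_nonneg.2 h4)
    have := (hext.2 _ hx _ hy ⟨1 / 2, 1 / 2, by norm_num, by norm_num, by norm_num, by
      ext <;> simp <;> ring⟩).1
    apply hab.2
    have e1 := (Prod.ext_iff.1 this).1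
    have e2 := (Prod.ext_iff.1 this).2
    simp only at e1 e2
    exact Prod.ext (by exact_mod_cast e1) (by exact_mod_cast e2)
  obtain ⟨f, U, hfU, hUf⟩ := geometric_hahn_banach_point_closed (convex_convexHull ℝ _)
    (isClosed_hull c') hnot
  have hf : ∀ z : ℝ × ℝ, f z = f (1, 0) * z.1 + f (0, 1) * z.2 := by
    intro z
    have : z = z.1 • ((1 : ℝ), (0 : ℝ)) + z.2 • ((0 : ℝ), (1 : ℝ)) := by ext <;> simp
    conv_lhs => rw [this, map_add, map_smul, map_smul]
    simp only [smul_eq_mul]; ring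
  by_cases hemp : ∃ a b, c' a b ≠ 0
  · obtain ⟨a, b, hab⟩ := hemp
    have hmem : (((a : ℝ), (b : ℝ)) : ℝ × ℝ) ∈ convexHull ℝ (quadrants c') := mem_hull_of_ne_zero hab
    -- A functional bounded below on a set stable under adding w cannot be negative on w.
    have hpos : ∀ w : ℝ × ℝ, 0 ≤ w.1 → 0 ≤ w.2 → 0 ≤ f w := by
      intro w hw1 hw2
      by_contra! hneg
      obtain ⟨k, hk⟩ := exists_nat_gt ((f ((a : ℝ), (b : ℝ)) - U) / (-f w))
      rw [div_lt_iff₀ (by linarith)] at hk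
      have := hUf _ (add_mem_hull hmem (w := (k : ℝ) • w)
        (mul_nonneg (Nat.cast_nonneg k) hw1) (mul_nonneg (Nat.cast_nonneg k) hw2))
      rw [map_add, map_smul, smul_eq_mul] at this
      linarith
    have hu := hpos (1, 0) zero_le_one le_rfl
    have hv := hpos (0, 1) le_rfl zero_le_one
    rw [hf] at hfU
    obtain ⟨p, q, hp, hq, hpq⟩ := exists_nat_weights hu hv hfU (c := c) fun a b hab hne => by
      have := hUf _ (mem_hull_of_ne_zero ((hc'ne a b).2 ⟨hab, hne⟩))
      rwa [hf] at this
    exact ⟨p, q, n, hp, hq, hnm, hpq⟩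
  · push Not at hemp
    refine ⟨1, 1, n, one_pos, one_pos, hnm, fun a b hab _ => ?_⟩
    by_contra hne
    exact (hc'ne a b).2 ⟨hab, fun h => hne (Prod.ext_iff.1 h)⟩ (hemp a b)

/-- The point (d, d) lies on the boundary, and a supporting line there cuts out a face. If (d, d) is
not a vertex, that face is an edge with (d, d) in its interior, bounded or not. -/
theorem exists_inCase {S : ℝ × ℝ → ℝ} (hne : ∃ a b, taylorCoeff S a b ≠ 0)
    (hS : Superadapted S) : ∃ i, InCase S i := by
  obtain ⟨a, b, hab⟩ := hne
  set N := newtonPolygon S with hN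
  set d := newtonDistance S with hd
  have hclosed : IsClosed N := isClosed_hull _
  have hconv : Convex ℝ N := convex_convexHull ℝ _
  have hab' : (((a : ℝ), (b : ℝ)) : ℝ × ℝ) ∈ N := mem_hull_of_ne_zero hab
  have hbdd : BddBelow {t : ℝ | (t, t) ∈ N} := ⟨0, fun t ht => (nonneg_of_mem_hull ht).1⟩
  have hdN : (d, d) ∈ N := by
    have hcl : IsClosed {t : ℝ | (t, t) ∈ N} := hclosed.preimage (by fun_prop : Continuous fun t : ℝ => (t, t))
    refine hcl.csInf_mem ⟨a + b, ?_⟩ hbdd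
    have := add_mem_hull hab' (w := ((b : ℝ), (a : ℝ))) (Nat.cast_nonneg b) (Nat.cast_nonneg a)
    rw [Prod.mk_add_mk, add_comm (b : ℝ) a] at this
    exact this
  have hint : (d, d) ∉ interior N := by
    intro hin
    have hcont : Continuous fun t : ℝ => (t, t) := by fun_prop
    have h1 : ∀ᶠ t in 𝓝 d, (t, t) ∈ N :=
      hcont.continuousAt.eventually (mem_interior_iff_mem_nhds.1 hin)
    obtain ⟨t, htN, ht⟩ := ((h1.filter_mono (nhdsWithin_le_nhds (s := Set.Iio d))).and
      self_mem_nhdsWithin).exists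
    exact absurd (csInf_le hbdd htN) (not_le.2 ht)
  have hintne : (interior N).Nonempty := by
    refine ⟨((a : ℝ) + 1, (b : ℝ) + 1), mem_interior.2 ⟨Set.Ioi (a : ℝ) ×ˢ Set.Ioi (b : ℝ), ?_,
      isOpen_Ioi.prod isOpen_Ioi, ?_⟩⟩
    · intro z hz
      exact subset_convexHull ℝ _ ⟨a, b, hab, (Set.mem_Ioi.1 hz.1).le, (Set.mem_Ioi.1 hz.2).le⟩
    · exact ⟨by simp, by simp⟩
  obtain ⟨f, hf⟩ := geometric_hahn_banach_open_point hconv.interior isOpen_interior hint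
  have hfN : ∀ z ∈ N, f z ≤ f (d, d) := by
    intro z hz
    have hz' : z ∈ closure (interior N) := by
      rw [hconv.closure_interior_eq_closure_of_nonempty_interior hintne]
      exact subset_closure hz
    have hcl : IsClosed {z | f z ≤ f (d, d)} := isClosed_le f.continuous continuous_const
    exact closure_minimal (fun w hw => (hf w hw).le) hcl hz'
  by_cases hvert : BisectrixMeetsVertex S
  · exact ⟨.case2, hS, hvert⟩
  set e := f.toExposed N with he
  have hexp : IsExposed ℝ N e := ContinuousLinearMap.toExposed.isExposed
  have hde : (d, d) ∈ e := ⟨hdN, hfN⟩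
  have hnot : (d, d) ∉ Set.extremePoints ℝ e := fun h =>
    hvert (hexp.isExtreme.extremePoints_subset_extremePoints h)
  have hedge : IsEdge S e := by
    refine ⟨hexp, ?_, fun h => ?_⟩
    · by_contra hsub
      rw [Set.not_nontrivial_iff] at hsub
      apply hnot
      rw [hsub.eq_singleton_of_mem hde, extremePoints_singleton]
      rfl
    · obtain ⟨z, hz⟩ := hintne
      have h1 : z ∈ e := by rw [h]; exact interior_subset hz
      exact absurd (h1.2 _ hdN) (not_le.2 (hf z hz))
  by_cases hb : Bornology.IsBounded e
  · exact ⟨.case1, hS, e, ⟨hedge, Metric.isCompact_of_isClosed_isBounded (hexp.isClosed hclosed) hb⟩,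
      _, ⟨hde, hnot⟩, rfl⟩
  · exact ⟨.case3, hS, e, ⟨hedge, hb⟩, _, ⟨hde, hnot⟩, rfl⟩

theorem IsEdge.eq_newtonDistance {S : ℝ × ℝ → ℝ} {e : Set (ℝ × ℝ)} (he : IsEdge S e) {t : ℝ}
    (ht : (t, t) ∈ e) : newtonDistance S = t := by
  obtain ⟨u, v, K, hu, hv, huv, hK, rfl⟩ := he.exists_weight
  refine newtonDistance_eq huv (fun z hz => ?_) ht.1
  have h1 := ht.2
  have h2 := hK z hz
  simp only at h1
  rw [add_mul]
  linarith

theorem IsEdge.not_bisectrixMeetsVertex {S : ℝ × ℝ → ℝ} {e : Set (ℝ × ℝ)} (he : IsEdge S e)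
    (h : (edgeInterior e ∩ bisectrix).Nonempty) : ¬ BisectrixMeetsVertex S := by
  intro hv
  obtain ⟨⟨t, t'⟩, ⟨hte, hext⟩, (htt : t = t')⟩ := h
  subst htt
  rw [BisectrixMeetsVertex, he.eq_newtonDistance hte] at hv
  exact hext (inter_extremePoints_subset_extremePoints_of_subset he.1.subset ⟨hte, hv⟩)

/-- The straddling support points have a diagonal point between them, so extremality puts both in
the unbounded edge. The normals are then proportional, and the unbounded edge lies in a compact
face. -/
theorem not_compact_and_unbounded {S : ℝ × ℝ → ℝ} (h1 : BisectrixMeetsCompactEdge S) :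
    ¬ BisectrixMeetsUnboundedEdge S := by
  rintro ⟨e, ⟨he, hunb⟩, ⟨t, t'⟩, ⟨hte, -⟩, (htt : t = t')⟩
  subst htt
  obtain ⟨p, q, hp, hq, N, hW, ⟨a, b, hab, hw, hlt⟩, ⟨a', b', hab', hw', hlt'⟩⟩ :=
    bisectrixMeetsCompactEdge_iff.1 h1
  have hface := diag_mem_face hp hab hw hlt.le hab' hw' hlt'.le
  have htd : (N : ℝ) / (p + q) = t :=
    (newtonDistance_of_mem_face hp hW hface).1.symm.trans (he.eq_newtonDistance hte)
  have hseg := diag_mem_openSegment hp hw hlt hw' hlt'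
  rw [htd] at hseg
  have hA := he.1.isExtreme.left_mem_of_mem_openSegment (mem_hull_of_ne_zero hab)
    (mem_hull_of_ne_zero hab') hte hseg
  have hB := he.1.isExtreme.right_mem_of_mem_openSegment (mem_hull_of_ne_zero hab)
    (mem_hull_of_ne_zero hab') hte hseg
  obtain ⟨u, v, K, hu, hv, huv, hK, heq⟩ := he.exists_weight
  rw [heq] at hA hB
  have e1 := hA.2
  have e2 := hB.2
  simp only at e1 e2
  have hp' : (0 : ℝ) < p := by exact_mod_cast hp
  have hq' : (0 : ℝ) < q := by exact_mod_cast hq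
  have e3 : (p : ℝ) * a + q * b = p * a' + q * b' := by exact_mod_cast hw.trans hw'.symm
  have hbb : b' < b := by
    by_contra! hle
    have h2 : q * b ≤ q * b' := Nat.mul_le_mul_left q hle
    have h3 : p * a' ≤ p * a := by omega
    have := Nat.le_of_mul_le_mul_left h3 hp
    omega
  have hbb' : (0 : ℝ) < (b : ℝ) - b' := sub_pos.2 (by exact_mod_cast hbb)
  have hprop : u * q = v * p := by
    have : ((b : ℝ) - b') * (u * q - v * p) = 0 := by linear_combination u * e3 - p * e1 + p * e2
    linarith [(mul_eq_zero.1 this).resolve_left hbb'.ne']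
  have hu' : 0 < u := by
    refine lt_of_le_of_ne hu fun h0 => ?_
    rw [← h0, zero_mul] at hprop
    have : v = 0 := (mul_eq_zero.1 hprop.symm).resolve_right hp'.ne'
    rw [← h0, this] at huv
    simp at huv
  apply hunb
  refine (isCompact_face S hp hq N).isBounded.subset ?_
  intro z hz
  rw [heq] at hz
  refine ⟨hz.1, ?_⟩
  have e4 : (p : ℝ) * a + q * b = N := by exact_mod_cast hw
  have : u * ((p : ℝ) * z.1 + q * z.2 - N) = 0 := by
    linear_combination (p : ℝ) * hz.2 - p * e1 + (z.2 - b) * hprop + u * e4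
  linarith [(mul_eq_zero.1 this).resolve_left hu'.ne']

/-! ### Nontrivial quasi-homogeneous substitutions. -/

/-- The leading parts of weight `N` for the weights `(1, l)` of two series are related by the
substitution `(x, y) ↦ (α x + β y, γ xˡ + δ y)`. -/
structure FormRel (c e : ℕ → ℕ → ℝ) (l N : ℕ) (α β γ δ : ℝ) : Prop where
  weight_left : WeightGE c 1 l N
  weight_right : WeightGE e 1 l N
  form_eq : ∀ x y, form e 1 l N (x, y) = form c 1 l N (α * x + β * y, γ * x ^ l + δ * y)
  shape : β = 0 ∨ l = 1
  fst_ne : α ≠ 0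
  low_ne : γ ≠ 0
  snd_ne : δ ≠ 0
  det_ne : α * δ - β * γ ≠ 0

theorem FormRel.inv {c e : ℕ → ℕ → ℝ} {l N : ℕ} {α β γ δ : ℝ} (h : FormRel c e l N α β γ δ) :
    ∃ α' β' γ' δ', FormRel e c l N α' β' γ' δ' ∧ (β = 0 → β' = 0) ∧ (β ≠ 0 → β' ≠ 0) := by
  obtain ⟨hc, he, hf, hs, hα, hγ, hδ, hD⟩ := h
  by_cases hβ : β = 0
  · subst hβ
    refine ⟨α⁻¹, 0, -γ / (δ * α ^ l), δ⁻¹, ⟨he, hc, fun x y => ?_, Or.inl rfl, inv_ne_zero hα,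
      div_ne_zero (neg_ne_zero.2 hγ) (mul_ne_zero hδ (pow_ne_zero l hα)), inv_ne_zero hδ, ?_⟩,
      fun _ => rfl, fun h => absurd rfl h⟩
    · rw [hf]
      congr 2
      · field_simp; ring
      · rw [zero_mul, add_zero, mul_pow, inv_pow]
        field_simp; ring
    · rw [zero_mul, sub_zero]
      exact mul_ne_zero (inv_ne_zero hα) (inv_ne_zero hδ)
  · obtain rfl := hs.resolve_left hβ
    set D := α * δ - β * γ with hDdef
    refine ⟨δ / D, -β / D, -γ / D, α / D, ⟨he, hc, fun x y => ?_, Or.inr rfl, div_ne_zero hδ hD,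
      div_ne_zero (neg_ne_zero.2 hγ) hD, div_ne_zero hα hD, ?_⟩, fun h => absurd h hβ,
      fun _ => div_ne_zero (neg_ne_zero.2 hβ) hD⟩
    · rw [hf]
      congr 2
      · field_simp; rw [hDdef]; ring
      · rw [pow_one, pow_one]; field_simp; rw [hDdef]; ring
    · have : δ / D * (α / D) - -β / D * (-γ / D) = D⁻¹ := by
        field_simp; rw [hDdef]; ring
      rw [this]
      exact inv_ne_zero hD

theorem FormRel.swap {c e : ℕ → ℕ → ℝ} {N : ℕ} {α β γ δ : ℝ} (h : FormRel c e 1 N α β γ δ)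
    (hβ : β ≠ 0) : FormRel (fun a b => c b a) (fun a b => e b a) 1 N δ γ β α := by
  obtain ⟨hc, he, hf, hs, hα, hγ, hδ, hD⟩ := h
  refine ⟨hc.swap, he.swap, fun x y => ?_, Or.inr rfl, hδ, hβ, hα, ?_⟩
  · rw [form_swap (c := c), form_swap (c := e)]
    refine (hf y x).trans ?_
    congr 1
    refine Prod.ext ?_ ?_ <;> simp only [Prod.fst_swap, Prod.snd_swap] <;> ring
  · rwa [mul_comm δ, mul_comm γ]

theorem FormRel.edgePoly_eq {c e : ℕ → ℕ → ℝ} {l N : ℕ} {α β γ δ : ℝ}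
    (h : FormRel c e l N α β γ δ) : edgePoly e 1 l N 1 = ∑ ab ∈ lineSet 1 l N,
      Polynomial.C (c ab.1 ab.2) * (Polynomial.C α + Polynomial.C β * Polynomial.X) ^ ab.1 *
        (Polynomial.C γ + Polynomial.C δ * Polynomial.X) ^ ab.2 := by
  refine Polynomial.funext fun y => ?_
  rw [eval_edgePoly, h.form_eq, form]
  simp [Polynomial.eval_finsetSum]

theorem FormRel.exists_right {c e : ℕ → ℕ → ℝ} {l N : ℕ} {α β γ δ : ℝ} (hl : 0 < l)
    (h : FormRel c e l N α β γ δ) (hne : ∃ a b, c a b ≠ 0 ∧ 1 * a + l * b = N) :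
    ∃ a b, e a b ≠ 0 ∧ 1 * a + l * b = N := by
  by_contra! hcon
  obtain ⟨α', β', γ', δ', h', -⟩ := h.inv
  obtain ⟨a, b, hab, hw⟩ := hne
  refine hab ((form_eq_zero_iff one_pos hl).1 (fun y => ?_) a b hw)
  rw [h'.form_eq, form]
  refine Finset.sum_eq_zero fun ab hab => ?_
  have : e ab.1 ab.2 = 0 := by
    by_contra hne
    exact hcon _ _ hne ((mem_lineSet one_pos hl).1 hab)
  simp [this]

/-- Each monomial contributes a factor (γ + δ y)^B, so -γ / δ is a nonzero root of order at least B
≥ N / (1 + l). The rest checks that the new side reaches the bisectrix. -/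
theorem FormRel.bad {c e : ℕ → ℕ → ℝ} {l N : ℕ} {α β γ δ : ℝ} (hl : 0 < l)
    (h : FormRel c e l N α β γ δ) (hne : ∃ a b, c a b ≠ 0 ∧ 1 * a + l * b = N) {B : ℕ}
    (hB : ∀ a b, c a b ≠ 0 → 1 * a + l * b = N → B ≤ b) (hNB : N ≤ (1 + l) * B) : Bad e 1 l := by
  set y₀ := -γ / δ with hy₀
  have hy0 : y₀ ≠ 0 := div_ne_zero (neg_ne_zero.2 h.low_ne) h.snd_ne
  have hdvd : (Polynomial.X - Polynomial.C y₀) ^ B ∣ edgePoly e 1 l N 1 := by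
    rw [h.edgePoly_eq]
    refine Finset.dvd_sum fun ab hab => ?_
    by_cases hc : c ab.1 ab.2 = 0
    · simp [hc]
    have hle := hB _ _ hc ((mem_lineSet one_pos hl).1 hab)
    have hfac : Polynomial.C γ + Polynomial.C δ * Polynomial.X =
        Polynomial.C δ * (Polynomial.X - Polynomial.C y₀) := by
      rw [mul_sub, ← Polynomial.C_mul, hy₀, mul_div_cancel₀ _ h.snd_ne, Polynomial.C_neg]
      ring
    rw [hfac, mul_pow]
    exact Dvd.dvd.mul_left (Dvd.dvd.mul_left (pow_dvd_pow _ hle) _) _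
  obtain ⟨a₀, b₀, hab₀, hw₀⟩ := h.exists_right hl hne
  have hE : edgePoly e 1 l N 1 ≠ 0 := edgePoly_ne_zero one_pos hl one_ne_zero hab₀ hw₀
  obtain ⟨a₁, hw₁, hab₁⟩ := exists_of_coeff_edgePoly_ne_zero (c := e) (N := N) (ε := 1) one_pos hl
    (b := (edgePoly e 1 l N 1).natDegree)
    (by rw [Polynomial.coeff_natDegree]; exact Polynomial.leadingCoeff_ne_zero.2 hE)
  have hdeg : B ≤ (edgePoly e 1 l N 1).natDegree := by
    have := Polynomial.natDegree_le_of_dvd hdvd hE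
    rwa [Polynomial.natDegree_pow, Polynomial.natDegree_X_sub_C, mul_one] at this
  refine ⟨N, B, h.weight_right, ?_, ?_, hNB, y₀, 1, hy0, Or.inl rfl, hdvd⟩
  · by_contra! hcon
    have h1 := hcon _ _ hab₁ hw₁
    nlinarith
  · by_contra! hcon
    -- If all monomials were strictly above the bisectrix, X^K would divide too. Then the degree n
    -- is at least K + B, so (1 + l) n > 2 N, while l n ≤ N gives (1 + l) n ≤ 2 N.
    set K := N / (1 + l) + 1 with hK
    have hKN : N < (1 + l) * K := by
      rw [hK]
      exact Nat.lt_mul_div_succ N (by omega)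
    have hXK : Polynomial.X ^ K ∣ edgePoly e 1 l N 1 := by
      rw [Polynomial.X_pow_dvd_iff]
      intro b hb
      by_contra hbne
      obtain ⟨a, hw, hab⟩ := exists_of_coeff_edgePoly_ne_zero one_pos hl hbne
      have h1 := hcon a b hab hw
      have h2 : b ≤ N / (1 + l) := by omega
      have h3 : (1 + l) * (N / (1 + l)) ≤ N := Nat.mul_div_le N (1 + l)
      nlinarith
    have hcop : IsCoprime (Polynomial.X ^ K) ((Polynomial.X - Polynomial.C y₀) ^ B : ℝ[X]) := by
      refine IsCoprime.pow ?_
      have := Polynomial.isCoprime_X_sub_C_of_isUnit_sub (R := ℝ) (a := 0) (b := y₀)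
        (by rw [zero_sub]; exact (isUnit_iff_ne_zero.2 hy0).neg)
      simpa using this
    have h4 := Polynomial.natDegree_le_of_dvd (hcop.mul_dvd hXK hdvd) hE
    rw [Polynomial.natDegree_mul (pow_ne_zero _ Polynomial.X_ne_zero)
      (pow_ne_zero _ (Polynomial.X_sub_C_ne_zero _)), Polynomial.natDegree_pow,
      Polynomial.natDegree_pow, Polynomial.natDegree_X_sub_C, Polynomial.natDegree_X] at h4
    generalize (edgePoly e 1 l N 1).natDegree = n at *
    have h5 : (1 + l) * (K * 1 + B * 1) ≤ (1 + l) * n := Nat.mul_le_mul_left _ h4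
    have h6 : (1 + l) * K + (1 + l) * B ≤ (1 + l) * n := by nlinarith
    have h7 : n ≤ l * n := Nat.le_mul_of_pos_left n hl
    nlinarith

/-- If the new form stayed weakly on one side of the bisectrix, the inverse substitution would
either make c bad or, when β = 0, be unable to raise the y-degree up to b₁. -/
theorem FormRel.strict {c e : ℕ → ℕ → ℝ} {l N : ℕ} {α β γ δ : ℝ} (hl : 0 < l)
    (h : FormRel c e l N α β γ δ) (hc : ∀ p q, 0 < p → 0 < q → ¬ Bad c p q)
    (hup : ∃ a b, c a b ≠ 0 ∧ 1 * a + l * b = N ∧ a < b) : StrictStraddle e 1 l := by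
  obtain ⟨a₁, b₁, hab₁, hw₁, hlt⟩ := hup
  have hne := h.exists_right hl ⟨a₁, b₁, hab₁, hw₁⟩
  obtain ⟨α', β', γ', δ', h', hβ0, hβ1⟩ := h.inv
  refine ⟨N, h.weight_right, ?_, ?_⟩
  · by_contra! hcon
    by_cases hβ : β = 0
    · have hE := h'.edgePoly_eq
      have hcoeff := coeff_edgePoly c one_pos hl 1 hw₁
      have hdeg : (edgePoly c 1 l N 1).natDegree < b₁ := by
        rw [hE]
        refine lt_of_le_of_lt (Polynomial.natDegree_sum_le_of_forall_le (n := b₁ - 1) _ _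
          fun ab hab => ?_) (by omega)
        by_cases h0 : e ab.1 ab.2 = 0
        · simp [h0]
        have hw := (mem_lineSet one_pos hl).1 hab
        have h1 := hcon _ _ h0 hw
        have h2 : ab.2 ≤ b₁ - 1 := by
          have : ab.2 < b₁ := by
            by_contra! h3
            nlinarith
          omega
        rw [hβ0 hβ, Polynomial.C_0, zero_mul, add_zero]
        refine le_trans ?_ h2
        compute_degree
      rw [Polynomial.coeff_eq_zero_of_natDegree_lt hdeg] at hcoeff
      simp at hcoeff
      exact hab₁ hcoeff.symm
    -- Here l = 1. No monomial lies above the bisectrix, so every x-exponent is at least (N + 1) /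
    -- 2, the ceiling of N / 2, and the swapped relation makes c bad.
    · obtain rfl := h.shape.resolve_left hβ
      refine hc 1 1 one_pos one_pos (Bad.swap (c := fun a b => c b a) one_pos one_pos
        ((h'.swap (hβ1 hβ)).bad one_pos ?_ (B := (N + 1) / 2) ?_ ?_))
      · obtain ⟨a, b, hab, hw⟩ := hne
        exact ⟨b, a, hab, by omega⟩
      · intro a b hab hw
        have := hcon b a hab (by omega)
        omega
      · omega
  · by_contra! hcon
    -- The bound B is the ceiling of N / (1 + l), below which no y-exponent occurs.
    refine hc 1 l one_pos hl (h'.bad hl hne (B := (N + l) / (1 + l)) ?_ ?_)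
    · intro a b hab hw
      have := hcon a b hab hw
      refine Nat.le_of_lt_succ ((Nat.div_lt_iff_lt_mul (by omega)).2 ?_)
      nlinarith
    · have := Nat.lt_mul_div_succ (N + l) (show 0 < 1 + l by omega)
      nlinarith

/-! ### Action of a coordinate change on a side of the polygon. -/

/-- A germ of a smooth coordinate change fixing the origin, with Jacobian matrix
`((α, β), (γ, δ))`. -/
structure Change (Φ : ℝ × ℝ → ℝ × ℝ) (α β γ δ : ℝ) : Prop where
  smooth : SmoothNear Φ 0
  map_zero : Φ 0 = 0
  det_ne : α * δ - β * γ ≠ 0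
  deriv : ∃ L : ℝ × ℝ →L[ℝ] ℝ × ℝ, HasStrictFDerivAt Φ L 0 ∧
    ∀ z, L z = (α * z.1 + β * z.2, γ * z.1 + δ * z.2)

theorem SmoothNear.contDiff_comp {E F G : Type*} [NormedAddCommGroup E] [NormedSpace ℝ E]
    [NormedAddCommGroup F] [NormedSpace ℝ F] [NormedAddCommGroup G] [NormedSpace ℝ G]
    {f : E → F} {p : E} (hf : SmoothNear f p) {g : F → G} (hg : ContDiff ℝ ∞ g) :
    SmoothNear (g ∘ f) p := by
  obtain ⟨U, hU, hpU, hfU⟩ := hf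
  exact ⟨U, hU, hpU, hg.comp_contDiffOn hfU⟩

theorem SmoothNear.comp {E F G : Type*} [NormedAddCommGroup E] [NormedSpace ℝ E]
    [NormedAddCommGroup F] [NormedSpace ℝ F] [NormedAddCommGroup G] [NormedSpace ℝ G]
    {f : E → F} {p : E} {g : F → G} (hg : SmoothNear g (f p)) (hf : SmoothNear f p) :
    SmoothNear (g ∘ f) p := by
  obtain ⟨U, hU, hpU, hfU⟩ := hf
  obtain ⟨V, hV, hpV, hgV⟩ := hg
  exact ⟨U ∩ f ⁻¹' V, hfU.continuousOn.isOpen_inter_preimage hU hV, ⟨hpU, hpV⟩,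
    hgV.comp (hfU.mono Set.inter_subset_left) fun x hx => hx.2⟩

theorem contDiff_swap : ContDiff ℝ ∞ (Prod.swap : ℝ × ℝ → ℝ × ℝ) := contDiff_snd.prodMk contDiff_fst

theorem hasStrictFDerivAt_swap (z : ℝ × ℝ) : HasStrictFDerivAt (Prod.swap : ℝ × ℝ → ℝ × ℝ)
    ((ContinuousLinearMap.snd ℝ ℝ ℝ).prod (ContinuousLinearMap.fst ℝ ℝ ℝ)) z :=
  ((ContinuousLinearMap.snd ℝ ℝ ℝ).prod (ContinuousLinearMap.fst ℝ ℝ ℝ)).hasStrictFDerivAt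

theorem Change.swap_left {Φ : ℝ × ℝ → ℝ × ℝ} {α β γ δ : ℝ} (h : Change Φ α β γ δ) :
    Change (Prod.swap ∘ Φ) γ δ α β := by
  obtain ⟨hs, h0, hD, L, hL, hLz⟩ := h
  refine ⟨hs.contDiff_comp contDiff_swap, by simp [h0], fun h => hD (by linarith),
    _, (hasStrictFDerivAt_swap _).comp 0 hL, fun z => ?_⟩
  simp [hLz]

theorem Change.swap_right {Φ : ℝ × ℝ → ℝ × ℝ} {α β γ δ : ℝ} (h : Change Φ α β γ δ) :
    Change (Φ ∘ Prod.swap) β α δ γ := by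
  obtain ⟨hs, h0, hD, L, hL, hLz⟩ := h
  have h0' : (Prod.swap (0 : ℝ × ℝ)) = 0 := rfl
  refine ⟨?_, by simp [h0], fun h => hD (by linarith),
    _, HasStrictFDerivAt.comp (0 : ℝ × ℝ) (g := Φ) (h0'.symm ▸ hL) (hasStrictFDerivAt_swap 0),
    fun z => ?_⟩
  · exact SmoothNear.comp (h0'.symm ▸ hs) ⟨Set.univ, isOpen_univ, trivial, contDiff_swap.contDiffOn⟩
  · simp [hLz, add_comm]

theorem norm_scale_le {p q : ℕ} (hpq : p ≤ q) {t : ℝ} (h0 : 0 < t) (h1 : t < 1) (z : ℝ × ℝ) :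
    ‖(t ^ p * z.1, t ^ q * z.2)‖ ≤ t ^ p * ‖z‖ := by
  rw [Prod.norm_def]
  refine max_le ?_ ?_
  · rw [norm_mul, Real.norm_of_nonneg (pow_nonneg h0.le p)]
    exact mul_le_mul_of_nonneg_left (norm_fst_le z) (pow_nonneg h0.le p)
  · rw [norm_mul, Real.norm_of_nonneg (pow_nonneg h0.le q)]
    exact mul_le_mul (pow_le_pow_of_le_one h0.le h1.le hpq) (norm_snd_le z) (norm_nonneg _)
      (pow_nonneg h0.le p)

/-- The first component is governed by its linear part, where β y survives only for p = q. The
second is split as its value on the x-axis, of leading part κ, plus δ y plus an error o(t^q). -/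
theorem Change.scaledTo {Φ : ℝ × ℝ → ℝ × ℝ} {α β γ δ : ℝ} (h : Change Φ α β γ δ) {p q : ℕ}
    (hp : 0 < p) (hpq : p ≤ q) {β' : ℝ} (hβ : p = q → β' = β) (hβ' : p < q → β' = 0) {κ : ℝ → ℝ}
    (hκ : ∀ z : ℝ × ℝ, Tendsto (fun tz : ℝ × (ℝ × ℝ) => (Φ (tz.1 ^ p * tz.2.1, 0)).2 / tz.1 ^ q)
      (𝓝[>] 0 ×ˢ 𝓝 z) (𝓝 (κ z.1))) :
    ScaledTo Φ p q fun z => (α * z.1 + β' * z.2, κ z.1 + δ * z.2) := by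
  obtain ⟨-, h0, -, L, hL, hLz⟩ := h
  intro z
  have hq : 0 < q := hp.trans_le hpq
  have h3 : Tendsto (fun tz : ℝ × (ℝ × ℝ) => tz.2) (𝓝[>] (0:ℝ) ×ˢ 𝓝 z) (𝓝 z) := tendsto_snd
  have hbd : (fun tz : ℝ × (ℝ × ℝ) => ‖tz.2‖) =O[𝓝[>] (0:ℝ) ×ˢ 𝓝 z] fun _ => (1 : ℝ) :=
    h3.norm.isBigO_one ℝ
  have hsc := tendsto_scale hp hq z
  have hsc0 : Tendsto (fun tz : ℝ × (ℝ × ℝ) => ((tz.1 ^ p * tz.2.1, 0) : ℝ × ℝ))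
      (𝓝[>] (0:ℝ) ×ˢ 𝓝 z) (𝓝 0) :=
    ((continuous_fst.tendsto _).comp hsc).prodMk_nhds tendsto_const_nhds
  refine Tendsto.prodMk_nhds ?_ ?_
  · have h4 := (hasFDerivAt_iff_isLittleO.1 hL.hasFDerivAt).comp_tendsto hsc
    have h5 : (fun tz : ℝ × (ℝ × ℝ) => ((tz.1 ^ p * tz.2.1, tz.1 ^ q * tz.2.2) : ℝ × ℝ))
        =O[𝓝[>] (0:ℝ) ×ˢ 𝓝 z] fun tz => tz.1 ^ p := by
      have : (fun tz : ℝ × (ℝ × ℝ) => tz.1 ^ p * ‖tz.2‖) =O[𝓝[>] (0:ℝ) ×ˢ 𝓝 z]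
          fun tz => tz.1 ^ p := by
        simpa using (isBigO_refl (fun tz : ℝ × (ℝ × ℝ) => tz.1 ^ p) _).mul hbd
      refine IsBigO.trans (IsBigO.of_bound 1 ?_) this
      filter_upwards [eventually_fst_pos z, eventually_fst_lt_one z] with tz ht ht'
      rw [one_mul, norm_mul, norm_norm, Real.norm_of_nonneg (pow_nonneg ht.le p)]
      exact norm_scale_le hpq ht ht' _
    have h6 := (isBigO_fst_prod'.trans_isLittleO (h4.trans_isBigO
      (by simpa [Function.comp_def] using h5))).tendsto_div_nhds_zero
    have h7 : Tendsto (fun tz : ℝ × (ℝ × ℝ) => α * tz.2.1 + β * (tz.1 ^ (q - p) * tz.2.2))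
        (𝓝[>] (0:ℝ) ×ˢ 𝓝 z) (𝓝 (α * z.1 + β' * z.2)) := by
      have hx := (((continuous_fst.tendsto z).comp h3).const_mul α)
      have hy := ((((tendsto_fst_nhds (z := z)).pow (q - p)).mul
        ((continuous_snd.tendsto z).comp h3)).const_mul β)
      have := hx.add hy
      rcases hpq.eq_or_lt with he | hlt
      · rw [hβ he]
        simpa [he] using this
      · rw [hβ' hlt]
        simpa [zero_pow (show q - p ≠ 0 by omega)] using this
    have h8 := h6.add h7
    rw [zero_add] at h8
    refine h8.congr' ?_
    filter_upwards [eventually_fst_pos z] with tz ht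
    have hq' : tz.1 ^ q = tz.1 ^ (q - p) * tz.1 ^ p := by rw [← pow_add]; congr 1; omega
    have hne := (pow_pos ht p).ne'
    simp only [Function.comp_apply, sub_zero, hLz, h0, Prod.fst_sub]
    rw [hq']
    field_simp
    ring
  -- Strict differentiability is essential: comparing with (t^p x, 0) gives an error small relative
  -- to t^q, whereas differentiability at 0 only controls it relative to t^p.
  · have h4 := hL.isLittleO.comp_tendsto (hsc.prodMk_nhds hsc0)
    have h5 : (fun tz : ℝ × (ℝ × ℝ) => ((0, tz.1 ^ q * tz.2.2) : ℝ × ℝ))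
        =O[𝓝[>] (0:ℝ) ×ˢ 𝓝 z] fun tz => tz.1 ^ q := by
      have : (fun tz : ℝ × (ℝ × ℝ) => tz.1 ^ q * ‖tz.2‖) =O[𝓝[>] (0:ℝ) ×ˢ 𝓝 z]
          fun tz => tz.1 ^ q := by
        simpa using (isBigO_refl (fun tz : ℝ × (ℝ × ℝ) => tz.1 ^ q) _).mul hbd
      refine IsBigO.trans (IsBigO.of_bound 1 (Eventually.of_forall fun tz => ?_)) this
      rw [one_mul, norm_mul, norm_norm, Prod.norm_def, norm_zero,
        max_eq_right (norm_nonneg _), norm_mul]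
      exact mul_le_mul_of_nonneg_left (norm_snd_le tz.2) (norm_nonneg _)
    have h6 := (isBigO_snd_prod'.trans_isLittleO (h4.trans_isBigO
      (by simpa [Function.comp_def] using h5))).tendsto_div_nhds_zero
    have h7 := (h6.add (hκ z)).add (((continuous_snd.tendsto z).comp h3).const_mul δ)
    rw [zero_add] at h7
    refine h7.congr' ?_
    filter_upwards [eventually_fst_pos z] with tz ht
    have hne := (pow_pos ht q).ne'
    simp only [Function.comp_apply, hLz, Prod.snd_sub, Prod.fst_sub, sub_self, sub_zero, mul_zero,
      zero_add]
    field_simp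
    ring

theorem Change.hasDerivAt {Φ : ℝ × ℝ → ℝ × ℝ} {α β γ δ : ℝ} (h : Change Φ α β γ δ) :
    HasDerivAt (fun x => (Φ (x, 0)).2) γ 0 := by
  obtain ⟨-, h0, -, L, hL, hLz⟩ := h
  have h1 : HasDerivAt (fun x : ℝ => ((x, 0) : ℝ × ℝ)) (1, 0) 0 :=
    (hasDerivAt_id (0 : ℝ)).prodMk (hasDerivAt_const (0 : ℝ) (0 : ℝ))
  have h2 := (HasFDerivAt.comp_hasDerivAt (0 : ℝ) (l := Φ) (f := fun x : ℝ => ((x, 0) : ℝ × ℝ))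
    hL.hasFDerivAt h1)
  have h3 := (ContinuousLinearMap.snd ℝ ℝ ℝ).hasFDerivAt.comp_hasDerivAt (0 : ℝ) h2
  simpa [hLz, Function.comp_def] using h3

theorem hasDerivAt_of_isBigO_sq {g : ℝ → ℝ} {r : ℝ}
    (h : (fun x => g x - r * x ^ 1) =O[𝓝 0] fun x => x ^ 2) : HasDerivAt g r 0 := by
  have h0 : g 0 = 0 := by
    have := eq_zero_of_isBigO_pow two_pos h
    simpa using this
  rw [hasDerivAt_iff_isLittleO]
  refine ((h.congr_left fun x => ?_).trans_isLittleO (isLittleO_pow_pow one_lt_two)).congr_right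
    fun x => ?_
  · simp [h0, mul_comm]
  · simp

/-- On the `x`-axis the second component either has a leading term `r xˡ` with `l ≤ q / p`, or
vanishes to order larger than `q / p`. -/
theorem Change.exists_order {Φ : ℝ × ℝ → ℝ × ℝ} {α β γ δ : ℝ} (h : Change Φ α β γ δ) {p q : ℕ}
    (hp : 0 < p) :
    (∃ l r, 0 < l ∧ p * l ≤ q ∧ r ≠ 0 ∧ (l = 1 → r = γ) ∧
      (fun x => (Φ (x, 0)).2 - r * x ^ l) =O[𝓝 0] fun x => x ^ (l + 1)) ∨
    (∃ M, q < p * M ∧ (fun x => (Φ (x, 0)).2) =O[𝓝 0] fun x => x ^ M) ∧ (p ≤ q → γ = 0) := by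
  classical
  set g : ℝ → ℝ := fun x => (Φ (x, 0)).2 with hg
  have hgs : SmoothNear g 0 := by
    have h1 : SmoothNear (fun x : ℝ => ((x, 0) : ℝ × ℝ)) 0 :=
      ⟨Set.univ, isOpen_univ, trivial, (contDiff_id.prodMk contDiff_const).contDiffOn⟩
    exact (SmoothNear.comp (f := fun x : ℝ => ((x, 0) : ℝ × ℝ)) (p := (0:ℝ)) (g := Φ) h.smooth
      h1).contDiff_comp contDiff_snd
  have hg0 : g 0 = 0 := by
    have : Φ (0, 0) = 0 := h.map_zero
    simp [hg, this]
  obtain ⟨c, hc⟩ := hgs.exists_taylor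
  have hc0 : c 0 = 0 := by
    have := eq_zero_of_isBigO_pow one_pos (hc 0)
    simpa [hg0] using this
  have hder : ∀ r, (fun x => g x - r * x ^ 1) =O[𝓝 0] (fun x => x ^ 2) → r = γ := fun r hr =>
    (hasDerivAt_of_isBigO_sq hr).unique h.hasDerivAt
  by_cases hex : ∃ l, c l ≠ 0 ∧ p * l ≤ q
  · left
    set l := Nat.find hex with hl
    obtain ⟨hcl, hlq⟩ := Nat.find_spec hex
    have hsum : ∀ x : ℝ, ∑ k ∈ Finset.range (l + 1), c k * x ^ k = c l * x ^ l := fun x => by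
      rw [Finset.sum_range_succ, Finset.sum_eq_zero, zero_add]
      intro k hk
      have hk' := Finset.mem_range.1 hk
      have := Nat.find_min hex hk'
      have h1 : p * k ≤ p * l := Nat.mul_le_mul_left p hk'.le
      have : c k = 0 := by
        by_contra h2
        exact this ⟨h2, h1.trans hlq⟩
      rw [this, zero_mul]
    have hO := (hc l).congr_left (f₂ := fun x => g x - c l * x ^ l) fun x => by rw [hsum]
    refine ⟨l, c l, ?_, hlq, hcl, fun h1 => ?_, hO⟩
    · rcases Nat.eq_zero_or_pos l with h1 | h1
      · exact absurd (h1 ▸ hcl) (not_not.2 hc0)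
      · exact h1
    · rw [h1] at hO ⊢
      exact hder _ hO
  · right
    push Not at hex
    have hO : (fun x => g x) =O[𝓝 0] fun x => x ^ (q / p + 1) := by
      refine (hc (q / p)).congr_left fun x => ?_
      rw [Finset.sum_eq_zero, sub_zero]
      intro k hk
      have h1 : k ≤ q / p := Nat.lt_succ_iff.1 (Finset.mem_range.1 hk)
      have h2 : p * k ≤ q := (Nat.mul_le_mul_left p h1).trans (Nat.mul_div_le q p)
      have : c k = 0 := by
        by_contra h3
        exact absurd (hex k h3) (not_lt.2 h2)
      rw [this, zero_mul]
    refine ⟨⟨q / p + 1, Nat.lt_mul_div_succ q hp, hO⟩, fun hpq => ?_⟩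
    -- For p ≤ q the vanishing order is at least 2, so the derivative γ is zero.
    have h2 : 2 ≤ q / p + 1 := by
      have := Nat.div_pos hpq hp
      omega
    refine (hder 0 ?_).symm
    refine (hO.trans ?_).congr_left fun x => by ring
    refine IsBigO.of_bound 1 ?_
    filter_upwards [Metric.ball_mem_nhds (0 : ℝ) one_pos] with x hx
    rw [mem_ball_zero_iff] at hx
    rw [norm_pow, norm_pow, one_mul]
    exact pow_le_pow_of_le_one (norm_nonneg x) hx.le h2

theorem exists_weightGE {c : ℕ → ℕ → ℝ} (h : ∃ a b, c a b ≠ 0) (p q : ℕ) :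
    ∃ N, WeightGE c p q N ∧ ∃ a b, c a b ≠ 0 ∧ p * a + q * b = N := by
  classical
  have hex : ∃ N a b, c a b ≠ 0 ∧ p * a + q * b = N := by
    obtain ⟨a, b, hab⟩ := h
    exact ⟨_, a, b, hab, rfl⟩
  refine ⟨Nat.find hex, fun a b hab => ?_, Nat.find_spec hex⟩
  exact Nat.find_min' hex ⟨a, b, hab, rfl⟩

theorem form_diag (c : ℕ → ℕ → ℝ) (p q N : ℕ) (s t : ℝ) (z : ℝ × ℝ) :
    form c p q N (s * z.1, t * z.2) = form (fun a b => c a b * s ^ a * t ^ b) p q N z := by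
  simp only [form, mul_pow]
  exact Finset.sum_congr rfl fun ab _ => by ring

/-- On the side of the Newton polygon with normal `(p, q)`, `p ≤ q`, a coordinate change acts either
by a nontrivial quasi-homogeneous substitution or by rescaling the coefficients. -/
theorem Change.formRel_or_diag {S T : ℝ × ℝ → ℝ} (hS : SmoothNear S 0) (hT : SmoothNear T 0)
    {Φ : ℝ × ℝ → ℝ × ℝ} (hTS : T =ᶠ[𝓝 0] S ∘ Φ) {α β γ δ : ℝ} (h : Change Φ α β γ δ)
    (hα : α ≠ 0) (hδ : δ ≠ 0)
    (hbad : ∀ p q, 0 < p → 0 < q → ¬ Bad (taylorCoeff T) p q) {p q N : ℕ} (hp : 0 < p)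
    (hpq : p ≤ q) (hβγ : p = q → γ = 0 → β = 0) (hN : WeightGE (taylorCoeff S) p q N)
    {a₁ b₁ : ℕ} (hab : taylorCoeff S a₁ b₁ ≠ 0) (hw : p * a₁ + q * b₁ = N) (hle : a₁ ≤ b₁) :
    (∃ l N' α' β' γ' δ', 0 < l ∧ p * l = q ∧ N = p * N' ∧
      FormRel (taylorCoeff S) (taylorCoeff T) l N' α' β' γ' δ') ∨
    (∃ s t : ℝ, s ≠ 0 ∧ t ≠ 0 ∧ WeightGE (taylorCoeff T) p q N ∧
      ∀ a b, p * a + q * b = N → taylorCoeff T a b = taylorCoeff S a b * s ^ a * t ^ b) := by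
  have hq : 0 < q := hp.trans_le hpq
  rcases h.exists_order (q := q) hp with ⟨l, r, hl, hlq, hr, hrγ, hO⟩ | ⟨⟨M, hM, hO⟩, hγ⟩
  · obtain ⟨N', hN', a₀, b₀, hab₀, hw₀⟩ := exists_weightGE ⟨a₁, b₁, hab⟩ 1 l
    have hκ : ∀ z : ℝ × ℝ, Tendsto (fun tz : ℝ × (ℝ × ℝ) =>
        (Φ (tz.1 ^ 1 * tz.2.1, 0)).2 / tz.1 ^ l) (𝓝[>] 0 ×ˢ 𝓝 z) (𝓝 (r * z.1 ^ l)) := by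
      intro z
      have h3 : Tendsto (fun tz : ℝ × (ℝ × ℝ) => tz.2) (𝓝[>] (0:ℝ) ×ˢ 𝓝 z) (𝓝 z) := tendsto_snd
      have h4 := (tendsto_scaled_of_isBigO one_pos (show l < 1 * (l + 1) by omega) hO z).add
        ((((continuous_fst.tendsto z).comp h3).pow l).const_mul r)
      rw [zero_add] at h4
      refine h4.congr' ?_
      filter_upwards [eventually_fst_pos z] with tz ht
      have := (pow_pos ht l).ne'
      simp only [Function.comp_apply]
      field_simp
      ring
    have hsc := h.scaledTo one_pos hl (β' := if l = 1 then β else 0)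
      (fun h => by rw [if_pos h.symm]) (fun h => by rw [if_neg (by omega)])
      (κ := fun x => r * x ^ l) hκ
    obtain ⟨hWT, hform⟩ := form_comp hS.hasJet hT.hasJet hTS one_pos hl hsc hN'
    have hrel : FormRel (taylorCoeff S) (taylorCoeff T) l N' α (if l = 1 then β else 0) r δ := by
      refine ⟨hN', hWT, fun x y => hform (x, y), ?_, hα, hr, hδ, ?_⟩
      · split_ifs with h1
        · exact Or.inr h1
        · exact Or.inl rfl
      · split_ifs with h1
        · rw [hrγ h1]
          exact h.det_ne
        · rw [zero_mul, sub_zero]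
          exact mul_ne_zero hα hδ
    rcases hlq.eq_or_lt with heq | hlt
    · refine Or.inl ⟨l, N', _, _, _, _, hl, heq, ?_, hrel⟩
      refine le_antisymm ?_ ?_
      · have := hN _ _ hab₀
        rw [← heq] at this
        calc N ≤ p * a₀ + p * l * b₀ := this
          _ = p * N' := by rw [← hw₀]; ring
      · calc p * N' ≤ p * (1 * a₁ + l * b₁) := Nat.mul_le_mul_left p (hN' _ _ hab)
          _ = N := by rw [← hw, ← heq]; ring
    -- Since l < q / p, minimisers of the weight (1, l) lie no lower than (a₁, b₁), and b₁ ≥ a₁. The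
    -- substitution would then create a bad side for T.
    · refine absurd (hrel.bad hl ⟨a₀, b₀, hab₀, hw₀⟩ (B := b₁) ?_ ?_) (hbad 1 l one_pos hl)
      · intro a b hab' hw'
        have h1 := hN' _ _ hab
        have h2 := hN _ _ hab'
        by_contra! hlt'
        have h3 : p * (1 * a + l * b) ≤ p * (1 * a₁ + l * b₁) := Nat.mul_le_mul_left p (by omega)
        zify at *
        nlinarith
      · have := hN' _ _ hab
        nlinarith
  -- The image of the x-axis is of too high an order to be seen at this scale, so the leading part
  -- of Φ is diagonal.
  · right
    have hκ : ∀ z : ℝ × ℝ, Tendsto (fun tz : ℝ × (ℝ × ℝ) =>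
        (Φ (tz.1 ^ p * tz.2.1, 0)).2 / tz.1 ^ q) (𝓝[>] 0 ×ˢ 𝓝 z) (𝓝 0) :=
      fun z => tendsto_scaled_of_isBigO hp hM hO z
    have hsc := h.scaledTo hp hpq (β' := 0) (fun h => (hβγ h (hγ hpq)).symm) (fun _ => rfl)
      (κ := fun _ => 0) hκ
    obtain ⟨hWT, hform⟩ := form_comp hS.hasJet hT.hasJet hTS hp hq hsc hN
    refine ⟨α, δ, hα, hδ, hWT, fun a b hab' => form_congr_coeff (N := N)
      (c := fun a b => taylorCoeff S a b * α ^ a * δ ^ b) hp hq (fun z => ?_) hab'⟩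
    rw [hform, ← form_diag]
    simp

theorem StrictStraddle.swap {c : ℕ → ℕ → ℝ} {p q : ℕ} (h : StrictStraddle c p q) :
    StrictStraddle (fun a b => c b a) q p := by
  obtain ⟨N, hN, ⟨a, b, hab, hw, hlt⟩, ⟨a', b', hab', hw', hlt'⟩⟩ := h
  exact ⟨N, hN.swap, ⟨b', a', hab', by omega, hlt'⟩, ⟨b, a, hab, by omega, hlt⟩⟩

theorem DiagonalVertex.swap {c : ℕ → ℕ → ℝ} (h : DiagonalVertex c) :
    DiagonalVertex fun a b => c b a := by
  obtain ⟨p, q, n, hp, hq, hn, h⟩ := h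
  exact ⟨q, p, n, hq, hp, hn, fun a b hab hle => (h b a hab (by linarith)).symm⟩

/-- The bisectrix crosses a compact edge in its interior for some positive weights. -/
def HasStraddle (c : ℕ → ℕ → ℝ) : Prop := ∃ p q, 0 < p ∧ 0 < q ∧ StrictStraddle c p q

theorem HasStraddle.swap {c : ℕ → ℕ → ℝ} (h : HasStraddle c) : HasStraddle fun a b => c b a := by
  obtain ⟨p, q, hp, hq, h⟩ := h
  exact ⟨q, p, hq, hp, h.swap⟩

theorem Change.transfer_of_le {S T : ℝ × ℝ → ℝ} (hS : SmoothNear S 0) (hT : SmoothNear T 0)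
    {Φ : ℝ × ℝ → ℝ × ℝ} (hTS : T =ᶠ[𝓝 0] S ∘ Φ) {α β γ δ : ℝ} (h : Change Φ α β γ δ)
    (hα : α ≠ 0) (hδ : δ ≠ 0)
    (hbS : ∀ p q, 0 < p → 0 < q → ¬ Bad (taylorCoeff S) p q)
    (hbT : ∀ p q, 0 < p → 0 < q → ¬ Bad (taylorCoeff T) p q) {p q : ℕ} (hp : 0 < p)
    (hpq : p ≤ q) (hβγ : p = q → γ = 0 → β = 0) :
    (StrictStraddle (taylorCoeff S) p q → HasStraddle (taylorCoeff T)) ∧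
    ∀ n, taylorCoeff S n n ≠ 0 → (∀ a b, taylorCoeff S a b ≠ 0 → p * a + q * b ≤ (p + q) * n →
      a = n ∧ b = n) → DiagonalVertex (taylorCoeff T) := by
  have hq : 0 < q := hp.trans_le hpq
  constructor
  · rintro ⟨N, hN, ⟨a, b, hab, hw, hlt⟩, ⟨a', b', hab', hw', hlt'⟩⟩
    rcases h.formRel_or_diag hS hT hTS hα hδ hbT hp hpq hβγ hN hab hw hlt.le with
      ⟨l, N', α', β', γ', δ', hl, hlq, hNN, hrel⟩ | ⟨s, t, hs, ht, hWT, hst⟩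
    · refine ⟨1, l, one_pos, hl, hrel.strict hl hbS ⟨a, b, hab, ?_, hlt⟩⟩
      refine Nat.eq_of_mul_eq_mul_left hp ?_
      rw [← hNN, ← hw, ← hlq]
      ring
    · have hne : ∀ a b, p * a + q * b = N → taylorCoeff S a b ≠ 0 → taylorCoeff T a b ≠ 0 :=
        fun a b hw hab => by
          rw [hst a b hw]
          exact mul_ne_zero (mul_ne_zero hab (pow_ne_zero a hs)) (pow_ne_zero b ht)
      exact ⟨p, q, hp, hq, N, hWT, ⟨a, b, hne a b hw hab, hw, hlt⟩,
        ⟨a', b', hne a' b' hw' hab', hw', hlt'⟩⟩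
  · intro n hn hmin
    have hN : WeightGE (taylorCoeff S) p q ((p + q) * n) := by
      intro a b hab
      by_contra! hlt
      obtain ⟨rfl, rfl⟩ := hmin a b hab hlt.le
      nlinarith
    rcases h.formRel_or_diag hS hT hTS hα hδ hbT hp hpq hβγ hN hn (by ring) le_rfl with
      ⟨l, N', α', β', γ', δ', hl, hlq, hNN, hrel⟩ | ⟨s, t, hs, ht, hWT, hst⟩
    · have hN' : N' = (1 + l) * n := by
        refine Nat.eq_of_mul_eq_mul_left hp ?_
        rw [← hNN, ← hlq]
        ring
      -- The only monomial on the side is (n, n), so a nontrivial substitution would produce a root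
      -- of order n, which is the Newton distance.
      refine absurd (hrel.bad hl ⟨n, n, hn, by rw [hN']; ring⟩ (B := n) ?_ hN'.le)
        (hbT 1 l one_pos hl)
      intro a b hab hw
      refine (hmin a b hab ?_).2.ge
      rw [hNN, ← hw, ← hlq]
      exact le_of_eq (by ring)
    · refine ⟨p, q, n, hp, hq, ?_, fun a b hab hle => ?_⟩
      · rw [hst n n (by ring)]
        exact mul_ne_zero (mul_ne_zero hn (pow_ne_zero n hs)) (pow_ne_zero n ht)
      · have hw := le_antisymm hle (hWT a b hab)
        refine hmin a b (fun h0 => hab ?_) hle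
        rw [hst a b hw, h0, zero_mul, zero_mul]

theorem not_bad_swap {S : ℝ × ℝ → ℝ} (hS : SmoothNear S 0)
    (h : ∀ p q, 0 < p → 0 < q → ¬ Bad (taylorCoeff S) p q) :
    ∀ p q, 0 < p → 0 < q → ¬ Bad (taylorCoeff (S ∘ Prod.swap)) p q := fun p q hp hq hB => by
  rw [hS.taylorCoeff_swap] at hB
  exact h q p hq hp (hB.swap hp hq)

/-- When p > q, or p = q with γ = 0 and β ≠ 0, conjugation by the swap exchanges the weights as well
as β and γ and restores the hypotheses of `Change.transfer_of_le`. -/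
theorem Change.transfer_of_diag_ne {S T : ℝ × ℝ → ℝ} (hS : SmoothNear S 0) (hT : SmoothNear T 0)
    {Φ : ℝ × ℝ → ℝ × ℝ} (hTS : T =ᶠ[𝓝 0] S ∘ Φ) {α β γ δ : ℝ} (h : Change Φ α β γ δ)
    (hα : α ≠ 0) (hδ : δ ≠ 0)
    (hbS : ∀ p q, 0 < p → 0 < q → ¬ Bad (taylorCoeff S) p q)
    (hbT : ∀ p q, 0 < p → 0 < q → ¬ Bad (taylorCoeff T) p q) {p q : ℕ} (hp : 0 < p)
    (hq : 0 < q) :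
    (StrictStraddle (taylorCoeff S) p q → HasStraddle (taylorCoeff T)) ∧
    ∀ n, taylorCoeff S n n ≠ 0 → (∀ a b, taylorCoeff S a b ≠ 0 → p * a + q * b ≤ (p + q) * n →
      a = n ∧ b = n) → DiagonalVertex (taylorCoeff T) := by
  by_cases hc : p ≤ q ∧ (p = q → γ = 0 → β = 0)
  · exact h.transfer_of_le hS hT hTS hα hδ hbS hbT hp hc.1 hc.2
  have hsw : Tendsto (Prod.swap : ℝ × ℝ → ℝ × ℝ) (𝓝 0) (𝓝 0) := continuous_swap.tendsto' _ _ rfl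
  have hTS' : T ∘ Prod.swap =ᶠ[𝓝 0] (S ∘ Prod.swap) ∘ (Prod.swap ∘ Φ ∘ Prod.swap) := by
    filter_upwards [hsw.eventually hTS] with z hz
    simp only [Function.comp_apply, Prod.swap_swap] at hz ⊢
    exact hz
  have hqp : q ≤ p ∧ (q = p → β = 0 → γ = 0) := by
    by_cases hpq : p ≤ q
    · have h1 : ¬ (p = q → γ = 0 → β = 0) := fun h1 => hc ⟨hpq, h1⟩
      push Not at h1
      exact ⟨h1.1.ge, fun _ h2 => absurd h2 h1.2.2⟩
    · exact ⟨by omega, fun h1 => absurd h1.ge hpq⟩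
  have key := h.swap_right.swap_left.transfer_of_le hS.comp_swap hT.comp_swap hTS' hδ hα
    (not_bad_swap hS hbS) (not_bad_swap hT hbT) hq hqp.1 hqp.2
  rw [hS.taylorCoeff_swap, hT.taylorCoeff_swap] at key
  exact ⟨fun h1 => (key.1 h1.swap).swap, fun n hn h1 => (key.2 n hn fun a b hab hle =>
    (h1 b a hab (by linarith)).symm).swap⟩

/-- As the Jacobian is nonzero, either both diagonal or both off-diagonal entries are nonzero; in
the second situation composition with the swap reduces to the first. -/
theorem Change.transfer {S T : ℝ × ℝ → ℝ} (hS : SmoothNear S 0) (hT : SmoothNear T 0)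
    {Φ : ℝ × ℝ → ℝ × ℝ} (hTS : T =ᶠ[𝓝 0] S ∘ Φ) {α β γ δ : ℝ} (h : Change Φ α β γ δ)
    (hbS : ∀ p q, 0 < p → 0 < q → ¬ Bad (taylorCoeff S) p q)
    (hbT : ∀ p q, 0 < p → 0 < q → ¬ Bad (taylorCoeff T) p q) :
    (HasStraddle (taylorCoeff S) → HasStraddle (taylorCoeff T)) ∧
    (DiagonalVertex (taylorCoeff S) → DiagonalVertex (taylorCoeff T)) := by
  by_cases hc : α ≠ 0 ∧ δ ≠ 0
  · constructor
    · rintro ⟨p, q, hp, hq, h1⟩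
      exact (h.transfer_of_diag_ne hS hT hTS hc.1 hc.2 hbS hbT hp hq).1 h1
    · rintro ⟨p, q, n, hp, hq, hn, h1⟩
      exact (h.transfer_of_diag_ne hS hT hTS hc.1 hc.2 hbS hbT hp hq).2 n hn h1
  · have h0 : α * δ = 0 := by
      by_contra h0
      exact hc ⟨left_ne_zero_of_mul h0, right_ne_zero_of_mul h0⟩
    have h2 : β * γ ≠ 0 := fun h2 => h.det_ne (by rw [h0, h2, sub_zero])
    have hTS' : T =ᶠ[𝓝 0] (S ∘ Prod.swap) ∘ (Prod.swap ∘ Φ) := by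
      filter_upwards [hTS] with z hz
      simpa using hz
    have key := fun p q => h.swap_left.transfer_of_diag_ne (p := p) (q := q) hS.comp_swap hT hTS'
      (right_ne_zero_of_mul h2) (left_ne_zero_of_mul h2) (not_bad_swap hS hbS) hbT
    rw [hS.taylorCoeff_swap] at key
    constructor
    · intro h1
      obtain ⟨p, q, hp, hq, h1⟩ := h1.swap
      exact (key p q hp hq).1 h1
    · intro h1
      obtain ⟨p, q, n, hp, hq, hn, h1⟩ := h1.swap
      exact (key p q hp hq).2 n hn h1

/-! ### Coordinate changes as germs, and shears among them. -/

theorem IsCoordChange.smoothNear {Φ : ℝ × ℝ → ℝ × ℝ} (h : IsCoordChange Φ) : SmoothNear Φ 0 := by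
  obtain ⟨-, φ, hz, heq⟩ := h
  exact ⟨φ.source, φ.open_source, hz,
    (contMDiffOn_iff_contDiffOn.1 φ.contMDiffOn).congr heq⟩

theorem SmoothNear.contDiffAt {E F : Type*} [NormedAddCommGroup E] [NormedSpace ℝ E]
    [NormedAddCommGroup F] [NormedSpace ℝ F] {f : E → F} {p : E} (h : SmoothNear f p) :
    ContDiffAt ℝ ∞ f p := by
  obtain ⟨U, hU, hp, hf⟩ := h
  exact hf.contDiffAt (hU.mem_nhds hp)

theorem IsCoordChange.comp {Φ Ψ : ℝ × ℝ → ℝ × ℝ} (hΦ : IsCoordChange Φ) (hΨ : IsCoordChange Ψ) :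
    IsCoordChange (Φ ∘ Ψ) := by
  have h := hΦ.2
  rw [← hΨ.1] at h
  exact ⟨by simp [hΦ.1, hΨ.1], IsLocalDiffeomorphAt.comp (hf := hΨ.2) (hg := h)⟩

theorem IsCoordChange.exists_inverse {Φ : ℝ × ℝ → ℝ × ℝ} (h : IsCoordChange Φ) :
    ∃ Ψ, IsCoordChange Ψ ∧ Φ ∘ Ψ =ᶠ[𝓝 0] id ∧ Ψ ∘ Φ =ᶠ[𝓝 0] id := by
  obtain ⟨h0, h⟩ := h
  have h1 := h.localInverse_isLocalDiffeomorphAt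
  have h2 := h.localInverse_eventuallyEq_right
  have h3 := h.localInverse_eventuallyEq_left
  rw [h0] at h1 h2
  refine ⟨h.localInverse, ⟨?_, h1⟩, h2, h3⟩
  have := h3.self_of_nhds
  simpa [h0] using this

theorem IsCoordChange.tendsto {Φ : ℝ × ℝ → ℝ × ℝ} (h : IsCoordChange Φ) :
    Tendsto Φ (𝓝 0) (𝓝 0) := by
  have := h.smoothNear.contDiffAt.continuousAt
  rwa [ContinuousAt, h.1] at this

theorem IsCoordChange.change {Φ : ℝ × ℝ → ℝ × ℝ} (h : IsCoordChange Φ) :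
    ∃ α β γ δ, Change Φ α β γ δ := by
  obtain ⟨Ψ, hΨ, -, hinv⟩ := h.exists_inverse
  have hL := h.smoothNear.contDiffAt.hasStrictFDerivAt (by simp)
  have hM := hΨ.smoothNear.contDiffAt.hasStrictFDerivAt (by simp)
  set L := fderiv ℝ Φ 0
  set M := fderiv ℝ Ψ 0
  have hML : ∀ z, M (L z) = z := by
    have h1 : HasFDerivAt (Ψ ∘ Φ) (M.comp L) 0 :=
      HasFDerivAt.comp (0 : ℝ × ℝ) (by rw [h.1]; exact hM.hasFDerivAt) hL.hasFDerivAt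
    have h2 := (h1.congr_of_eventuallyEq hinv.symm).unique (hasFDerivAt_id (0 : ℝ × ℝ))
    exact fun z => congrArg (fun K : ℝ × ℝ →L[ℝ] ℝ × ℝ => K z) h2
  have hLz : ∀ z, L z = ((L (1, 0)).1 * z.1 + (L (0, 1)).1 * z.2,
      (L (1, 0)).2 * z.1 + (L (0, 1)).2 * z.2) := by
    intro z
    have hz : z = z.1 • ((1, 0) : ℝ × ℝ) + z.2 • ((0, 1) : ℝ × ℝ) := by ext <;> simp
    conv_lhs => rw [hz, map_add, map_smul, map_smul]
    ext <;> simp [mul_comm]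
  refine ⟨_, _, _, _, h.smoothNear, h.1, fun hdet => ?_, L, hL, hLz⟩
  -- With zero determinant, (δ, -γ) and (-β, α) lie in the kernel. Injectivity makes all four
  -- entries vanish, so L kills (1, 0) as well.
  have hinj : ∀ z, L z = 0 → z = 0 := fun z hz => by rw [← hML z, hz, map_zero]
  have h1 := hinj ((L (0, 1)).2, -(L (1, 0)).2) (by
    rw [hLz]
    ext <;> simp only [Prod.fst_zero, Prod.snd_zero] <;> linarith)
  have h2 := hinj (-(L (0, 1)).1, (L (1, 0)).1) (by
    rw [hLz]
    ext <;> simp only [Prod.fst_zero, Prod.snd_zero] <;> linarith)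
  simp only [Prod.mk_eq_zero, neg_eq_zero] at h1 h2
  have h3 := hinj (1, 0) (Prod.ext h2.2 h1.2)
  simp at h3

theorem isCoordChange_swap : IsCoordChange Prod.swap :=
  ⟨rfl, (ContinuousLinearEquiv.prodComm ℝ ℝ ℝ).toDiffeomorph.isLocalDiffeomorph 0⟩

theorem IsVerticalShear.isCoordChange {Φ : ℝ × ℝ → ℝ × ℝ} (h : IsVerticalShear Φ) :
    IsCoordChange Φ := by
  obtain ⟨a, ⟨U, hU, h0, ha⟩, ha0, rfl⟩ := h
  refine ⟨by simp [ha0], ?_⟩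
  have hcomp : ContDiffOn ℝ ∞ (fun z : ℝ × ℝ => a z.1) (U ×ˢ Set.univ) :=
    ha.comp contDiff_fst.contDiffOn fun z hz => hz.1
  let φ : PartialDiffeomorph 𝓘(ℝ, ℝ × ℝ) 𝓘(ℝ, ℝ × ℝ) (ℝ × ℝ) (ℝ × ℝ) ∞ :=
    { toFun := fun z => (z.1, z.2 + a z.1)
      invFun := fun z => (z.1, z.2 - a z.1)
      source := U ×ˢ Set.univ
      target := U ×ˢ Set.univ
      map_source' := fun z hz => ⟨hz.1, trivial⟩
      map_target' := fun z hz => ⟨hz.1, trivial⟩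
      left_inv' := fun z _ => by simp
      right_inv' := fun z _ => by simp
      open_source := hU.prod isOpen_univ
      open_target := hU.prod isOpen_univ
      contMDiffOn_toFun := contMDiffOn_iff_contDiffOn.2
        (contDiff_fst.contDiffOn.prodMk (contDiff_snd.contDiffOn.add hcomp))
      contMDiffOn_invFun := contMDiffOn_iff_contDiffOn.2
        (contDiff_fst.contDiffOn.prodMk (contDiff_snd.contDiffOn.sub hcomp)) }
  exact ⟨φ, ⟨h0, trivial⟩, fun z _ => rfl⟩

theorem isVerticalShear_vShear {a : ℝ → ℝ} (ha : ContDiff ℝ ∞ a) (h0 : a 0 = 0) :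
    IsVerticalShear (vShear a) :=
  ⟨a, ⟨Set.univ, isOpen_univ, trivial, ha.contDiffOn⟩, h0, rfl⟩

theorem SmoothNear.neg {a : ℝ → ℝ} (h : SmoothNear a 0) : SmoothNear (fun x => -a x) 0 := by
  obtain ⟨U, hU, h0, ha⟩ := h
  exact ⟨U, hU, h0, ha.neg⟩

theorem IsVerticalShear.conj_swap {Φ : ℝ × ℝ → ℝ × ℝ} (h : IsVerticalShear Φ) :
    IsHorizontalShear (Prod.swap ∘ Φ ∘ Prod.swap) := by
  obtain ⟨a, ha, ha0, rfl⟩ := h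
  exact ⟨fun x => -a x, ha.neg, by simp [ha0], by funext z; simp [Prod.swap]⟩

theorem IsHorizontalShear.conj_swap {Φ : ℝ × ℝ → ℝ × ℝ} (h : IsHorizontalShear Φ) :
    IsVerticalShear (Prod.swap ∘ Φ ∘ Prod.swap) := by
  obtain ⟨a, ha, ha0, rfl⟩ := h
  exact ⟨fun x => -a x, ha.neg, by simp [ha0], by funext z; simp [Prod.swap, sub_eq_add_neg]⟩

theorem IsHorizontalShear.isCoordChange {Φ : ℝ × ℝ → ℝ × ℝ} (h : IsHorizontalShear Φ) :
    IsCoordChange Φ := by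
  have := isCoordChange_swap.comp (h.conj_swap.isCoordChange.comp isCoordChange_swap)
  convert this using 1
  funext z
  simp

theorem isVerticalShear_id : IsVerticalShear id :=
  ⟨0, ⟨Set.univ, isOpen_univ, trivial, contDiff_const.contDiffOn⟩, rfl, by funext z; simp⟩

theorem isHorizontalShear_id : IsHorizontalShear id :=
  ⟨0, ⟨Set.univ, isOpen_univ, trivial, contDiff_const.contDiffOn⟩, rfl, by funext z; simp⟩

/-! ### Assembly of existence and uniqueness. -/

/-- A smooth germ vanishing at the origin, with nonzero Taylor expansion. -/
structure IsPhase (S : ℝ × ℝ → ℝ) : Prop where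
  smooth : SmoothNear S 0
  value_zero : S 0 = 0
  taylor_ne_zero : ∃ a b : ℕ, taylorCoeff S a b ≠ 0

/-- A flat composite, composed with the inverse germ, would make S itself flat, against uniqueness
of jets. -/
theorem IsPhase.comp {S : ℝ × ℝ → ℝ} (h : IsPhase S) {Φ : ℝ × ℝ → ℝ × ℝ} (hΦ : IsCoordChange Φ) :
    IsPhase (S ∘ Φ) := by
  obtain ⟨hS, h0, hne⟩ := h
  have hT : SmoothNear (S ∘ Φ) 0 := SmoothNear.comp (hΦ.1.symm ▸ hS) hΦ.smoothNear
  refine ⟨hT, by simp [hΦ.1, h0], ?_⟩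
  by_contra! hcon
  obtain ⟨Ψ, hΨ, hinv, -⟩ := hΦ.exists_inverse
  have hO : Ψ =O[𝓝 0] fun z => ‖z‖ := by
    have := (hΨ.smoothNear.contDiffAt.differentiableAt (by simp)).isBigO_sub
    simpa [hΨ.1] using this.norm_right
  have hjet : HasJet S fun _ _ => 0 := by
    intro M
    have h1 := (hT.hasJet M).comp_tendsto hΨ.tendsto
    refine (h1.trans (hO.norm_left.pow (M + 1))).congr' ?_ EventuallyEq.rfl
    filter_upwards [hinv] with z hz
    simp only [Function.comp_apply, id_eq] at hz
    simp [hcon, hz]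
  obtain ⟨a, b, hab⟩ := hne
  exact hab (congrFun (congrFun (hS.hasJet.unique hjet) a) b)

theorem InCase.superadapted {S : ℝ × ℝ → ℝ} {i : SuperadaptedCase} (h : InCase S i) :
    Superadapted S := by
  cases i <;> exact h.1

theorem inCase_unique {S : ℝ × ℝ → ℝ} {i j : SuperadaptedCase} (hi : InCase S i)
    (hj : InCase S j) : i = j := by
  have h12 : BisectrixMeetsCompactEdge S → ¬ BisectrixMeetsVertex S := fun ⟨_, he, h⟩ =>
    he.1.not_bisectrixMeetsVertex h
  have h32 : BisectrixMeetsUnboundedEdge S → ¬ BisectrixMeetsVertex S := fun ⟨_, he, h⟩ =>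
    he.1.not_bisectrixMeetsVertex h
  cases i <;> cases j <;> first
    | rfl
    | exact absurd hj.2 (h12 hi.2)
    | exact absurd hi.2 (h12 hj.2)
    | exact absurd hj.2 (h32 hi.2)
    | exact absurd hi.2 (h32 hj.2)
    | exact absurd hj.2 (not_compact_and_unbounded hi.2)
    | exact absurd hi.2 (not_compact_and_unbounded hj.2)

/-- Cases 1 and 2 transfer along Φ and its inverse; case 3 follows by exclusion, since the cases are
mutually exclusive for one function. -/
theorem inCase_congr {S T : ℝ × ℝ → ℝ} (hS : IsPhase S) (hT : IsPhase T) {Φ : ℝ × ℝ → ℝ × ℝ}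
    (hΦ : IsCoordChange Φ) (hTS : T =ᶠ[𝓝 0] S ∘ Φ) {i j : SuperadaptedCase} (hi : InCase S i)
    (hj : InCase T j) : i = j := by
  obtain ⟨Ψ, hΨ, hinv, -⟩ := hΦ.exists_inverse
  have hST : S =ᶠ[𝓝 0] T ∘ Ψ := by
    filter_upwards [hinv, hΨ.tendsto.eventually hTS] with z hz hz'
    simp only [Function.comp_apply, id_eq] at hz hz' ⊢
    rw [hz', hz]
  have hbS := fun p q hp hq => hi.superadapted.not_bad hS.value_zero (p := p) (q := q) hp hq
  have hbT := fun p q hp hq => hj.superadapted.not_bad hT.value_zero (p := p) (q := q) hp hq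
  obtain ⟨α, β, γ, δ, h1⟩ := hΦ.change
  obtain ⟨α', β', γ', δ', h2⟩ := hΨ.change
  have hforth := h1.transfer hS.smooth hT.smooth hTS hbS hbT
  have hback := h2.transfer hT.smooth hS.smooth hST hbT hbS
  have hS1 : InCase T .case1 → InCase S .case1 := fun h =>
    ⟨hi.superadapted, bisectrixMeetsCompactEdge_iff.2 (hback.1 (bisectrixMeetsCompactEdge_iff.1 h.2))⟩
  have hT1 : InCase S .case1 → InCase T .case1 := fun h =>
    ⟨hj.superadapted,
      bisectrixMeetsCompactEdge_iff.2 (hforth.1 (bisectrixMeetsCompactEdge_iff.1 h.2))⟩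
  have hS2 : InCase T .case2 → InCase S .case2 := fun h =>
    ⟨hi.superadapted, (hback.2 h.2.diagonalVertex).bisectrixMeetsVertex⟩
  have hT2 : InCase S .case2 → InCase T .case2 := fun h =>
    ⟨hj.superadapted, (hforth.2 h.2.diagonalVertex).bisectrixMeetsVertex⟩
  cases i with
  | case1 => exact inCase_unique (hT1 hi) hj
  | case2 => exact inCase_unique (hT2 hi) hj
  | case3 =>
    cases j with
    | case1 => exact inCase_unique hi (hS1 hj)
    | case2 => exact inCase_unique hi (hS2 hj)
    | case3 => rfl

/-- The swap preserves the absence of bad sides, so some case holds afterwards; `inCase_congr`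
identifies it, with no separate argument on reflected polygons. -/
theorem InCase.comp_swap {S : ℝ × ℝ → ℝ} (hS : IsPhase S) {i : SuperadaptedCase}
    (hi : InCase S i) : InCase (S ∘ Prod.swap) i := by
  have hT := hS.comp isCoordChange_swap
  have hsup : Superadapted (S ∘ Prod.swap) := superadapted_of_not_bad
    (not_bad_swap hS.smooth fun p q hp hq => hi.superadapted.not_bad hS.value_zero hp hq)
  obtain ⟨j, hj⟩ := exists_inCase hT.taylor_ne_zero hsup
  rwa [inCase_congr hS hT isCoordChange_swap EventuallyEq.rfl hi hj]

theorem BisectrixMeetsVertex.comp_swap {S : ℝ × ℝ → ℝ} (hS : SmoothNear S 0)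
    (h : BisectrixMeetsVertex S) : BisectrixMeetsVertex (S ∘ Prod.swap) := by
  refine DiagonalVertex.bisectrixMeetsVertex ?_
  rw [hS.taylorCoeff_swap]
  exact h.diagonalVertex.swap

/-- The coordinate changes `σ` and `σ ∘ τ` put `S` into superadapted coordinates. -/
def Resolves (S : ℝ × ℝ → ℝ) (σ τ : ℝ × ℝ → ℝ × ℝ) : Prop :=
  InCase (S ∘ σ) .case1 ∨ InCase (S ∘ σ) .case3 ∨
    (BisectrixMeetsVertex (S ∘ σ) ∧ InCase (S ∘ σ ∘ τ) .case2)

theorem resolves_id {S : ℝ × ℝ → ℝ} {σ : ℝ × ℝ → ℝ × ℝ} (hS : IsPhase (S ∘ σ))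
    (h : ∀ p q, 0 < p → 0 < q → ¬ Bad (taylorCoeff (S ∘ σ)) p q) : Resolves S σ id := by
  obtain ⟨i, hi⟩ := exists_inCase hS.taylor_ne_zero (superadapted_of_not_bad h)
  cases i with
  | case1 => exact Or.inl hi
  | case2 => exact Or.inr (Or.inr ⟨hi.2, hi⟩)
  | case3 => exact Or.inr (Or.inl hi)

theorem exists_resolves_of_bad {S : ℝ × ℝ → ℝ} (hS : IsPhase S) {p q : ℕ} (hp : 0 < p)
    (hpq : p ≤ q) (hB : Bad (taylorCoeff S) p q) :
    ∃ σ τ, IsVerticalShear σ ∧ IsHorizontalShear τ ∧ Resolves S σ τ := by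
  obtain ⟨a, ha, ha0, h⟩ := exists_shears_of_bad hS.smooth hS.value_zero hp hpq hB
  have hσ := isVerticalShear_vShear ha ha0
  rcases h with h | ⟨h1, b, hb, hb0, h2, h3⟩
  · exact ⟨_, _, hσ, isHorizontalShear_id, resolves_id (hS.comp hσ.isCoordChange) h⟩
  · have hτ := isVerticalShear_vShear hb hb0
    refine ⟨_, _, hσ, hτ.conj_swap, Or.inr (Or.inr ⟨h1.bisectrixMeetsVertex, ?_⟩)⟩
    have hph : IsPhase (S ∘ vShear a ∘ Prod.swap ∘ vShear b) :=
      hS.comp (hσ.isCoordChange.comp (isCoordChange_swap.comp hτ.isCoordChange))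
    exact InCase.comp_swap (i := .case2) hph
      ⟨superadapted_of_not_bad h3, h2.bisectrixMeetsVertex⟩

theorem Resolves.conj_swap {S : ℝ × ℝ → ℝ} (hS : IsPhase S) {σ τ : ℝ × ℝ → ℝ × ℝ}
    (hσ : IsCoordChange σ) (hτ : IsCoordChange τ) (h : Resolves (S ∘ Prod.swap) σ τ) :
    Resolves S (Prod.swap ∘ σ ∘ Prod.swap) (Prod.swap ∘ τ ∘ Prod.swap) := by
  have h1 : IsPhase ((S ∘ Prod.swap) ∘ σ) := (hS.comp isCoordChange_swap).comp hσ
  have h2 : IsPhase ((S ∘ Prod.swap) ∘ σ ∘ τ) :=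
    (hS.comp isCoordChange_swap).comp (hσ.comp hτ)
  have e1 : S ∘ Prod.swap ∘ σ ∘ Prod.swap = ((S ∘ Prod.swap) ∘ σ) ∘ Prod.swap := rfl
  have e2 : S ∘ (Prod.swap ∘ σ ∘ Prod.swap) ∘ (Prod.swap ∘ τ ∘ Prod.swap) =
      ((S ∘ Prod.swap) ∘ σ ∘ τ) ∘ Prod.swap := by
    funext z
    simp
  rw [Resolves, e1, e2]
  rcases h with h | h | ⟨h, h'⟩
  · exact Or.inl (InCase.comp_swap h1 h)
  · exact Or.inr (Or.inl (InCase.comp_swap h1 h))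
  · exact Or.inr (Or.inr ⟨h.comp_swap h1.smooth, InCase.comp_swap h2 h'⟩)

/-- The swap reduces to a bad normal with p ≤ q; this decides whether the vertical or the horizontal
shear comes first. -/
theorem exists_resolves {S : ℝ × ℝ → ℝ} (hS : IsPhase S) : ∃ σ τ,
    ((IsVerticalShear σ ∧ IsHorizontalShear τ) ∨ (IsHorizontalShear σ ∧ IsVerticalShear τ)) ∧
      Resolves S σ τ := by
  by_cases h : ∃ p q, 0 < p ∧ 0 < q ∧ Bad (taylorCoeff S) p q
  · obtain ⟨p, q, hp, hq, hB⟩ := h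
    rcases le_total p q with hpq | hqp
    · obtain ⟨σ, τ, hσ, hτ, h⟩ := exists_resolves_of_bad hS hp hpq hB
      exact ⟨σ, τ, Or.inl ⟨hσ, hτ⟩, h⟩
    · have hB' : Bad (taylorCoeff (S ∘ Prod.swap)) q p := by
        rw [hS.smooth.taylorCoeff_swap]
        exact hB.swap hp hq
      obtain ⟨σ, τ, hσ, hτ, h⟩ :=
        exists_resolves_of_bad (hS.comp isCoordChange_swap) hq hqp hB'
      exact ⟨_, _, Or.inr ⟨hσ.conj_swap, hτ.conj_swap⟩,
        h.conj_swap hS hσ.isCoordChange hτ.isCoordChange⟩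
  · push Not at h
    exact ⟨id, id, Or.inl ⟨isVerticalShear_id, isHorizontalShear_id⟩, resolves_id hS h⟩

theorem existsUnique_inCase {S : ℝ × ℝ → ℝ} (hS : IsPhase S) :
    ∃! i, ∃ Φ : ℝ × ℝ → ℝ × ℝ, IsCoordChange Φ ∧ InCase (S ∘ Φ) i := by
  obtain ⟨σ, τ, hστ, h⟩ := exists_resolves hS
  have hσ : IsCoordChange σ := by
    rcases hστ with h | h
    · exact h.1.isCoordChange
    · exact h.1.isCoordChange
  have hτ : IsCoordChange τ := by
    rcases hστ with h | h
    · exact h.2.isCoordChange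
    · exact h.2.isCoordChange
  refine existsUnique_of_exists_of_unique ?_ ?_
  · rcases h with h | h | ⟨-, h⟩
    · exact ⟨_, σ, hσ, h⟩
    · exact ⟨_, σ, hσ, h⟩
    · exact ⟨_, σ ∘ τ, hσ.comp hτ, h⟩
  · rintro i j ⟨Φ, hΦ, hi⟩ ⟨Ψ, hΨ, hj⟩
    obtain ⟨Φ', hΦ', hinv, -⟩ := hΦ.exists_inverse
    refine inCase_congr (hS.comp hΦ) (hS.comp hΨ) (hΦ'.comp hΨ) ?_ hi hj
    filter_upwards [hΨ.tendsto.eventually hinv] with z hz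
    simp only [Function.comp_apply, id_eq] at hz ⊢
    rw [hz]

end NewtonPhase

end

theorem lemma1p5 (S : ℝ × ℝ → ℝ) (hS : NewtonPhase.IsDegeneratePhase S) :
    (∃ σ τ : ℝ × ℝ → ℝ × ℝ,
      ((NewtonPhase.IsVerticalShear σ ∧ NewtonPhase.IsHorizontalShear τ) ∨
        (NewtonPhase.IsHorizontalShear σ ∧ NewtonPhase.IsVerticalShear τ)) ∧
      (NewtonPhase.InCase (S ∘ σ) .case1 ∨
        NewtonPhase.InCase (S ∘ σ) .case3 ∨
        (NewtonPhase.BisectrixMeetsVertex (S ∘ σ) ∧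
          NewtonPhase.InCase (S ∘ σ ∘ τ) .case2))) ∧
    ∃! i : NewtonPhase.SuperadaptedCase,
      ∃ Φ : ℝ × ℝ → ℝ × ℝ, NewtonPhase.IsCoordChange Φ ∧ NewtonPhase.InCase (S ∘ Φ) i := by
  have h : NewtonPhase.IsPhase S := ⟨hS.smooth, hS.value_zero, hS.taylor_ne_zero⟩
  exact ⟨NewtonPhase.exists_resolves h, NewtonPhase.existsUnique_inCase h⟩
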